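/- Let $k$ be a field of characteristic $0$, let $n\ge 3$ and $l\ge 1$, and let $k[\mathbf x]=k[x_1,\dots,x_n]$. Let $\mathrm{Aff}_n(k)$ be the group of affine automorphisms of the $k$-algebra $k[\mathbf x]$ (those with $(\phi(x_1),\dots,\phi(x_n))=(x_1,\dots,x_n)A+\mathbf b$, $A\in GL_n(k)$, $\mathbf b\in k^n$), $\mathrm{BA}_n(k)$ the group of triangular automorphisms ($\phi(x_i)=a_ix_i+g_i$ with $a_i\in k^*$, $g_i\in k[x_1,\dots,x_{i-1}]$), $\mathrm{TA}_n(k)=\langle \mathrm{Aff}_n(k),\mathrm{BA}_n(k)\rangle$ the tame subgroup, and $\mathrm{Tr}_n(k)=\{\tau_{\mathbf a}\mid \mathbf a\in k^n\}$ the group of translations $\tau_{\mathbf a}(x_i)=x_i+a_i$. Put $$D=\sum_{j=1}^{n-1}(n-j)x_{j+1}\frac{\partial}{\partial x_j},\qquad D'=\sum_{j=2}^{n}(j-1)x_{j-1}\frac{\partial}{\partial x_j},$$ and, for $m\ge 2$, $$f_{[2m-1]}=\frac12\sum_{i=1}^{2m-1}(-1)^{i-1}\binom{2m-2}{i-1}x_ix_{2m-i},\qquad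 f_{[2m]}=D(f_{[2m-1]})^2-2D^2(f_{[2m-1]})\,f_{[2m-1]},$$ where in the second formula $D$ is the derivation for $n=2m$ and $f_{[2m-1]}$ is regarded as a polynomial in $x_1,\dots,x_{2m}$. For a locally nilpotent $k$-derivation $E$ of $k[\mathbf x]$ (every $g$ satisfies $E^r(g)=0$ for some $r\geq 1$) let $\exp E$ be the automorphism $g\mapsto\sum_{i\ge0}E^i(g)/i!$. Then $f_{[n]}^lD$, $D'$ and $-f_{[n]}^lD$ are locally nilpotent, and the automorphism $$\phi=\exp(f_{[n]}^lD)\circ\exp(D')\circ\exp(-f_{[n]}^lD)$$ of $k[\mathbf x]$ has the following properties. (i) $\phi$ is co-tame: $\langle\phi,\mathrm{Aff}_n(k)\rangle\supset\mathrm{TA}_n(k)$. (ii) $G=\langle\phi,\mathrm{Tr}_n(k)\rangle$ is the free product of its subgroups $\langle\phi\rangle$ and $\mathrm{Tr}_n(k)$, and $G\cap\mathrm{Aff}_n(k)=\mathrm{Tr}_n(k)$. Moreover, $\phi^{i_1}\circ\tau_{\mathbf a_1}\circ\phi^{i_2}\circ\cdots\circ\tau_{\mathbf a_{s-1}}\circ\phi^{i_s}\notin\mathrm{Aff}_n(k)$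 for all $s\ge1$, $i_1,\dots,i_s\in\mathbb Z\setminus\{0\}$ and $\mathbf a_1,\dots,\mathbf a_{s-1}\in k^n\setminus\{0\}$. Consequently, let $\mathrm{EL}_n$ be the set of all non-affine automorphisms $\psi$ of $k[\mathbf x]$ for which there is $\mathbf a\in k^n\setminus\{0\}$ such that $\psi\circ\tau_{c\mathbf a}\circ\psi^{-1}\in\mathrm{Aff}_n(k)$ for all $c\in k$. Then $\langle\phi,\mathrm{Tr}_n(k)\rangle\cap\mathrm{EL}_n=\emptyset$, that is, $\phi$ does not belong to the closure $\{g\mid\langle g,\mathrm{Tr}_n(k)\rangle\cap \mathrm{EL}_n\ne\emptyset\}$ of $\mathrm{EL}_n$ relative to $\mathrm{Tr}_n(k)$. -/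

import Mathlib

open MvPolynomial

noncomputable section

namespace CoTame

/-! ### Exponentials of locally nilpotent derivations -/

section Exponential

variable {k A : Type*} [Field k] [CommRing A] [Algebra k A]

/-- A derivation `D` is locally nilpotent if every element is killed by some power of `D`. -/
def IsLocallyNilpotent (D : Derivation k A A) : Prop :=
  ∀ g : A, ∃ m : ℕ, D^[m] g = 0

/-- The sum `∑ i, D ^ i (g) / i!`, which has only finitely many nonzero terms
when `D` is locally nilpotent. -/
def expFun (D : Derivation k A A) (g : A) : A :=
  ∑ᶠ i : ℕ, ((i.factorial : k)⁻¹) • D^[i] g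

theorem iterate_eq_zero (D : Derivation k A A) {g : A} {m i : ℕ} (h : D^[m] g = 0)
    (hi : m ≤ i) : D^[i] g = 0 := by
  obtain ⟨j, rfl⟩ := Nat.exists_eq_add_of_le hi
  rw [Nat.add_comm, Function.iterate_add_apply, h]
  exact iterate_map_zero D j

theorem expFun_eq_sum (D : Derivation k A A) {g : A} {m : ℕ} (h : D^[m] g = 0) :
    expFun D g = ∑ i ∈ Finset.range m, ((i.factorial : k)⁻¹) • D^[i] g := by
  apply finsum_eq_sum_of_support_subset
  intro i hi
  by_contra hm
  apply hi
  have hmi : m ≤ i := by simpa using hm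
  simp [iterate_eq_zero D h hmi]

theorem sum_range_range {M : Type*} [AddCommMonoid M] (F : ℕ → ℕ → M) (m : ℕ)
    (h1 : ∀ i j, m ≤ i → F i j = 0) (h2 : ∀ i j, m ≤ j → F i j = 0) :
    ∑ i ∈ Finset.range m, ∑ j ∈ Finset.range m, F i j =
      ∑ r ∈ Finset.range (2 * m), ∑ p ∈ Finset.HasAntidiagonal.antidiagonal r, F p.1 p.2 := by
  rw [← Finset.sum_product', Finset.sum_sigma']
  symm
  refine Finset.sum_bij_ne_zero (fun x _ _ => x.2) ?_ ?_ ?_ ?_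
  · rintro ⟨r, p⟩ _ hne
    simp only [Finset.mem_product, Finset.mem_range]
    constructor
    · by_contra hc
      exact hne (h1 _ _ (not_lt.mp hc))
    · by_contra hc
      exact hne (h2 _ _ (not_lt.mp hc))
  · rintro ⟨r, p⟩ hx _ ⟨r', p'⟩ hx' _ he
    simp only [Finset.mem_sigma, Finset.HasAntidiagonal.mem_antidiagonal] at hx hx' he
    subst he
    obtain rfl : r = r' := hx.2.symm.trans hx'.2
    rfl
  · rintro ⟨i, j⟩ hp hne
    simp only [Finset.mem_product, Finset.mem_range] at hp
    exact ⟨⟨i + j, (i, j)⟩, by simp; omega, hne, rfl⟩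
  · intros; rfl

theorem iterate_leibniz (D : Derivation k A A) (r : ℕ) (g h : A) :
    D^[r] (g * h) =
      ∑ p ∈ Finset.HasAntidiagonal.antidiagonal r, r.choose p.1 • (D^[p.1] g * D^[p.2] h) := by
  induction r with
  | zero => simp
  | succ r ih =>
    rw [Finset.sum_antidiagonal_choose_succ_nsmul (fun i j => D^[i] g * D^[j] h),
      Function.iterate_succ_apply', ih, map_sum, ← Finset.sum_add_distrib]
    refine Finset.sum_congr rfl fun p hp => ?_
    rw [map_nsmul, D.leibniz, smul_eq_mul, smul_eq_mul, ← Function.iterate_succ_apply' D,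
      ← Function.iterate_succ_apply' D, nsmul_add]
    have : r.choose p.1 = r.choose p.2 :=
      Nat.choose_symm_of_eq_add (Finset.HasAntidiagonal.mem_antidiagonal.mp hp).symm
    rw [this, mul_comm (D^[p.2] h)]

theorem choose_coeff [CharZero k] {r : ℕ} {p : ℕ × ℕ} (hp : p ∈ Finset.HasAntidiagonal.antidiagonal r) :
    ((r.factorial : k)⁻¹) * (r.choose p.1 : k) =
      ((p.1.factorial : k)⁻¹) * ((p.2.factorial : k)⁻¹) := by
  obtain rfl := (Finset.HasAntidiagonal.mem_antidiagonal.mp hp)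
  have h := Nat.add_choose_mul_factorial_mul_factorial p.1 p.2
  rw [← Nat.choose_symm_add] at h
  have h' : ((p.1 + p.2).choose p.1 : k) * p.1.factorial * p.2.factorial
      = (p.1 + p.2).factorial := by exact_mod_cast h
  have e1 : (p.1.factorial : k) ≠ 0 := by exact_mod_cast p.1.factorial_ne_zero
  have e2 : (p.2.factorial : k) ≠ 0 := by exact_mod_cast p.2.factorial_ne_zero
  have e3 : ((p.1 + p.2).factorial : k) ≠ 0 := by exact_mod_cast (p.1 + p.2).factorial_ne_zero
  field_simp
  linear_combination h'

theorem expFun_mul [CharZero k] {D : Derivation k A A} (hD : IsLocallyNilpotent D) (g h : A) :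
    expFun D (g * h) = expFun D g * expFun D h := by
  obtain ⟨a, ha⟩ := hD g
  obtain ⟨b, hb⟩ := hD h
  set m := max a b
  have hg : D^[m] g = 0 := iterate_eq_zero D ha (le_max_left _ _)
  have hh : D^[m] h = 0 := iterate_eq_zero D hb (le_max_right _ _)
  have key : ∀ r, ((r.factorial : k)⁻¹) • D^[r] (g * h) =
      ∑ p ∈ Finset.HasAntidiagonal.antidiagonal r, (((p.1.factorial : k)⁻¹) • D^[p.1] g) *
        (((p.2.factorial : k)⁻¹) • D^[p.2] h) := by
    intro r
    rw [iterate_leibniz, Finset.smul_sum]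
    refine Finset.sum_congr rfl fun p hp => ?_
    rw [smul_mul_smul_comm, ← choose_coeff hp, mul_smul, Nat.cast_smul_eq_nsmul]
  have hgh : D^[2 * m] (g * h) = 0 := by
    rw [iterate_leibniz]
    refine Finset.sum_eq_zero fun p hp => ?_
    have := Finset.HasAntidiagonal.mem_antidiagonal.mp hp
    rcases le_total m p.1 with h1 | h1
    · simp [iterate_eq_zero D hg h1]
    · simp [iterate_eq_zero D hh (show m ≤ p.2 by omega)]
  rw [expFun_eq_sum D hgh, expFun_eq_sum D hg, expFun_eq_sum D hh, Finset.sum_mul_sum,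
    sum_range_range]
  · exact Finset.sum_congr rfl fun r _ => key r
  · intro i j hi; simp [iterate_eq_zero D hg hi]
  · intro i j hj; simp [iterate_eq_zero D hh hj]

theorem expFun_add {D : Derivation k A A} (hD : IsLocallyNilpotent D) (g h : A) :
    expFun D (g + h) = expFun D g + expFun D h := by
  obtain ⟨a, ha⟩ := hD g
  obtain ⟨b, hb⟩ := hD h
  have hg : D^[max a b] g = 0 := iterate_eq_zero D ha (le_max_left _ _)
  have hh : D^[max a b] h = 0 := iterate_eq_zero D hb (le_max_right _ _)
  have hgh : D^[max a b] (g + h) = 0 := by rw [iterate_map_add, hg, hh, add_zero]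
  rw [expFun_eq_sum D hgh, expFun_eq_sum D hg, expFun_eq_sum D hh, ← Finset.sum_add_distrib]
  simp [iterate_map_add]

theorem expFun_algebraMap (D : Derivation k A A) (c : k) :
    expFun D (algebraMap k A c) = algebraMap k A c := by
  rw [expFun_eq_sum D (m := 1) (by simp)]
  simp

theorem iterate_neg_apply (D : Derivation k A A) (i : ℕ) (g : A) :
    (-D)^[i] g = ((-1 : k) ^ i) • D^[i] g := by
  induction i with
  | zero => simp
  | succ i ih =>
    rw [Function.iterate_succ_apply', ih, Function.iterate_succ_apply', Derivation.neg_apply,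
      Derivation.map_smul, pow_succ]
    simp

theorem IsLocallyNilpotent.neg {D : Derivation k A A} (hD : IsLocallyNilpotent D) :
    IsLocallyNilpotent (-D) := by
  intro g
  obtain ⟨m, hm⟩ := hD g
  exact ⟨m, by rw [iterate_neg_apply, hm, smul_zero]⟩

/-- `exp D` as an algebra homomorphism. -/
def expHom [CharZero k] (D : Derivation k A A) (hD : IsLocallyNilpotent D) : A →ₐ[k] A where
  toFun := expFun D
  map_one' := by simpa using expFun_algebraMap D (1 : k)
  map_mul' := expFun_mul hD
  map_zero' := by simpa using expFun_algebraMap D (0 : k)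
  map_add' := expFun_add hD
  commutes' := expFun_algebraMap D

theorem iterate_smul (D : Derivation k A A) (i : ℕ) (c : k) (g : A) :
    D^[i] (c • g) = c • D^[i] g := by
  induction i with
  | zero => rfl
  | succ i ih => rw [Function.iterate_succ_apply', ih, Function.iterate_succ_apply', D.map_smul]

theorem sum_antidiagonal_sign [CharZero k] (r : ℕ) :
    ∑ p ∈ Finset.HasAntidiagonal.antidiagonal r,
      ((p.1.factorial : k)⁻¹) * ((-1) ^ p.2 * ((p.2.factorial : k)⁻¹)) =
      if r = 0 then 1 else 0 := by
  have h1 : ∀ p ∈ Finset.HasAntidiagonal.antidiagonal r,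
      ((p.1.factorial : k)⁻¹) * ((-1) ^ p.2 * ((p.2.factorial : k)⁻¹)) =
        ((r.factorial : k)⁻¹) * ((1 : k) ^ p.1 * (-1) ^ p.2 * (r.choose p.1 : k)) := by
    intro p hp
    linear_combination (-(-1) ^ p.2) * choose_coeff (k := k) hp
  rw [Finset.sum_congr rfl h1, ← Finset.mul_sum]
  have h2 := add_pow (1 : k) (-1) r
  rw [Finset.Nat.sum_antidiagonal_eq_sum_range_succ
    (fun i j => (1 : k) ^ i * (-1) ^ j * (r.choose i : k)), ← h2]
  rcases r with _ | r <;> simp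

theorem expFun_expFun_neg [CharZero k] {D : Derivation k A A} (hD : IsLocallyNilpotent D) (g : A) :
    expFun D (expFun (-D) g) = g := by
  obtain ⟨m, hm⟩ := hD g
  have hm' : (-D)^[m] g = 0 := by rw [iterate_neg_apply, hm, smul_zero]
  change expHom D hD (expFun (-D) g) = g
  rw [expFun_eq_sum _ hm', map_sum]
  have h1 : ∀ j, expHom D hD (((j.factorial : k)⁻¹) • (-D)^[j] g) =
      ∑ i ∈ Finset.range m,
        (((i.factorial : k)⁻¹) * ((-1) ^ j * ((j.factorial : k)⁻¹))) • D^[i + j] g := by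
    intro j
    have hz : D^[m] (D^[j] g) = 0 := by
      rw [← Function.iterate_add_apply]
      exact iterate_eq_zero D hm (by omega)
    rw [map_smul, iterate_neg_apply, map_smul]
    change _ • _ • expFun D (D^[j] g) = _
    rw [expFun_eq_sum D hz, Finset.smul_sum, Finset.smul_sum]
    refine Finset.sum_congr rfl fun i _ => ?_
    rw [smul_smul, smul_smul, ← Function.iterate_add_apply]
    congr 1
    ring
  rw [Finset.sum_congr rfl fun j _ => h1 j, Finset.sum_comm, sum_range_range]
  · have h2 : ∀ r, ∑ p ∈ Finset.HasAntidiagonal.antidiagonal r,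
        (((p.1.factorial : k)⁻¹) * ((-1) ^ p.2 * ((p.2.factorial : k)⁻¹))) • D^[p.1 + p.2] g =
        if r = 0 then g else 0 := by
      intro r
      have : ∀ p ∈ Finset.HasAntidiagonal.antidiagonal r,
          (((p.1.factorial : k)⁻¹) * ((-1) ^ p.2 * ((p.2.factorial : k)⁻¹))) • D^[p.1 + p.2] g
          = (((p.1.factorial : k)⁻¹) * ((-1) ^ p.2 * ((p.2.factorial : k)⁻¹))) • D^[r] g := by
        intro p hp
        rw [Finset.HasAntidiagonal.mem_antidiagonal.mp hp]
      rw [Finset.sum_congr rfl this, ← Finset.sum_smul, sum_antidiagonal_sign]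
      split_ifs with h
      · simp [h]
      · simp
    rw [Finset.sum_congr rfl fun r _ => h2 r]
    rcases m with _ | m
    · simpa using hm.symm
    · simp
  · intro i j hi; rw [iterate_eq_zero D hm (by omega), smul_zero]
  · intro i j hj; rw [iterate_eq_zero D hm (by omega), smul_zero]

/-- The exponential automorphism `exp D`, `g ↦ ∑ i, D ^ i (g) / i!`, of a locally nilpotent
derivation `D`. -/
def expAut [CharZero k] (D : Derivation k A A) (hD : IsLocallyNilpotent D) : A ≃ₐ[k] A :=
  AlgEquiv.ofAlgHom (expHom D hD) (expHom (-D) hD.neg)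
    (by ext g; exact expFun_expFun_neg hD g)
    (by
      ext g
      have := expFun_expFun_neg hD.neg g
      rwa [neg_neg] at this)

theorem expAut_apply [CharZero k] (D : Derivation k A A) (hD : IsLocallyNilpotent D) (g : A) :
    expAut D hD g = ∑ᶠ i : ℕ, ((i.factorial : k)⁻¹) • D^[i] g := rfl

end Exponential

/-! ### Groups of polynomial automorphisms -/

section Automorphisms

variable (k : Type*) [Field k] (n : ℕ)

/-- The group `Aut_k k[x₁, …, xₙ]`; multiplication is composition of maps. -/
abbrev PolyAut := MvPolynomial (Fin n) k ≃ₐ[k] MvPolynomial (Fin n) k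

/-- The affine automorphisms: `(φ(x₁), …, φ(xₙ)) = (x₁, …, xₙ) A + b` with `A` invertible. -/
def Aff : Set (PolyAut k n) :=
  {φ | ∃ (A : GL (Fin n) k) (b : Fin n → k),
    ∀ i, φ (X i) = (∑ j, C ((A : Matrix (Fin n) (Fin n) k) j i) * X j) + C (b i)}

/-- The triangular automorphisms: `φ(xᵢ) = aᵢ xᵢ + fᵢ` with `aᵢ ∈ k*` and
`fᵢ ∈ k[x₁, …, xᵢ₋₁]`. -/
def BA : Set (PolyAut k n) :=
  {φ | ∃ (a : Fin n → k) (f : Fin n → MvPolynomial (Fin n) k),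
    (∀ i, a i ≠ 0) ∧ (∀ i, f i ∈ MvPolynomial.supported k {j : Fin n | j < i}) ∧
      ∀ i, φ (X i) = C (a i) * X i + f i}

/-- The tame subgroup. -/
def TA : Subgroup (PolyAut k n) := Subgroup.closure (Aff k n ∪ BA k n)

variable {k n}

/-- The translation `τ_a : xᵢ ↦ xᵢ + aᵢ`. -/
def translation (a : Fin n → k) : PolyAut k n :=
  AlgEquiv.ofAlgHom (aeval fun i => X i + C (a i)) (aeval fun i => X i - C (a i))
    (by ext i; simp [algebraMap_eq]) (by ext i; simp [algebraMap_eq])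

theorem translation_X (a : Fin n → k) (i : Fin n) :
    translation a (X i) = X i + C (a i) := by
  simp [translation]

theorem ext_X {φ ψ : PolyAut k n} (h : ∀ i, φ (X i) = ψ (X i)) : φ = ψ := by
  have : (φ : MvPolynomial (Fin n) k →ₐ[k] MvPolynomial (Fin n) k) = ψ :=
    MvPolynomial.algHom_ext (by simpa using h)
  exact AlgEquiv.ext fun p => DFunLike.congr_fun this p

theorem translation_mul (a b : Fin n → k) :
    translation a * translation b = translation (a + b) := by
  apply ext_X
  intro i
  have hC : ∀ c : k, translation a (C c) = C c := fun c => (translation a).commutes c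
  simp only [AlgEquiv.mul_apply, translation_X, map_add, hC, Pi.add_apply]
  ring

theorem translation_zero : translation (0 : Fin n → k) = 1 := by
  apply ext_X
  intro i
  simp [translation_X]

variable (k n)

/-- The group of translations. -/
def Tr : Subgroup (PolyAut k n) where
  carrier := Set.range translation
  mul_mem' := by
    rintro _ _ ⟨a, rfl⟩ ⟨b, rfl⟩
    exact ⟨a + b, (translation_mul a b).symm⟩
  one_mem' := ⟨0, translation_zero⟩
  inv_mem' := by
    rintro _ ⟨a, rfl⟩
    refine ⟨-a, eq_inv_of_mul_eq_one_left ?_⟩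
    rw [translation_mul, neg_add_cancel, translation_zero]

variable {k n}

/-- `φ` is co-tame if `φ` and the affine automorphisms generate a group containing every tame
automorphism. -/
def IsCoTame (φ : PolyAut k n) : Prop :=
  TA k n ≤ Subgroup.closure ({φ} ∪ Aff k n)

variable (k n)

/-- The set `EL_n` of non-affine automorphisms `φ` such that, for some nonzero vector `a`, the
conjugates `φ ∘ τ_b ∘ φ⁻¹` of all the translations with `b` on the line `k a` are affine. -/
def EL : Set (PolyAut k n) :=
  {φ | φ ∉ Aff k n ∧ ∃ a : Fin n → k, a ≠ 0 ∧
    ∀ c : k, φ * translation (c • a) * φ⁻¹ ∈ Aff k n}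

end Automorphisms

section Groups

variable {Γ : Type*} [Group Γ]

/-- The closure of `S` relative to the subgroup `H`: all `g` such that `⟨g, H⟩` meets `S`. -/
def kurodaClosure (H : Subgroup Γ) (S : Set Γ) : Set Γ :=
  {g | ((Subgroup.closure ({g} ∪ (H : Set Γ)) : Set Γ) ∩ S).Nonempty}

/-- `G` is the (internal) free product of its subgroups `H` and `K`: the canonical homomorphism
`H * K → Γ` is injective with image `G`. -/
def IsFreeProduct (G H K : Subgroup Γ) : Prop :=
  Function.Injective (Monoid.Coprod.lift H.subtype K.subtype) ∧
    (Monoid.Coprod.lift H.subtype K.subtype).range = G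

end Groups

/-! ### The derivations `D`, `D'` and the polynomial `f_[n]` -/

section Construction

variable (k : Type*) [Field k] (n : ℕ)

/-- The variable `xᵢ` with the usual numbering `1 ≤ i ≤ n` (and `0` for other `i`). -/
def x (i : ℕ) : MvPolynomial (Fin n) k :=
  if h : 1 ≤ i ∧ i ≤ n then X ⟨i - 1, by omega⟩ else 0

/-- `D = ∑_{j=1}^{n-1} (n - j) x_{j+1} ∂/∂x_j`; the entry `j : Fin n` is the variable
`x_{j+1}`. -/
def D : Derivation k (MvPolynomial (Fin n) k) (MvPolynomial (Fin n) k) :=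
  mkDerivation k fun j => C ((n : k) - ((j : ℕ) + 1)) * x k n ((j : ℕ) + 2)

/-- `D' = ∑_{j=2}^{n} (j - 1) x_{j-1} ∂/∂x_j`; the entry `j : Fin n` is the variable
`x_{j+1}`. -/
def D' : Derivation k (MvPolynomial (Fin n) k) (MvPolynomial (Fin n) k) :=
  mkDerivation k fun j => C ((j : ℕ) : k) * x k n (j : ℕ)

/-- The quadratic form `(1/2) ∑_{i=1}^{2m-1} (-1)^(i-1) binom(2m-2, i-1) x_i x_{2m-i}`, which is
`f_[2m-1]`, as a polynomial in `x₁, …, xₙ`. -/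
def fOdd (m : ℕ) : MvPolynomial (Fin n) k :=
  C (1 / 2 : k) * ∑ i ∈ Finset.Icc 1 (2 * m - 1),
    C ((-1) ^ (i - 1) * ((2 * m - 2).choose (i - 1) : k)) * x k n i * x k n (2 * m - i)

/-- The polynomial `f_[n]`: for `n = 2m - 1` it is the quadratic form above, and for `n = 2m` it
is `D(f_[2m-1])² - 2 D²(f_[2m-1]) f_[2m-1]`. -/
def f : MvPolynomial (Fin n) k :=
  if Odd n then fOdd k n ((n + 1) / 2)
  else D k n (fOdd k n (n / 2)) ^ 2 -
    2 * D k n (D k n (fOdd k n (n / 2))) * fOdd k n (n / 2)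

end Construction

end CoTame

end

/-! Everything rests on `D`, `D'` and `H = [D, D']` forming an `sl₂`-triple of linear derivations
which all kill `f`. Write `κ` for half the degree of `f`, `σ = exp (f ^ l D)` and `ε = exp D'`, so
that `φ ^ i = σ ε ^ i σ⁻¹`.

Co-tameness. In `SL₂` a product lower-upper-lower can be upper triangular: `b = ε exp (-3/2 D) ε²`
is affine, fixes `f` and conjugates `D` to `4 D`. As `B = exp (-3/2 D)` is affine and commutes with
`σ`, the product `φ B φ² b⁻¹` collapses to `σ (b σ⁻¹ b⁻¹) = exp (-3 f ^ l D)` (`f_pow_mem_kerExp`).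
Translations in `x₁` commute with `D`, so iterated differences in `x₁` replace `f ^ l` by its
leading coefficient, a multiple of `x_n ^ (κ l)` (`X_last_pow_mem_kerExp`). Conjugating `x₁ ↦ x₁ +
x_{n-1}` by the resulting exponential gives the non-affine `x₁ ↦ x₁ + x_n ^ (κ l + 1)`. Polarisation
and substitution then yield every elementary automorphism, hence every triangular one (`BA_subset`).

Free product. Automorphisms act on points with coordinates in `k[s]`. Weight and degree force `f` to
be `x₁ ^ κ x_n ^ κ` plus monomials that involve a middle variable, so `deg f(y)` is determined
whenever the degrees of the middle coordinates lie strictly below the chord joining those of the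
extreme ones. The invariant `Growing` is preserved by a nonzero power of `φ` followed by a nonzero
translation (`Growing.phi_zpow`). The value of `f` is unchanged by `φ`; it is the translation that
makes it grow, as computed in `degree_aeval_f_flow_add_flow`. Starting from the point `(s, 0, …, 0,
s)`, every alternating word sends `x_n` to something of degree greater than one, which no affine
automorphism does. The statements on free products, on the affine part and on `EL` are formal
consequences of this. -/

noncomputable section

namespace CoTame

/-! ### Flows of locally nilpotent derivations -/

section Flow

variable {k A R : Type*} [Field k] [CommRing A] [Algebra k A] [CommRing R] [Algebra k R]

/-- The time-`s` flow of `δ` applied to `p`, pushed forward along `e`: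
`∑ i, s ^ i e (δ ^ i p) / i!`. -/
def flowFun (δ : Derivation k A A) (e : A →ₐ[k] R) (s : R) (p : A) : R :=
  ∑ᶠ i : ℕ, ((i.factorial : k)⁻¹) • (s ^ i * e (δ^[i] p))

theorem flowFun_eq_sum (δ : Derivation k A A) (e : A →ₐ[k] R) (s : R) {p : A} {m : ℕ}
    (h : δ^[m] p = 0) : flowFun δ e s p =
      ∑ i ∈ Finset.range m, ((i.factorial : k)⁻¹) • (s ^ i * e (δ^[i] p)) := by
  apply finsum_eq_sum_of_support_subset
  intro i hi
  by_contra hm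
  apply hi
  have hmi : m ≤ i := by simpa using hm
  simp [iterate_eq_zero δ h hmi]

theorem flowFun_add {δ : Derivation k A A} (hδ : IsLocallyNilpotent δ) (e : A →ₐ[k] R) (s : R)
    (g h : A) : flowFun δ e s (g + h) = flowFun δ e s g + flowFun δ e s h := by
  obtain ⟨a, ha⟩ := hδ g
  obtain ⟨b, hb⟩ := hδ h
  have hg : δ^[max a b] g = 0 := iterate_eq_zero δ ha (le_max_left _ _)
  have hh : δ^[max a b] h = 0 := iterate_eq_zero δ hb (le_max_right _ _)
  have hgh : δ^[max a b] (g + h) = 0 := by rw [iterate_map_add, hg, hh, add_zero]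
  rw [flowFun_eq_sum δ e s hgh, flowFun_eq_sum δ e s hg, flowFun_eq_sum δ e s hh,
    ← Finset.sum_add_distrib]
  simp [iterate_map_add, mul_add]

theorem flowFun_algebraMap (δ : Derivation k A A) (e : A →ₐ[k] R) (s : R) (c : k) :
    flowFun δ e s (algebraMap k A c) = algebraMap k R c := by
  rw [flowFun_eq_sum δ e s (m := 1) (by simp)]
  simp

theorem flowFun_mul [CharZero k] {δ : Derivation k A A} (hδ : IsLocallyNilpotent δ)
    (e : A →ₐ[k] R) (s : R) (g h : A) :
    flowFun δ e s (g * h) = flowFun δ e s g * flowFun δ e s h := by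
  obtain ⟨a, ha⟩ := hδ g
  obtain ⟨b, hb⟩ := hδ h
  set m := max a b
  have hg : δ^[m] g = 0 := iterate_eq_zero δ ha (le_max_left _ _)
  have hh : δ^[m] h = 0 := iterate_eq_zero δ hb (le_max_right _ _)
  have key : ∀ r, ((r.factorial : k)⁻¹) • (s ^ r * e (δ^[r] (g * h))) =
      ∑ p ∈ Finset.HasAntidiagonal.antidiagonal r,
        (((p.1.factorial : k)⁻¹) • (s ^ p.1 * e (δ^[p.1] g))) *
        (((p.2.factorial : k)⁻¹) • (s ^ p.2 * e (δ^[p.2] h))) := by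
    intro r
    rw [iterate_leibniz, map_sum, Finset.mul_sum, Finset.smul_sum]
    refine Finset.sum_congr rfl fun p hp => ?_
    rw [smul_mul_smul_comm, ← choose_coeff hp, mul_smul, Nat.cast_smul_eq_nsmul, map_nsmul,
      map_mul, ← Finset.HasAntidiagonal.mem_antidiagonal.mp hp, pow_add, mul_smul_comm]
    congr 2
    ring
  have hgh : δ^[2 * m] (g * h) = 0 := by
    rw [iterate_leibniz]
    refine Finset.sum_eq_zero fun p hp => ?_
    have := Finset.HasAntidiagonal.mem_antidiagonal.mp hp
    rcases le_total m p.1 with h1 | h1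
    · simp [iterate_eq_zero δ hg h1]
    · simp [iterate_eq_zero δ hh (show m ≤ p.2 by omega)]
  rw [flowFun_eq_sum δ e s hgh, flowFun_eq_sum δ e s hg, flowFun_eq_sum δ e s hh,
    Finset.sum_mul_sum, sum_range_range]
  · exact Finset.sum_congr rfl fun r _ => key r
  · intro i j hi; simp [iterate_eq_zero δ hg hi]
  · intro i j hj; simp [iterate_eq_zero δ hh hj]

theorem iterate_smul_apply (δ : Derivation k A A) {g : A} (hg : δ g = 0) (i : ℕ) (p : A) :
    (g • δ)^[i] p = g ^ i * δ^[i] p := by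
  induction i with
  | zero => simp
  | succ i ih =>
    have : δ (g ^ i) = 0 := by simp [δ.leibniz_pow, hg]
    rw [Function.iterate_succ_apply', ih, Function.iterate_succ_apply', Derivation.smul_apply,
      δ.leibniz, this]
    simp only [smul_eq_mul]
    ring

theorem IsLocallyNilpotent.smul {δ : Derivation k A A} (hδ : IsLocallyNilpotent δ) {g : A}
    (hg : δ g = 0) : IsLocallyNilpotent (g • δ) := by
  intro p
  obtain ⟨m, hm⟩ := hδ p
  exact ⟨m, by rw [iterate_smul_apply δ hg, hm, mul_zero]⟩

variable [CharZero k]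

/-- The time-`s` flow of a locally nilpotent derivation, pushed forward along `e`. -/
def flow (δ : Derivation k A A) (hδ : IsLocallyNilpotent δ) (e : A →ₐ[k] R) (s : R) :
    A →ₐ[k] R where
  toFun := flowFun δ e s
  map_one' := by simpa using flowFun_algebraMap δ e s (1 : k)
  map_mul' := flowFun_mul hδ e s
  map_zero' := by simpa using flowFun_algebraMap δ e s (0 : k)
  map_add' := flowFun_add hδ e s
  commutes' := flowFun_algebraMap δ e s

theorem flow_eq_sum {δ : Derivation k A A} (hδ : IsLocallyNilpotent δ) (e : A →ₐ[k] R) (s : R)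
    {p : A} {m : ℕ} (h : δ^[m] p = 0) : flow δ hδ e s p =
      ∑ i ∈ Finset.range m, ((i.factorial : k)⁻¹) • (s ^ i * e (δ^[i] p)) :=
  flowFun_eq_sum δ e s h

theorem flow_of_mem_ker {δ : Derivation k A A} (hδ : IsLocallyNilpotent δ) (e : A →ₐ[k] R)
    (s : R) {p : A} (h : δ p = 0) : flow δ hδ e s p = e p := by
  rw [flow_eq_sum hδ e s (m := 1) h]
  simp

theorem flow_zero {δ : Derivation k A A} (hδ : IsLocallyNilpotent δ) (e : A →ₐ[k] R) :
    flow δ hδ e 0 = e := by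
  ext p
  obtain ⟨m, hm⟩ := hδ p
  rw [flow_eq_sum hδ e 0 (iterate_eq_zero δ hm (Nat.le_succ m)), Finset.sum_range_succ']
  simp

theorem flow_flow {δ : Derivation k A A} (hδ : IsLocallyNilpotent δ) (e : A →ₐ[k] R)
    (s t : R) : flow δ hδ (flow δ hδ e s) t = flow δ hδ e (s + t) := by
  ext p
  obtain ⟨m, hm⟩ := hδ p
  have hm2 : δ^[2 * m] p = 0 := iterate_eq_zero δ hm (by omega)
  rw [flow_eq_sum hδ _ t hm, flow_eq_sum hδ e _ hm2]
  have h1 : ∀ j, flow δ hδ e s (δ^[j] p) =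
      ∑ i ∈ Finset.range m, ((i.factorial : k)⁻¹) • (s ^ i * e (δ^[i + j] p)) := by
    intro j
    have hz : δ^[m] (δ^[j] p) = 0 := by
      rw [← Function.iterate_add_apply]
      exact iterate_eq_zero δ hm (by omega)
    rw [flow_eq_sum hδ e s hz]
    simp only [Function.iterate_add_apply]
  have h2 : ∀ i, ((i.factorial : k)⁻¹) • (t ^ i * flow δ hδ e s (δ^[i] p)) =
      ∑ j ∈ Finset.range m, (((j.factorial : k)⁻¹) * ((i.factorial : k)⁻¹)) •
        (s ^ j * t ^ i * e (δ^[j + i] p)) := by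
    intro i
    rw [h1, Finset.mul_sum, Finset.smul_sum]
    refine Finset.sum_congr rfl fun j _ => ?_
    rw [mul_smul_comm, smul_smul, mul_comm ((i.factorial : k)⁻¹)]
    congr 1
    ring
  rw [Finset.sum_congr rfl fun i _ => h2 i, Finset.sum_comm, sum_range_range]
  · refine Finset.sum_congr rfl fun r _ => ?_
    rw [(Commute.all s t).add_pow', Finset.sum_mul, Finset.smul_sum]
    refine Finset.sum_congr rfl fun q hq => ?_
    rw [← choose_coeff hq, Finset.HasAntidiagonal.mem_antidiagonal.mp hq, mul_smul,
      Nat.cast_smul_eq_nsmul, smul_mul_assoc]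
  · intro i j hi; rw [iterate_eq_zero δ hm (by omega)]; simp
  · intro i j hi; rw [iterate_eq_zero δ hm (by omega)]; simp

end Flow

/-! ### Exponentials of multiples of a locally nilpotent derivation -/

section ExpKernel

variable {k A R : Type*} [Field k] [CharZero k] [CommRing A] [Algebra k A] [CommRing R]
  [Algebra k R]

theorem expAut_eq_sum {δ : Derivation k A A} (hδ : IsLocallyNilpotent δ) {p : A} {m : ℕ}
    (h : δ^[m] p = 0) :
    expAut δ hδ p = ∑ i ∈ Finset.range m, ((i.factorial : k)⁻¹) • δ^[i] p :=
  expFun_eq_sum δ h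

theorem expAut_congr {δ ε : Derivation k A A} (h : δ = ε) (hδ : IsLocallyNilpotent δ)
    (hε : IsLocallyNilpotent ε) : expAut δ hδ = expAut ε hε := by
  subst h; rfl

/-- Since `δ g = 0`, the powers satisfy `(g δ) ^ i = g ^ i δ ^ i`; the coefficient `g` thus becomes
the time `e g` of a flow. This is how automorphisms are turned into motions of points. -/
theorem map_expAut_smul {δ : Derivation k A A} (hδ : IsLocallyNilpotent δ) {g : A}
    (hg : δ g = 0) (h : IsLocallyNilpotent (g • δ)) (e : A →ₐ[k] R) (p : A) :
    e (expAut (g • δ) h p) = flow δ hδ e (e g) p := by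
  obtain ⟨m, hm⟩ := hδ p
  rw [expAut_eq_sum h (by rw [iterate_smul_apply δ hg, hm, mul_zero]), flow_eq_sum hδ _ _ hm,
    map_sum]
  refine Finset.sum_congr rfl fun i _ => ?_
  rw [iterate_smul_apply δ hg, map_smul, map_mul, map_pow]

theorem expAut_of_mem_ker {δ : Derivation k A A} (hδ : IsLocallyNilpotent δ) {p : A}
    (h : δ p = 0) : expAut δ hδ p = p := by
  rw [expAut_eq_sum hδ (m := 1) h]
  simp

theorem expAut_smul_mul {δ : Derivation k A A} (hδ : IsLocallyNilpotent δ) {g h : A}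
    (hg : δ g = 0) (hh : δ h = 0) :
    expAut (g • δ) (hδ.smul hg) * expAut (h • δ) (hδ.smul hh) =
      expAut ((g + h) • δ) (hδ.smul (by rw [map_add, hg, hh, add_zero])) := by
  ext p
  have hgh : δ (g + h) = 0 := by rw [map_add, hg, hh, add_zero]
  have h1 := map_expAut_smul hδ hh (hδ.smul hh)
    (expAut (g • δ) (hδ.smul hg) : A ≃ₐ[k] A).toAlgHom p
  have h2 := map_expAut_smul hδ hgh (hδ.smul hgh) (AlgHom.id k A) p
  have h3 : (expAut (g • δ) (hδ.smul hg) : A ≃ₐ[k] A).toAlgHom = flow δ hδ (AlgHom.id k A) g := by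
    ext q
    exact map_expAut_smul hδ hg (hδ.smul hg) (AlgHom.id k A) q
  have h4 : (expAut (g • δ) (hδ.smul hg) : A ≃ₐ[k] A).toAlgHom h = h :=
    expAut_of_mem_ker _ (by simp [hh])
  refine (h1.trans ?_).trans h2.symm
  rw [h4, h3, flow_flow]
  rfl

/-- `g ↦ exp (g δ)` as a homomorphism from the additive group of the kernel of `δ`. -/
def expKer {δ : Derivation k A A} (hδ : IsLocallyNilpotent δ) :
    Multiplicative (LinearMap.ker (δ : A →ₗ[k] A)) →* (A ≃ₐ[k] A) :=
  MonoidHom.mk' (fun g => expAut ((g.toAdd : A) • δ) (hδ.smul g.toAdd.2))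
    fun g h => (expAut_smul_mul hδ g.toAdd.2 h.toAdd.2).symm

theorem expKer_ofAdd {δ : Derivation k A A} (hδ : IsLocallyNilpotent δ) {g : A}
    (hg : δ g = 0) :
    expKer hδ (Multiplicative.ofAdd ⟨g, hg⟩) = expAut (g • δ) (hδ.smul hg) := rfl

theorem expAut_smul_zpow {δ : Derivation k A A} (hδ : IsLocallyNilpotent δ) {g : A}
    (hg : δ g = 0) (i : ℤ) :
    expAut (g • δ) (hδ.smul hg) ^ i =
      expAut ((i • g) • δ) (hδ.smul (by rw [map_zsmul, hg, smul_zero])) := by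
  rw [← expKer_ofAdd hδ hg, ← map_zpow, ← ofAdd_zsmul]
  exact expKer_ofAdd hδ _

theorem expAut_smul_inv {δ : Derivation k A A} (hδ : IsLocallyNilpotent δ) {g : A}
    (hg : δ g = 0) :
    (expAut (g • δ) (hδ.smul hg))⁻¹ =
      expAut ((-g) • δ) (hδ.smul (by rw [map_neg, hg, neg_zero])) := by
  rw [← expKer_ofAdd hδ hg, ← map_inv, ← ofAdd_neg]
  exact expKer_ofAdd hδ _

theorem map_expAut_zpow {δ : Derivation k A A} (hδ : IsLocallyNilpotent δ)
    (e : A →ₐ[k] R) (i : ℤ) (p : A) :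
    e ((expAut δ hδ ^ i) p) = flow δ hδ e (i : R) p := by
  have h1 : δ (1 : A) = 0 := δ.map_one_eq_zero
  have hi : δ (i • (1 : A)) = 0 := by rw [map_zsmul, h1, smul_zero]
  -- Reading `δ` as `1 • δ` turns the exponent into a kernel coefficient, hence into the time `i`.
  rw [expAut_congr (one_smul A δ).symm hδ (hδ.smul h1), expAut_smul_zpow hδ h1,
    map_expAut_smul hδ hi]
  simp

theorem conj_expAut {δ ε : Derivation k A A} (hδ : IsLocallyNilpotent δ)
    (hε : IsLocallyNilpotent ε) (ψ : A ≃ₐ[k] A) (h : ∀ p, ψ (δ p) = ε (ψ p)) :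
    ψ * expAut δ hδ * ψ⁻¹ = expAut ε hε := by
  rw [mul_inv_eq_iff_eq_mul]
  ext p
  have hi : ∀ i, ψ (δ^[i] p) = ε^[i] (ψ p) := fun i =>
    Function.Semiconj.iterate_right (f := ψ) h i p
  obtain ⟨m, hm⟩ := hδ p
  change ψ (expAut δ hδ p) = expAut ε hε (ψ p)
  rw [expAut_eq_sum hδ hm, expAut_eq_sum hε (m := m) (by rw [← hi, hm, map_zero]), map_sum]
  simp [hi]

/-- If `ad E` acts nilpotently on `δ` through `δ → δ₁ → 2 δ₂ → 0`, then
`exp E ∘ δ = (δ + δ₁ + δ₂) ∘ exp E`. -/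
theorem expAut_apply_of_commutator {E : Derivation k A A} (hE : IsLocallyNilpotent E)
    (δ δ₁ δ₂ : A →ₗ[k] A) (h : ∀ p, E (δ p) = δ (E p) + δ₁ p)
    (h₁ : ∀ p, E (δ₁ p) = δ₁ (E p) + (2 : k) • δ₂ p) (h₂ : ∀ p, E (δ₂ p) = δ₂ (E p)) (p : A) :
    expAut E hE (δ p) =
      δ (expAut E hE p) + δ₁ (expAut E hE p) + δ₂ (expAut E hE p) := by
  set d : ℕ → A → A := fun i p => ((i.factorial : k)⁻¹) • E^[i] p with hd
  have d0 : ∀ p, d 0 p = p := by simp [hd]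
  have ds : ∀ i p, E (d i p) = ((i : k) + 1) • d (i + 1) p := by
    intro i p
    have h1 : ((i : k) + 1) ≠ 0 := by exact_mod_cast i.succ_ne_zero
    simp only [hd, Function.iterate_succ_apply', Derivation.map_smul, Nat.factorial_succ,
      smul_smul]
    congr 1
    push_cast
    have h2 : (i.factorial : k) ≠ 0 := by exact_mod_cast i.factorial_ne_zero
    field_simp
  have ds' : ∀ i p, d (i + 1) p = ((i : k) + 1)⁻¹ • E (d i p) := by
    intro i p
    have h1 : ((i : k) + 1) ≠ 0 := by exact_mod_cast i.succ_ne_zero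
    rw [ds, smul_smul, inv_mul_cancel₀ h1, one_smul]
  have d1 : ∀ p, d 1 p = E p := by intro p; rw [ds' 0, d0]; simp
  have key0 : d 1 (δ p) = δ (d 1 p) + δ₁ (d 0 p) := by rw [d1, d1, d0, h]
  -- Leibniz rule for the divided powers `E ^ i / i!`. Summing it over all `i` gives the claim;
  -- indices 0 and 1, with fewer terms, are split off below.
  have key : ∀ i, d (i + 2) (δ p) = δ (d (i + 2) p) + δ₁ (d (i + 1) p) + δ₂ (d i p) := by
    intro i
    induction i with
    | zero =>
      have h3 := ds 1 (δ p)
      rw [key0, map_add, h, h₁, ds 1 p, ds 0 p] at h3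
      rw [ds' 1, ds 1, h3.symm]
      simp only [map_smul, smul_add, smul_smul, d0]
      norm_num
      module
    | succ i ih =>
      rw [ds' (i + 2), ih, map_add, map_add, h, h₁, h₂, ds, ds, ds]
      have h1 : ((i : k) + 3) ≠ 0 := by exact_mod_cast (i + 2).succ_ne_zero
      have e3 : (((i + 2 : ℕ) : k) + 1) = (i : k) + 3 := by push_cast; ring
      have e2 : (((i + 1 : ℕ) : k) + 1) = (i : k) + 2 := by push_cast; ring
      rw [e3, e2]
      simp only [map_smul]
      rw [inv_smul_eq_iff₀ h1]
      module
  obtain ⟨m, hm⟩ := hE p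
  obtain ⟨m', hm'⟩ := hE (δ p)
  set M := max m m'
  have z : ∀ i, M ≤ i → d i p = 0 := fun i hi => by
    simp [hd, iterate_eq_zero E hm ((le_max_left _ _).trans hi)]
  have e0 : ∀ N, M ≤ N → expAut E hE p = ∑ i ∈ Finset.range N, d i p := fun N hN =>
    expAut_eq_sum hE (iterate_eq_zero E hm ((le_max_left _ _).trans hN))
  have e1 : expAut E hE (δ p) = ∑ i ∈ Finset.range (M + 2), d i (δ p) :=
    expAut_eq_sum hE (iterate_eq_zero E hm' ((le_max_right m m').trans (Nat.le_add_right M 2)))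
  rw [e1, Finset.sum_range_succ', Finset.sum_range_succ']
  simp only [key, zero_add, key0, d0, Finset.sum_add_distrib]
  have e2 : expAut E hE p = ∑ i ∈ Finset.range M, d (i + 2) p + d 1 p + p := by
    rw [e0 (M + 2) (by omega), Finset.sum_range_succ', Finset.sum_range_succ', d0]
  have e3 : expAut E hE p = ∑ i ∈ Finset.range M, d (i + 1) p + p := by
    rw [e0 (M + 1) (by omega), Finset.sum_range_succ', d0]
  rw [congrArg δ e2, congrArg δ₁ e3, congrArg δ₂ (e0 M le_rfl)]
  simp only [map_add, map_sum]
  abel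

end ExpKernel

/-! ### The `sl₂`-triple of derivations -/

section LocallyNilpotent

variable {k A : Type*} [Field k] [CommRing A] [Algebra k A]

theorem isLocallyNilpotent_of_X {σ : Type*}
    {δ : Derivation k (MvPolynomial σ k) (MvPolynomial σ k)}
    (h : ∀ i, ∃ m, δ^[m] (X i) = 0) : IsLocallyNilpotent δ := by
  intro p
  induction p using MvPolynomial.induction_on with
  | C c => exact ⟨1, δ.map_algebraMap c⟩
  | add p q hp hq =>
    obtain ⟨a, ha⟩ := hp
    obtain ⟨b, hb⟩ := hq
    exact ⟨max a b, by rw [iterate_map_add, iterate_eq_zero δ ha (le_max_left _ _),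
      iterate_eq_zero δ hb (le_max_right _ _), add_zero]⟩
  | mul_X p i hp =>
    obtain ⟨a, ha⟩ := hp
    obtain ⟨b, hb⟩ := h i
    refine ⟨a + b, ?_⟩
    rw [iterate_leibniz]
    refine Finset.sum_eq_zero fun r hr => ?_
    have := Finset.HasAntidiagonal.mem_antidiagonal.mp hr
    rcases le_total a r.1 with h1 | h1
    · simp [iterate_eq_zero δ ha h1]
    · simp [iterate_eq_zero δ hb (show b ≤ r.2 by omega)]

end LocallyNilpotent

section Triple

variable (k : Type*) [Field k] (n : ℕ)

theorem X_eq_x (i : Fin n) : (X i : MvPolynomial (Fin n) k) = x k n (i + 1) := by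
  have : 1 ≤ (i : ℕ) + 1 ∧ (i : ℕ) + 1 ≤ n := ⟨by omega, i.2⟩
  rw [x, dif_pos this]
  rfl

theorem x_succ_of_lt {j : ℕ} (h : j < n) : x k n (j + 1) = X ⟨j, h⟩ := (X_eq_x k n ⟨j, h⟩).symm

theorem x_zero : x k n 0 = 0 := by simp [x]

theorem x_of_lt {j : ℕ} (h : n < j) : x k n j = 0 := by
  rw [x, dif_neg (by omega)]

theorem D_x (j : ℕ) :
    D k n (x k n (j + 1)) = C ((n : k) - ((j : ℕ) + 1)) * x k n (j + 2) := by
  by_cases h : j < n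
  · rw [x_succ_of_lt k n h, D, mkDerivation_X]
  · rw [x_of_lt k n (by omega), x_of_lt k n (by omega), map_zero, mul_zero]

theorem D'_x {j : ℕ} (h : j < n) : D' k n (x k n (j + 1)) = C (j : k) * x k n j := by
  rw [x_succ_of_lt k n h, D', mkDerivation_X]

theorem D_iterate_x (j i : ℕ) :
    (D k n)^[i] (x k n (j + 1)) = (n - 1 - j).descFactorial i • x k n (j + i + 1) := by
  induction i with
  | zero => simp
  | succ i ih =>
    rw [Function.iterate_succ_apply', ih, map_nsmul, D_x, Nat.descFactorial_succ]
    -- Past the last variable `x` is zero by convention, so the truncated subtraction does no harm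
    -- there.
    by_cases hi : j + i + 1 < n
    · have : ((n - 1 - j - i : ℕ) : k) = (n : k) - ((j + i : ℕ) + 1) := by
        rw [Nat.sub_sub, Nat.sub_sub, Nat.cast_sub (by omega)]
        push_cast
        ring
      rw [← this, map_natCast, show j + (i + 1) + 1 = j + i + 2 by ring]
      simp only [nsmul_eq_mul]
      push_cast
      ring
    · rw [x_of_lt k n (j := j + i + 2) (by omega), x_of_lt k n (by omega)]
      simp

theorem D'_iterate_x (j i : ℕ) (h : j < n) :
    (D' k n)^[i] (x k n (j + 1)) = j.descFactorial i • x k n (j + 1 - i) := by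
  induction i with
  | zero => simp
  | succ i ih =>
    rw [Function.iterate_succ_apply', ih, map_nsmul, Nat.descFactorial_succ]
    by_cases hi : i ≤ j
    · rw [show j + 1 - i = (j - i) + 1 by omega, D'_x k n (show j - i < n by omega),
        map_natCast, show j + 1 - (i + 1) = j - i by omega]
      simp only [nsmul_eq_mul]
      push_cast
      ring
    · rw [Nat.descFactorial_eq_zero_iff_lt.mpr (by omega)]
      simp

theorem isLocallyNilpotent_D : IsLocallyNilpotent (D k n) :=
  isLocallyNilpotent_of_X fun i => ⟨n, by
    rw [X_eq_x, D_iterate_x k n i n, x_of_lt k n (by omega), smul_zero]⟩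

theorem isLocallyNilpotent_D' : IsLocallyNilpotent (D' k n) :=
  isLocallyNilpotent_of_X fun i => ⟨n, by
    rw [X_eq_x, D'_iterate_x k n i n i.2,
      Nat.descFactorial_eq_zero_iff_lt.mpr i.2, zero_smul]⟩

/-- The diagonal derivation `x_j ↦ c_j x_j`. -/
def diagDer {σ : Type*} (c : σ → k) : Derivation k (MvPolynomial σ k) (MvPolynomial σ k) :=
  mkDerivation k fun j => C (c j) * X j

-- Each monomial is an eigenvector. An eigenvalue equation for `H` or `euler` can therefore be read
-- off as a linear constraint on every exponent vector in the support.
variable {k} in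
theorem coeff_diagDer {σ : Type*} [Fintype σ] (c : σ → k) (m : σ →₀ ℕ) (p : MvPolynomial σ k) :
    coeff m (diagDer k c p) = (∑ j, (m j : k) * c j) * coeff m p := by
  classical
  have key : ∀ s : σ →₀ ℕ, ∀ a : k,
      diagDer k c (monomial s a) = C (∑ j, (s j : k) * c j) * monomial s a := by
    intro s a
    rw [diagDer, mkDerivation_monomial, Finsupp.sum_fintype _ _ (by simp), Finset.smul_sum,
      map_sum, Finset.sum_mul]
    refine Finset.sum_congr rfl fun j _ => ?_
    by_cases hs : s j = 0
    · simp [hs]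
    · rw [X, C_mul_monomial, smul_eq_mul, monomial_mul, smul_monomial, C_mul_monomial, smul_eq_mul,
        Finsupp.sub_add_single_one_cancel hs]
      congr 1
      ring
  induction p using MvPolynomial.induction_on' with
  | monomial s a =>
    rw [key, coeff_C_mul, coeff_monomial]
    split_ifs with h
    · rw [h]
    · simp
  | add p q hp hq => rw [map_add, coeff_add, hp, hq, coeff_add, mul_add]

/-- The weight derivation `x_j ↦ (2 j - (n + 1)) x_j` (with `1 ≤ j ≤ n`). -/
def H : Derivation k (MvPolynomial (Fin n) k) (MvPolynomial (Fin n) k) :=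
  diagDer k fun j => 2 * (j : k) + 1 - n

theorem H_x (j : ℕ) : H k n (x k n (j + 1)) = C (2 * (j : k) + 1 - n) * x k n (j + 1) := by
  by_cases h : j < n
  · rw [x_succ_of_lt k n h, H, diagDer, mkDerivation_X]
  · rw [x_of_lt k n (by omega), map_zero, mul_zero]

theorem commutator_D_D' : ⁅D k n, D' k n⁆ = H k n := by
  apply MvPolynomial.derivation_ext
  intro i
  rw [Derivation.commutator_apply, X_eq_x, H_x, D_x, D'_x k n i.2]
  rw [C_mul', C_mul', Derivation.map_smul, Derivation.map_smul]
  by_cases h : (i : ℕ) + 1 < n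
  · rw [D'_x k n h]
    rcases Nat.eq_zero_or_pos (i : ℕ) with h0 | h0
    · rw [h0, x_zero]
      simp only [C_mul', map_zero, smul_zero, smul_smul, ← neg_smul, zero_sub]
      congr 1
      push_cast
      ring
    · obtain ⟨j, hj⟩ : ∃ j, (i : ℕ) = j + 1 := ⟨i - 1, by omega⟩
      rw [hj, D_x]
      simp only [C_mul', smul_smul, ← sub_smul]
      congr 1
      push_cast
      ring
  · have hn : n = i + 1 := by omega
    rw [x_of_lt k n (show n < (i : ℕ) + 2 by omega), map_zero, smul_zero, sub_zero]
    rcases Nat.eq_zero_or_pos (i : ℕ) with h0 | h0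
    · rw [h0, x_zero]
      simp only [C_mul', map_zero, smul_zero]
      have : n = 1 := by omega
      subst this
      simp
    · obtain ⟨j, hj⟩ : ∃ j, (i : ℕ) = j + 1 := ⟨i - 1, by omega⟩
      rw [hj, D_x]
      simp only [C_mul', smul_smul]
      congr 1
      have : (n : k) = j + 2 := by rw [hn, hj]; push_cast; ring
      rw [this]
      push_cast
      ring

theorem commutator_H_D : ⁅H k n, D k n⁆ = (2 : k) • D k n := by
  apply MvPolynomial.derivation_ext
  intro i
  rw [Derivation.commutator_apply, Derivation.smul_apply, X_eq_x, H_x, D_x]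
  rw [C_mul', C_mul', Derivation.map_smul, Derivation.map_smul, H_x, D_x]
  simp only [C_mul', smul_smul, ← sub_smul]
  congr 1
  push_cast
  ring

theorem commutator_H_D' : ⁅H k n, D' k n⁆ = (-2 : k) • D' k n := by
  apply MvPolynomial.derivation_ext
  intro i
  rw [Derivation.commutator_apply, Derivation.smul_apply, X_eq_x, H_x, D'_x k n i.2]
  rw [C_mul', C_mul', Derivation.map_smul, Derivation.map_smul, D'_x k n i.2]
  rcases Nat.eq_zero_or_pos (i : ℕ) with h0 | h0
  · rw [h0, x_zero]
    simp
  · obtain ⟨j, hj⟩ : ∃ j, (i : ℕ) = j + 1 := ⟨i - 1, by omega⟩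
    rw [hj, H_x]
    simp only [C_mul', smul_smul, ← sub_smul]
    congr 1
    push_cast
    ring

variable {k n}

theorem D'_D (p : MvPolynomial (Fin n) k) :
    D' k n (D k n p) = D k n (D' k n p) - H k n p := by
  rw [← commutator_D_D', Derivation.commutator_apply]
  ring

theorem H_D (p : MvPolynomial (Fin n) k) :
    H k n (D k n p) = D k n (H k n p) + (2 : k) • D k n p := by
  have := congrArg (fun δ => δ p) (commutator_H_D k n)
  simp only [Derivation.commutator_apply, Derivation.smul_apply] at this
  rw [← this]
  ring

theorem D'_H (p : MvPolynomial (Fin n) k) :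
    D' k n (H k n p) = H k n (D' k n p) + (2 : k) • D' k n p := by
  have := congrArg (fun δ => δ p) (commutator_H_D' k n)
  simp only [Derivation.commutator_apply, Derivation.smul_apply, neg_smul] at this
  linear_combination -this

theorem H_D_of_weight {p : MvPolynomial (Fin n) k} {w : k} (h : H k n p = w • p) :
    H k n (D k n p) = (w + 2) • D k n p := by
  rw [H_D, h, Derivation.map_smul, add_smul]

/-- There is no nonzero lowest weight vector of positive weight. -/
theorem eq_zero_of_lowest_weight [CharZero k] {p : MvPolynomial (Fin n) k} {w : ℕ} (hw : 0 < w)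
    (h' : D' k n p = 0) (hH : H k n p = (w : k) • p) : p = 0 := by
  have hHi : ∀ i : ℕ, H k n ((D k n)^[i] p) = ((w : k) + 2 * i) • (D k n)^[i] p := by
    intro i
    induction i with
    | zero => simpa using hH
    | succ i ih =>
      rw [Function.iterate_succ_apply', H_D_of_weight ih]
      congr 1
      push_cast
      ring
  -- The `sl₂` ladder. The factor `(i + 1) (w + i)` never vanishes for `w > 0`, so the vanishing of
  -- a power of `D` on `p` descends step by step to `p` itself.
  have hD' : ∀ i : ℕ, D' k n ((D k n)^[i + 1] p) =
      (-(((i + 1) * (w + i) : ℕ) : k)) • (D k n)^[i] p := by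
    intro i
    induction i with
    | zero =>
      simp only [zero_add, Function.iterate_one, Function.iterate_zero, id_eq]
      rw [D'_D, h', hH, map_zero, zero_sub, ← neg_smul]
      simp
    | succ i ih =>
      rw [Function.iterate_succ_apply', D'_D, ih, hHi, Derivation.map_smul,
        ← Function.iterate_succ_apply' (D k n), ← sub_smul]
      congr 1
      push_cast
      ring
  obtain ⟨m, hm⟩ := isLocallyNilpotent_D k n p
  induction m with
  | zero => exact hm
  | succ m ih =>
    apply ih
    have h1 := hD' m
    rw [hm, map_zero] at h1
    refine (smul_eq_zero.mp h1.symm).resolve_left ?_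
    rw [neg_eq_zero, Nat.cast_eq_zero]
    positivity

end Triple

/-! ### Invariance and homogeneity of `f` -/

section Invariance

variable (k : Type*) [Field k] (n : ℕ)

/-- The polarised coefficients of the quadratic form `fOdd`. -/
def fOddCoeff (r i : ℕ) : k := (-1) ^ i * ((2 * r).choose i : k)

theorem fOddCoeff_succ (r i : ℕ) :
    fOddCoeff k r (i + 1) * ((i : k) + 1) = - (fOddCoeff k r i * ((2 * r - i : ℕ) : k)) := by
  have h := congrArg (Nat.cast (R := k)) (Nat.choose_succ_right_eq (2 * r) i)
  push_cast at h
  rw [fOddCoeff, fOddCoeff, pow_succ]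
  linear_combination (-(-1) ^ i) * h

theorem fOdd_succ (r : ℕ) : fOdd k n (r + 1) = C (1 / 2 : k) *
    ∑ i ∈ Finset.range (2 * r + 1),
      C (fOddCoeff k r i) * (x k n (i + 1) * x k n (2 * r - i + 1)) := by
  rw [fOdd, show 2 * (r + 1) - 1 = 2 * r + 1 by omega, show 2 * (r + 1) - 2 = 2 * r by omega]
  congr 1
  symm
  refine Finset.sum_bij (fun i _ => i + 1) ?_ ?_ ?_ ?_
  · intro i hi
    simp only [Finset.mem_range, Finset.mem_Icc] at *
    omega
  · intros; omega
  · intro i hi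
    simp only [Finset.mem_Icc] at hi
    exact ⟨i - 1, by simp only [Finset.mem_range]; omega, by omega⟩
  · intro i hi
    simp only [Finset.mem_range] at hi
    rw [fOddCoeff, Nat.add_sub_cancel, mul_assoc,
      show 2 * (r + 1) - (i + 1) = 2 * r - i + 1 by omega]

theorem D'_fOdd (r : ℕ) (h : 2 * r + 1 ≤ n) : D' k n (fOdd k n (r + 1)) = 0 := by
  -- By the recurrence `fOddCoeff_succ` the image under `D'` telescopes along `F`. Both ends vanish:
  -- `F 0` and `F (2 r + 1)` contain the factor `x k n 0 = 0`.
  set F : ℕ → MvPolynomial (Fin n) k := fun i =>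
    C (fOddCoeff k r i * i) * (x k n i * x k n (2 * r + 1 - i)) with hF
  rw [fOdd_succ, C_mul', Derivation.map_smul, map_sum]
  have : ∀ i ∈ Finset.range (2 * r + 1), D' k n (C (fOddCoeff k r i) *
      (x k n (i + 1) * x k n (2 * r - i + 1))) = F i - F (i + 1) := by
    intro i hi
    simp only [Finset.mem_range] at hi
    rw [C_mul', Derivation.map_smul, Derivation.leibniz, D'_x k n (by omega),
      D'_x k n (by omega)]
    have e := congrArg (C (σ := Fin n)) (fOddCoeff_succ k r i)
    simp only [hF, smul_eq_mul, ← C_mul', show 2 * r + 1 - (i + 1) = 2 * r - i by omega,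
      show 2 * r + 1 - i = 2 * r - i + 1 by omega] at e ⊢
    simp only [map_mul, map_neg, Nat.cast_add, Nat.cast_one] at e ⊢
    linear_combination (x k n (i + 1) * x k n (2 * r - i)) * e
  rw [Finset.sum_congr rfl this, Finset.sum_range_sub']
  simp [hF, x_zero]

variable {k n} in
theorem diagDer_mul {σ : Type*} {c : σ → k} {p q : MvPolynomial σ k} {v w : k}
    (hp : diagDer k c p = v • p) (hq : diagDer k c q = w • q) :
    diagDer k c (p * q) = (v + w) • (p * q) := by
  rw [Derivation.leibniz, hp, hq, smul_eq_mul, smul_eq_mul, add_smul, mul_smul_comm,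
    mul_smul_comm, mul_comm q p, add_comm]

theorem H_fOdd (r : ℕ) :
    H k n (fOdd k n (r + 1)) = (4 * (r : k) + 2 - 2 * n) • fOdd k n (r + 1) := by
  rw [fOdd_succ, C_mul', Derivation.map_smul, map_sum, smul_comm]
  congr 1
  rw [Finset.smul_sum]
  refine Finset.sum_congr rfl fun i hi => ?_
  simp only [Finset.mem_range] at hi
  have h1 := H_x k n i
  have h2 := H_x k n (2 * r - i)
  rw [C_mul'] at h1 h2
  rw [C_mul', Derivation.map_smul, H, diagDer_mul h1 h2, smul_comm]
  congr 2
  rw [Nat.cast_sub (by omega)]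
  push_cast
  ring

/-- The Euler derivation. -/
def euler : Derivation k (MvPolynomial (Fin n) k) (MvPolynomial (Fin n) k) :=
  diagDer k fun _ => 1

theorem euler_x (j : ℕ) : euler k n (x k n (j + 1)) = (1 : k) • x k n (j + 1) := by
  by_cases h : j < n
  · rw [x_succ_of_lt k n h, euler, diagDer, mkDerivation_X]
    simp
  · rw [x_of_lt k n (by omega), map_zero, smul_zero]

theorem euler_fOdd (r : ℕ) :
    euler k n (fOdd k n (r + 1)) = (2 : k) • fOdd k n (r + 1) := by
  rw [fOdd_succ, C_mul', Derivation.map_smul, map_sum, smul_comm]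
  congr 1
  rw [Finset.smul_sum]
  refine Finset.sum_congr rfl fun i hi => ?_
  rw [C_mul', Derivation.map_smul, euler, diagDer_mul (euler_x k n _) (euler_x k n _), smul_comm]
  norm_num

variable {k n}

theorem euler_D (p : MvPolynomial (Fin n) k) : euler k n (D k n p) = D k n (euler k n p) := by
  have : ⁅euler k n, D k n⁆ = 0 := by
    apply MvPolynomial.derivation_ext
    intro i
    rw [Derivation.commutator_apply, X_eq_x, euler_x, D_x, C_mul', Derivation.map_smul, euler_x,
      one_smul, one_smul, D_x, C_mul', sub_self]
    rfl
  have h := congrArg (fun δ => δ p) this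
  simp only [Derivation.commutator_apply] at h
  exact sub_eq_zero.mp h

variable (k n)

/-- Half the degree of `f`. -/
def halfDeg : ℕ := if Odd n then 1 else 2

theorem f_of_odd (r : ℕ) (hn : n = 2 * r + 1) : f k n = fOdd k n (r + 1) := by
  have h : Odd n := ⟨r, hn⟩
  rw [f, if_pos h]
  congr 1
  omega

theorem f_of_even (r : ℕ) (hn : n = 2 * (r + 1)) : f k n = D k n (fOdd k n (r + 1)) ^ 2 -
    2 * D k n (D k n (fOdd k n (r + 1))) * fOdd k n (r + 1) := by
  have h : ¬ Odd n := by rw [Nat.not_odd_iff_even]; exact ⟨r + 1, by omega⟩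
  have h2 : n / 2 = r + 1 := by omega
  rw [f, if_neg h, h2]

theorem halfDeg_of_odd (r : ℕ) (hn : n = 2 * r + 1) : halfDeg n = 1 := if_pos ⟨r, hn⟩

theorem halfDeg_of_even (r : ℕ) (hn : n = 2 * (r + 1)) : halfDeg n = 2 :=
  if_neg (by rw [Nat.not_odd_iff_even]; exact ⟨r + 1, by omega⟩)

theorem odd_or_even (hn : 0 < n) : (∃ r, n = 2 * r + 1) ∨ ∃ r, n = 2 * (r + 1) := by
  rcases Nat.even_or_odd' n with ⟨r, h | h⟩
  · exact Or.inr ⟨r - 1, by omega⟩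
  · exact Or.inl ⟨r, h⟩

-- In odd dimension `f` has weight 0 and is killed by `D'`, so `D f` would be a lowest weight vector
-- of weight 2 and must vanish. In even dimension the quadratic form `q` is a lowest weight vector
-- of weight -2, generating the three-dimensional module of `q`, `D q`, `D² q`; `f` is its invariant
-- quadratic form `(D q)² - 2 (D² q) q`.
variable {k n} in
theorem f_facts [CharZero k] (hn : 0 < n) : D k n (f k n) = 0 ∧ D' k n (f k n) = 0 ∧
    H k n (f k n) = 0 ∧ euler k n (f k n) = (2 * halfDeg n : k) • f k n := by
  rcases odd_or_even n hn with ⟨r, hr⟩ | ⟨r, hr⟩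
  · rw [f_of_odd k n r hr, halfDeg_of_odd n r hr]
    have hw : H k n (fOdd k n (r + 1)) = 0 := by
      rw [H_fOdd, hr]
      simp only [Nat.cast_add, Nat.cast_mul, Nat.cast_ofNat, Nat.cast_one]
      ring_nf
      simp
    have h' := D'_fOdd k n r hr.ge
    refine ⟨?_, h', hw, by rw [euler_fOdd]; norm_num⟩
    refine eq_zero_of_lowest_weight (w := 2) two_pos ?_ ?_
    · rw [D'_D, h', hw]; simp
    · rw [H_D, hw]; simp
  · rw [f_of_even k n r hr, halfDeg_of_even n r hr]
    set q := fOdd k n (r + 1)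
    have h' : D' k n q = 0 := D'_fOdd k n r (by omega)
    have w0 : H k n q = (-2 : k) • q := by
      rw [H_fOdd]
      congr 1
      rw [hr]
      push_cast
      ring
    have w1 : H k n (D k n q) = (0 : k) • D k n q := by
      rw [H_D_of_weight w0]; norm_num
    have w2 : H k n (D k n (D k n q)) = (2 : k) • D k n (D k n q) := by
      rw [H_D_of_weight w1]; norm_num
    have w3 : H k n (D k n (D k n (D k n q))) = ((4 : ℕ) : k) • D k n (D k n (D k n q)) := by
      rw [H_D_of_weight w2]; norm_num
    have d1 : D' k n (D k n q) = (2 : k) • q := by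
      rw [D'_D, h', w0]; simp
    have d2 : D' k n (D k n (D k n q)) = (2 : k) • D k n q := by
      rw [D'_D, d1, w1, Derivation.map_smul]; simp
    have d3 : D' k n (D k n (D k n (D k n q))) = 0 := by
      rw [D'_D, d2, w2, Derivation.map_smul]; simp
    have c3 : D k n (D k n (D k n q)) = 0 := eq_zero_of_lowest_weight four_pos d3 w3
    have two_kill : ∀ δ : Derivation k (MvPolynomial (Fin n) k) (MvPolynomial (Fin n) k),
        δ 2 = 0 := fun δ => by
      rw [show (2 : MvPolynomial (Fin n) k) = algebraMap k _ 2 from (map_ofNat _ 2).symm]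
      exact δ.map_algebraMap 2
    have expand : ∀ δ : Derivation k (MvPolynomial (Fin n) k) (MvPolynomial (Fin n) k),
        δ (D k n q ^ 2 - 2 * D k n (D k n q) * q) = 2 * D k n q * δ (D k n q)
          - 2 * δ (D k n (D k n q)) * q - 2 * D k n (D k n q) * δ q := by
      intro δ
      simp only [map_sub, sq, Derivation.leibniz, two_kill, smul_eq_mul]
      ring
    have e0 : euler k n q = (2 : k) • q := euler_fOdd k n r
    have C2 : (C 2 : MvPolynomial (Fin n) k) = 2 := map_ofNat _ 2
    have C4 : (C (2 * (2 : ℕ)) : MvPolynomial (Fin n) k) = 4 := by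
      rw [Nat.cast_ofNat, map_mul, C2]; norm_num
    refine ⟨?_, ?_, ?_, ?_⟩
    · rw [expand, c3]; ring
    · rw [expand, h', d1, d2, ← C_mul', ← C_mul', C2]; ring
    · rw [expand, w0, w1, w2, neg_smul, zero_smul, ← C_mul', ← C_mul', C2]; ring
    · rw [expand]
      simp only [euler_D, e0, Derivation.map_smul]
      simp only [← C_mul', C2, C4]
      ring

/-- This pins down the coefficient of `x₁ ^ κ x_n ^ κ`. In odd dimension the two end terms of the
sum contribute 1 each, halved. In even dimension `q` does not involve `x_n` and vanishes at the
corner, while `D` produces `x_n` only from `x_{n-1}`, with coefficient 1, so `D q` takes the value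
1. -/
theorem aeval_corner_f [CharZero k] (hn : 3 ≤ n) :
    aeval (fun i : Fin n => if (i : ℕ) = 0 ∨ (i : ℕ) = n - 1 then (1 : k) else 0) (f k n) = 1 := by
  set e := aeval (R := k) (fun i : Fin n => if (i : ℕ) = 0 ∨ (i : ℕ) = n - 1 then (1 : k) else 0)
    with he
  have ex : ∀ j, e (x k n (j + 1)) = if j = 0 ∨ j = n - 1 then 1 else 0 := by
    intro j
    by_cases h : j < n
    · rw [x_succ_of_lt k n h, he, aeval_X]
    · rw [x_of_lt k n (by omega), map_zero, if_neg (by omega)]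
  have eC : ∀ c : k, e (C c) = c := fun c => e.commutes c
  rcases odd_or_even n (by omega) with ⟨r, hr⟩ | ⟨r, hr⟩
  · rw [f_of_odd k n r hr, fOdd_succ, map_mul, map_sum, eC]
    have : ∀ i ∈ Finset.range (2 * r + 1), e (C (fOddCoeff k r i) *
        (x k n (i + 1) * x k n (2 * r - i + 1))) =
        (if i = 0 then 1 else 0) + (if i = 2 * r then 1 else 0) := by
      intro i hi
      simp only [Finset.mem_range] at hi
      rw [map_mul, map_mul, ex, ex, eC]
      by_cases h0 : i = 0
      · subst h0
        rw [if_pos (Or.inl rfl), if_pos (by omega), if_pos rfl, if_neg (by omega)]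
        simp [fOddCoeff]
      · by_cases h1 : i = 2 * r
        · subst h1
          rw [if_pos (by omega), if_pos (by omega), if_pos rfl, if_neg h0]
          simp [fOddCoeff]
        · rw [if_neg (by omega), if_neg h0, if_neg h1]
          simp
    rw [Finset.sum_congr rfl this, Finset.sum_add_distrib, Finset.sum_ite_eq', Finset.sum_ite_eq',
      if_pos (by simp), if_pos (by simp)]
    norm_num
  · have eq0 : e (fOdd k n (r + 1)) = 0 := by
      rw [fOdd_succ, map_mul, map_sum, Finset.sum_eq_zero, mul_zero]
      intro i hi
      simp only [Finset.mem_range] at hi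
      rw [map_mul, map_mul, ex, ex]
      by_cases h0 : i = 0
      · rw [if_neg (c := 2 * r - i = 0 ∨ 2 * r - i = n - 1) (by omega)]
        simp
      · rw [if_neg (by omega)]
        simp
    have eD : ∀ j, e (D k n (x k n (j + 1))) = if j = n - 2 then 1 else 0 := by
      intro j
      rw [D_x, map_mul, eC, show j + 2 = (j + 1) + 1 from rfl, ex]
      by_cases h : j = n - 2
      · rw [if_pos (by omega), if_pos h, h, Nat.cast_sub (by omega)]
        push_cast
        ring
      · rw [if_neg (by omega), if_neg h, mul_zero]
    have eq1 : e (D k n (fOdd k n (r + 1))) = 1 := by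
      rw [fOdd_succ, C_mul', Derivation.map_smul, map_smul, map_sum, map_sum]
      have : ∀ i ∈ Finset.range (2 * r + 1), e (D k n (C (fOddCoeff k r i) *
          (x k n (i + 1) * x k n (2 * r - i + 1)))) =
          (if i = 0 then 1 else 0) + (if i = 2 * r then 1 else 0) := by
        intro i hi
        simp only [Finset.mem_range] at hi
        rw [C_mul', Derivation.map_smul, map_smul, Derivation.leibniz, map_add]
        simp only [smul_eq_mul, map_mul]
        rw [ex, ex, eD, eD]
        by_cases h0 : i = 0
        · subst h0
          rw [if_pos (Or.inl rfl), if_pos (by omega), if_neg (by omega), if_neg (by omega),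
            if_pos rfl, if_neg (by omega)]
          simp [fOddCoeff]
        · by_cases h1 : i = 2 * r
          · subst h1
            rw [if_neg (by omega), if_neg (by omega), if_pos (by omega), if_pos (by omega),
              if_neg h0, if_pos rfl]
            simp [fOddCoeff]
          · rw [if_neg (c := i = 0 ∨ i = n - 1) (by omega),
              if_neg (c := 2 * r - i = 0 ∨ 2 * r - i = n - 1) (by omega), if_neg h0, if_neg h1]
            simp
      rw [Finset.sum_congr rfl this, Finset.sum_add_distrib, Finset.sum_ite_eq',
        Finset.sum_ite_eq', if_pos (by simp), if_pos (by simp)]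
      norm_num
    rw [f_of_even k n r hr, map_sub, map_pow, map_mul, eq0, eq1]
    norm_num

theorem D_f [CharZero k] (hn : 0 < n) : D k n (f k n) = 0 := (f_facts hn).1

theorem D'_f [CharZero k] (hn : 0 < n) : D' k n (f k n) = 0 := (f_facts hn).2.1

variable {k n}

/-- The monomials of `f` have degree `2 κ` and weight `κ (n - 1)`, where `κ` is `halfDeg n`. -/
theorem sum_of_mem_support_f [CharZero k] (hn : 0 < n) {m : Fin n →₀ ℕ}
    (hm : m ∈ (f k n).support) :
    ∑ j, m j = 2 * halfDeg n ∧ ∑ j, m j * (j : ℕ) = halfDeg n * (n - 1) := by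
  obtain ⟨-, -, h1, h2⟩ := f_facts (k := k) hn
  have hc : coeff m (f k n) ≠ 0 := mem_support_iff.mp hm
  have e1 := congrArg (coeff m) h1
  have e2 := congrArg (coeff m) h2
  rw [H, coeff_diagDer, coeff_zero] at e1
  rw [euler, coeff_diagDer, coeff_smul, smul_eq_mul] at e2
  have e2' := mul_right_cancel₀ hc e2
  have e1' := (mul_eq_zero.mp e1).resolve_right hc
  have d : ∑ j, m j = 2 * halfDeg n := by
    have : ((∑ j, m j : ℕ) : k) = ((2 * halfDeg n : ℕ) : k) := by
      push_cast
      simpa using e2'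
    exact_mod_cast this
  refine ⟨d, ?_⟩
  have : ((2 * ∑ j, m j * (j : ℕ) + ∑ j, m j : ℕ) : k) = ((n * ∑ j, m j : ℕ) : k) := by
    rw [← sub_eq_zero, ← e1']
    push_cast
    simp only [Finset.mul_sum, ← Finset.sum_add_distrib, ← Finset.sum_sub_distrib]
    refine Finset.sum_congr rfl fun j _ => ?_
    ring
  have h3 : 2 * ∑ j, m j * (j : ℕ) + ∑ j, m j = n * ∑ j, m j := by exact_mod_cast this
  rw [d] at h3
  obtain ⟨n', rfl⟩ : ∃ n', n = n' + 1 := ⟨n - 1, by omega⟩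
  rw [Nat.add_sub_cancel]
  nlinarith

end Invariance

/-! ### The leading term of `f` -/

section LeadingTerm

variable {k : Type*} [Field k] [CharZero k] {n : ℕ}

/-- A monomial in `x₁` and `x_n` alone is determined by its degree `2 κ` and weight `κ (n - 1)`. -/
theorem exists_mid_of_mem_support_f (hn : 3 ≤ n) {m : Fin n →₀ ℕ}
    (hm : m ∈ (f k n).support)
    (hne : m ≠ Finsupp.single ⟨0, by omega⟩ (halfDeg n) +
      Finsupp.single ⟨n - 1, by omega⟩ (halfDeg n)) :
    ∃ j : Fin n, 0 < (j : ℕ) ∧ (j : ℕ) < n - 1 ∧ m j ≠ 0 := by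
  by_contra! hc
  apply hne
  obtain ⟨h1, h2⟩ := sum_of_mem_support_f (by omega) hm
  set i0 : Fin n := ⟨0, by omega⟩ with hi0
  set i1 : Fin n := ⟨n - 1, by omega⟩ with hi1
  have h01 : i0 ≠ i1 := by
    intro h
    have := congrArg Fin.val h
    simp only [hi0, hi1] at this
    omega
  have hz : ∀ j, j ≠ i0 ∧ j ≠ i1 → m j = 0 := by
    rintro j ⟨hj0, hj1⟩
    have h0 : (j : ℕ) ≠ 0 := fun h => hj0 (Fin.ext h)
    have h1 : (j : ℕ) ≠ n - 1 := fun h => hj1 (Fin.ext h)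
    exact hc j (by omega) (by omega)
  rw [Fintype.sum_eq_add i0 i1 h01 hz] at h1
  rw [Fintype.sum_eq_add i0 i1 h01 fun j hj => by rw [hz j hj, zero_mul]] at h2
  simp only [hi0, hi1, mul_zero, zero_add] at h2
  have h3 := Nat.eq_of_mul_eq_mul_right (by omega) h2
  rw [← hi1] at h3
  have h4 : m i0 = halfDeg n := by omega
  ext j
  rw [Finsupp.add_apply]
  by_cases hj0 : j = i0
  · rw [hj0, Finsupp.single_eq_same, Finsupp.single_eq_of_ne h01, h4, add_zero]
  · by_cases hj1 : j = i1
    · rw [hj1, Finsupp.single_eq_same, Finsupp.single_eq_of_ne h01.symm, h3, zero_add]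
    · rw [hz j ⟨hj0, hj1⟩, Finsupp.single_eq_of_ne hj0, Finsupp.single_eq_of_ne hj1, add_zero]

theorem prod_pow_single_add_single {ι S : Type*} [Fintype ι] [CommRing S] (y : ι → S)
    (i j : ι) (a b : ℕ) :
    ∏ l, y l ^ (Finsupp.single i a + Finsupp.single j b : ι →₀ ℕ) l = y i ^ a * y j ^ b := by
  classical
  simp only [Finsupp.add_apply, pow_add, Finset.prod_mul_distrib]
  congr 1 <;>
  · rw [Finset.prod_eq_single_of_mem _ (Finset.mem_univ _)
      (fun b _ hb => by rw [Finsupp.single_eq_of_ne hb, pow_zero]), Finsupp.single_eq_same]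

/-- All other monomials vanish at the corner point, so `aeval_corner_f` says that the extreme
monomial has coefficient 1. -/
theorem aeval_f_eq_add_sum {R : Type*} [CommRing R] [Algebra k R] (hn : 3 ≤ n)
    (y : Fin n → R) :
    aeval y (f k n) = y ⟨0, by omega⟩ ^ halfDeg n * y ⟨n - 1, by omega⟩ ^ halfDeg n +
      ∑ m ∈ (f k n).support.erase (Finsupp.single ⟨0, by omega⟩ (halfDeg n) +
        Finsupp.single ⟨n - 1, by omega⟩ (halfDeg n)),
        algebraMap k R (coeff m (f k n)) * ∏ j, y j ^ m j := by
  set M : Fin n →₀ ℕ := Finsupp.single ⟨0, by omega⟩ (halfDeg n) +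
    Finsupp.single ⟨n - 1, by omega⟩ (halfDeg n) with hM
  have hc := aeval_corner_f k n hn
  rw [aeval_def, eval₂_eq'] at hc
  have hz : ∀ m ∈ (f k n).support, m ≠ M → algebraMap k k (coeff m (f k n)) *
      ∏ i : Fin n, (if (i : ℕ) = 0 ∨ (i : ℕ) = n - 1 then (1 : k) else 0) ^ m i = 0 := by
    intro m hm hmM
    obtain ⟨j, h0, h1, hj⟩ := exists_mid_of_mem_support_f hn hm hmM
    rw [Finset.prod_eq_zero (Finset.mem_univ j), mul_zero]
    rw [if_neg (by omega), zero_pow hj]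
  have hMs : M ∈ (f k n).support := by
    by_contra h
    rw [Finset.sum_eq_zero fun m hm => hz m hm (fun e => h (e ▸ hm))] at hc
    exact zero_ne_one hc
  rw [Finset.sum_eq_single_of_mem M hMs hz, prod_pow_single_add_single, if_pos (Or.inl rfl),
    if_pos (Or.inr rfl), one_pow, one_mul, mul_one] at hc
  rw [aeval_def, eval₂_eq', ← Finset.add_sum_erase _ _ hMs, prod_pow_single_add_single]
  congr 1
  rw [show coeff M (f k n) = 1 from hc, map_one, one_mul]

/-- If the degrees of the middle coordinates of `y` lie strictly below the chord through the
degrees of the extreme coordinates, then `f(y)` is dominated by its extreme monomial. -/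
theorem natDegree_aeval_f_sub_lt {K : Type*} [CommRing K] [Algebra k K] (hn : 3 ≤ n)
    (y : Fin n → Polynomial K) {a b : ℕ}
    (h0 : (y ⟨0, by omega⟩).natDegree ≤ a) (h1 : (y ⟨n - 1, by omega⟩).natDegree ≤ b)
    (hmid : ∀ j : Fin n, 0 < (j : ℕ) → (j : ℕ) < n - 1 →
      (n - 1) * (y j).natDegree < (n - 1 - j) * a + j * b) :
    (aeval y (f k n) - y ⟨0, by omega⟩ ^ halfDeg n *
      y ⟨n - 1, by omega⟩ ^ halfDeg n).natDegree < halfDeg n * (a + b) := by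
  have hκ : 0 < halfDeg n := by rw [halfDeg]; split_ifs <;> norm_num
  have hab : 0 < a + b := by
    have := hmid ⟨1, by omega⟩ one_pos (show 1 < n - 1 by omega)
    by_contra h
    obtain ⟨rfl, rfl⟩ : a = 0 ∧ b = 0 := by omega
    simp at this
  have hle : ∀ j : Fin n, (n - 1) * (y j).natDegree ≤ (n - 1 - j) * a + j * b := by
    intro j
    rcases Nat.eq_zero_or_pos (j : ℕ) with hj | hj
    · have hj0 : j = ⟨0, by omega⟩ := Fin.ext hj
      rw [hj, hj0, zero_mul, add_zero, Nat.sub_zero]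
      exact Nat.mul_le_mul_left _ h0
    · rcases Nat.lt_or_ge (j : ℕ) (n - 1) with hj' | hj'
      · exact (hmid j hj hj').le
      · have hj1 : (j : ℕ) = n - 1 := by omega
        rw [show y j = y ⟨n - 1, by omega⟩ from congrArg y (Fin.ext hj1), hj1, Nat.sub_self,
          zero_mul, zero_add]
        exact Nat.mul_le_mul_left _ h1
  rw [aeval_f_eq_add_sum hn, add_sub_cancel_left]
  suffices h : ∀ m ∈ (f k n).support.erase (Finsupp.single ⟨0, by omega⟩ (halfDeg n) +
        Finsupp.single ⟨n - 1, by omega⟩ (halfDeg n)),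
      (algebraMap k (Polynomial K) (coeff m (f k n)) * ∏ j, y j ^ m j).natDegree ≤
        halfDeg n * (a + b) - 1 by
    have hpos : 0 < halfDeg n * (a + b) := Nat.mul_pos hκ hab
    exact (Polynomial.natDegree_sum_le_of_forall_le _ _ h).trans_lt (by omega)
  intro m hm
  rw [Finset.mem_erase] at hm
  obtain ⟨s1, s2⟩ := sum_of_mem_support_f (by omega) hm.2
  obtain ⟨j, hj0, hj1, hj⟩ := exists_mid_of_mem_support_f hn hm.2 hm.1
  have e1 : (algebraMap k (Polynomial K) (coeff m (f k n)) * ∏ j, y j ^ m j).natDegree ≤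
      ∑ j, m j * (y j).natDegree := by
    rw [← Algebra.smul_def]
    refine (Polynomial.natDegree_smul_le _ _).trans ((Polynomial.natDegree_prod_le _ _).trans ?_)
    exact Finset.sum_le_sum fun i _ => Polynomial.natDegree_pow_le
  have e2 : (n - 1) * ∑ j, m j * (y j).natDegree <
      ∑ j : Fin n, m j * ((n - 1 - j) * a + j * b) := by
    rw [Finset.mul_sum]
    refine Finset.sum_lt_sum (fun i _ => ?_) ⟨j, Finset.mem_univ j, ?_⟩
    · rw [mul_left_comm]
      exact Nat.mul_le_mul_left _ (hle i)
    · rw [mul_left_comm]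
      exact Nat.mul_lt_mul_of_pos_left (hmid j hj0 hj1) (Nat.pos_of_ne_zero hj)
  have e3 : ∑ j : Fin n, m j * (n - 1 - j) + ∑ j, m j * (j : ℕ) = (n - 1) * (2 * halfDeg n) := by
    rw [← Finset.sum_add_distrib, ← s1, Finset.mul_sum]
    refine Finset.sum_congr rfl fun i _ => ?_
    rw [← mul_add, mul_comm, Nat.sub_add_cancel (by omega)]
  -- The chord is affine in `j`, so its sum against `m` depends only on the degree and the weight of
  -- `m`, which are the same for all monomials of `f`.
  have e4 : ∑ j : Fin n, m j * ((n - 1 - j) * a + j * b) = (n - 1) * (halfDeg n * (a + b)) := by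
    have : ∑ j : Fin n, m j * (n - 1 - j) = (n - 1) * halfDeg n := by
      rw [s2] at e3
      linarith
    calc ∑ j : Fin n, m j * ((n - 1 - j) * a + j * b)
        = (∑ j : Fin n, m j * (n - 1 - j)) * a + (∑ j, m j * (j : ℕ)) * b := by
          rw [Finset.sum_mul, Finset.sum_mul, ← Finset.sum_add_distrib]
          exact Finset.sum_congr rfl fun i _ => by ring
      _ = _ := by rw [this, s2]; ring
  rw [e4] at e2
  have := Nat.lt_of_mul_lt_mul_left e2
  omega

end LeadingTerm

/-! ### Flows acting on points -/

section Points

variable {k : Type*} [Field k] {n : ℕ} {R : Type*} [CommRing R] [Algebra k R]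

theorem aeval_x_succ_of_lt (y : Fin n → R) {j : ℕ} (h : j < n) :
    aeval y (x k n (j + 1)) = y ⟨j, h⟩ := by
  rw [x_succ_of_lt k n h, aeval_X]

theorem aeval_x_add (y z : Fin n → R) (j : ℕ) :
    aeval (y + z) (x k n j) = aeval y (x k n j) + aeval z (x k n j) := by
  rcases j with _ | j
  · simp [x_zero]
  · by_cases h : j < n
    · rw [x_succ_of_lt k n h]
      simp
    · rw [x_of_lt k n (by omega)]
      simp

variable [CharZero k]

/-- The action of the time-`s` flow of `δ` on the `R`-points of affine space. -/
def flowPt {δ : Derivation k (MvPolynomial (Fin n) k) (MvPolynomial (Fin n) k)}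
    (hδ : IsLocallyNilpotent δ) (s : R) (y : Fin n → R) : Fin n → R :=
  fun j => flow δ hδ (aeval y) s (X j)

variable {δ : Derivation k (MvPolynomial (Fin n) k) (MvPolynomial (Fin n) k)}
  (hδ : IsLocallyNilpotent δ)

theorem aeval_flowPt (s : R) (y : Fin n → R) :
    aeval (flowPt hδ s y) = flow δ hδ (aeval y) s :=
  (aeval_unique _).symm

theorem flowPt_flowPt (s t : R) (y : Fin n → R) :
    flowPt hδ t (flowPt hδ s y) = flowPt hδ (s + t) y := by
  funext j
  rw [flowPt, aeval_flowPt, flow_flow]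
  rfl

theorem flowPt_zero (y : Fin n → R) : flowPt hδ 0 y = y := by
  funext j
  rw [flowPt, flow_zero, aeval_X]

theorem aeval_flowPt_of_mem_ker (s : R) (y : Fin n → R) {p : MvPolynomial (Fin n) k}
    (hp : δ p = 0) : aeval (flowPt hδ s y) p = aeval y p := by
  rw [aeval_flowPt, flow_of_mem_ker hδ _ _ hp]

theorem factorial_inv_smul_descFactorial (N i : ℕ) (s r : R) :
    ((i.factorial : k)⁻¹) • (s ^ i * (N.descFactorial i • r)) = (N.choose i : R) * s ^ i * r := by
  have h : ((i.factorial : ℕ) : k) ≠ 0 := by exact_mod_cast i.factorial_ne_zero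
  rw [inv_smul_eq_iff₀ h, Nat.descFactorial_eq_factorial_mul_choose, Nat.cast_smul_eq_nsmul,
    nsmul_eq_mul, nsmul_eq_mul]
  push_cast
  ring

theorem flowPt_D_apply (s : R) (y : Fin n → R) (j : Fin n) :
    flowPt (isLocallyNilpotent_D k n) s y j = ∑ i ∈ Finset.range n,
      ((n - 1 - j).choose i : R) * s ^ i * aeval y (x k n (j + i + 1)) := by
  have h : (D k n)^[n] (X j) = 0 := by
    rw [X_eq_x, D_iterate_x k n j n, x_of_lt k n (by omega), smul_zero]
  rw [flowPt, flow_eq_sum _ _ _ h]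
  refine Finset.sum_congr rfl fun i _ => ?_
  rw [X_eq_x, D_iterate_x, map_nsmul, factorial_inv_smul_descFactorial]

theorem flowPt_D'_apply (s : R) (y : Fin n → R) (j : Fin n) :
    flowPt (isLocallyNilpotent_D' k n) s y j = ∑ i ∈ Finset.range n,
      ((j : ℕ).choose i : R) * s ^ i * aeval y (x k n (j + 1 - i)) := by
  have h : (D' k n)^[n] (X j) = 0 := by
    rw [X_eq_x, D'_iterate_x k n j n j.2, Nat.descFactorial_eq_zero_iff_lt.mpr j.2, zero_smul]
  rw [flowPt, flow_eq_sum _ _ _ h]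
  refine Finset.sum_congr rfl fun i _ => ?_
  rw [X_eq_x, D'_iterate_x k n j i j.2, map_nsmul, factorial_inv_smul_descFactorial]

theorem flowPt_D_add (s : R) (y z : Fin n → R) :
    flowPt (isLocallyNilpotent_D k n) s (y + z) =
      flowPt (isLocallyNilpotent_D k n) s y + flowPt (isLocallyNilpotent_D k n) s z := by
  funext j
  simp only [Pi.add_apply, flowPt_D_apply, aeval_x_add, mul_add, Finset.sum_add_distrib]

theorem flowPt_D'_add (s : R) (y z : Fin n → R) :
    flowPt (isLocallyNilpotent_D' k n) s (y + z) =
      flowPt (isLocallyNilpotent_D' k n) s y + flowPt (isLocallyNilpotent_D' k n) s z := by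
  funext j
  simp only [Pi.add_apply, flowPt_D'_apply, aeval_x_add, mul_add, Finset.sum_add_distrib]

end Points

/-! ### Degree estimates for flows of points over `k[s]` -/

section Degree

variable {k : Type*} [Field k]

theorem degree_sum_lt_of_forall {ι : Type*} {s : Finset ι} {F : ι → Polynomial k} {d : ℕ}
    (h : ∀ i ∈ s, (F i).degree < d) : (∑ i ∈ s, F i).degree < d := by
  refine Finset.sum_induction F (fun p => p.degree < d) (fun p q hp hq => ?_) ?_ h
  · exact (Polynomial.degree_add_le p q).trans_lt (max_lt hp hq)
  · rw [Polynomial.degree_zero]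
    exact WithBot.bot_lt_coe d

theorem degree_sum_le_of_forall {ι : Type*} {s : Finset ι} {F : ι → Polynomial k} {d : ℕ}
    (h : ∀ i ∈ s, (F i).degree ≤ d) : (∑ i ∈ s, F i).degree ≤ d := by
  refine Finset.sum_induction F (fun p => p.degree ≤ d) (fun p q hp hq => ?_) ?_ h
  · exact (Polynomial.degree_add_le p q).trans (max_le hp hq)
  · rw [Polynomial.degree_zero]
    exact bot_le

theorem degree_sum_eq_of_dominant {ι : Type*} {s : Finset ι} {F : ι → Polynomial k} {d : ℕ}
    {i₀ : ι} (h₀ : i₀ ∈ s) (hd : (F i₀).degree = d)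
    (h : ∀ i ∈ s, i ≠ i₀ → (F i).degree < d) : (∑ i ∈ s, F i).degree = d := by
  classical
  rw [← Finset.add_sum_erase _ _ h₀, Polynomial.degree_add_eq_left_of_degree_lt, hd]
  rw [hd]
  refine degree_sum_lt_of_forall fun i hi => ?_
  rw [Finset.mem_erase] at hi
  exact h i hi.2 hi.1

theorem degree_natCast_mul_pow_mul_le {s z : Polynomial k} {T d : ℕ} (c i : ℕ)
    (hs : s.degree ≤ T) (hz : z.degree ≤ d) :
    ((c : Polynomial k) * s ^ i * z).degree ≤ (i * T + d : ℕ) := by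
  rw [← Polynomial.natDegree_le_iff_degree_le] at *
  refine Polynomial.natDegree_mul_le.trans (add_le_add (Polynomial.natDegree_mul_le.trans ?_) hz)
  rw [Polynomial.natDegree_natCast, zero_add]
  exact Polynomial.natDegree_pow_le.trans (Nat.mul_le_mul_left _ hs)

theorem degree_pow_mul_eq {s z : Polynomial k} {T d : ℕ} (i : ℕ)
    (hs : s.degree = T) (hz : z.degree = d) :
    (s ^ i * z).degree = (i * T + d : ℕ) := by
  rw [Polynomial.degree_mul, Polynomial.degree_pow, hs, hz]
  push_cast
  simp

variable {n : ℕ}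

theorem degree_aeval_x_le {z : Fin n → Polynomial k} {d : ℕ} (hz : ∀ j, (z j).degree ≤ d)
    (j : ℕ) : (aeval z (x k n j)).degree ≤ d := by
  rcases j with _ | j
  · simp [x_zero]
  · by_cases h : j < n
    · rw [aeval_x_succ_of_lt z h]
      exact hz _
    · rw [x_of_lt k n (by omega)]
      simp

theorem exists_last_ne_zero {a : Fin n → k} (ha : a ≠ 0) :
    ∃ b : Fin n, a b ≠ 0 ∧ ∀ j, b < j → a j = 0 := by
  classical
  obtain ⟨i, hi⟩ := Function.ne_iff.mp ha
  have hne : (Finset.univ.filter fun j => a j ≠ 0).Nonempty := ⟨i, by simpa using hi⟩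
  refine ⟨_, (Finset.mem_filter.mp (Finset.max'_mem _ hne)).2, fun j hj => ?_⟩
  by_contra h
  exact absurd (Finset.le_max' _ j (by simpa using h)) (not_le.mpr hj)

variable [CharZero k]

/-- Coordinate `j` is a polynomial in `s` whose top term is `s ^ (n - 1 - j)` times the last
coordinate of `z`, and that coordinate has the maximal degree `d`. -/
theorem degree_flowPt_D_eq {z : Fin n → Polynomial k} {s : Polynomial k} {T d : ℕ} (hn : 0 < n)
    (hz : ∀ j, (z j).degree ≤ d) (hd : (z ⟨n - 1, by omega⟩).degree = d) (hT : 1 ≤ T)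
    (hs : s.degree = T) (j : Fin n) :
    (flowPt (isLocallyNilpotent_D k n) s z j).degree = ((n - 1 - j) * T + d : ℕ) := by
  rw [flowPt_D_apply]
  refine degree_sum_eq_of_dominant (i₀ := n - 1 - j) (by simp; omega) ?_ ?_
  · rw [Nat.choose_self, Nat.cast_one, one_mul, aeval_x_succ_of_lt z (by omega)]
    exact degree_pow_mul_eq _ hs (by rw [← hd]; congr 3; omega)
  · intro i _ hi
    rcases lt_or_gt_of_ne hi with hi | hi
    · refine (degree_natCast_mul_pow_mul_le _ i hs.le (degree_aeval_x_le hz _)).trans_lt ?_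
      have := Nat.mul_lt_mul_of_pos_right hi hT
      exact_mod_cast (by omega : i * T + d < (n - 1 - j) * T + d)
    · rw [Nat.choose_eq_zero_of_lt hi, Nat.cast_zero, zero_mul, zero_mul, Polynomial.degree_zero]
      exact WithBot.bot_lt_coe _

/-- Coordinate `j` contains `c ^ j` times the dominant first coordinate, so a flow of `D'` at
nonzero constant time makes all degrees equal. -/
theorem degree_flowPt_D'_eq {z : Fin n → Polynomial k} {c : k} {d : ℕ} (hn : 0 < n)
    (hd : (z ⟨0, hn⟩).degree = d) (hz : ∀ j : Fin n, 0 < (j : ℕ) → (z j).degree < d)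
    (hc : c ≠ 0) (j : Fin n) :
    (flowPt (isLocallyNilpotent_D' k n) (Polynomial.C c) z j).degree = d := by
  rw [flowPt_D'_apply]
  have hC : ∀ i, (Polynomial.C c ^ i).degree = (0 : ℕ) := fun i => by
    rw [← Polynomial.C_pow]
    exact Polynomial.degree_C (pow_ne_zero i hc)
  refine degree_sum_eq_of_dominant (i₀ := (j : ℕ)) (by simp) ?_ ?_
  · rw [Nat.choose_self, Nat.cast_one, one_mul, Polynomial.degree_mul, hC,
      show (j : ℕ) + 1 - j = 0 + 1 by omega, aeval_x_succ_of_lt z hn, hd]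
    simp
  · intro i _ hi
    rcases lt_or_gt_of_ne hi with hi | hi
    · rw [mul_assoc, Polynomial.degree_mul, Polynomial.degree_mul, hC,
        show (j : ℕ) + 1 - i = (j - i) + 1 by omega,
        aeval_x_succ_of_lt z (show (j : ℕ) - i < n by omega)]
      have h2 := hz ⟨j - i, by omega⟩ (by simp only; omega)
      have h3 : (((j : ℕ).choose i : ℕ) : Polynomial k).degree ≤ 0 := by
        rw [← map_natCast (Polynomial.C (R := k))]
        exact Polynomial.degree_C_le
      calc _ ≤ (0 : WithBot ℕ) + ((0 : ℕ) + (z ⟨j - i, by omega⟩).degree) := by gcongr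
        _ = (z ⟨j - i, by omega⟩).degree := by simp
        _ < _ := h2
    · rw [Nat.choose_eq_zero_of_lt hi]
      simp

/-- The last nonzero entry `a b` reaches the first coordinate with the factor `s ^ b`; every other
coordinate sees a smaller power of `s`. -/
theorem degree_flowPt_D_const {a : Fin n → k} {s : Polynomial k} {T : ℕ} (hn : 0 < n)
    {b : Fin n} (hb : a b ≠ 0) (hb' : ∀ j, b < j → a j = 0) (hT : 1 ≤ T) (hs : s.degree = T) :
    (flowPt (isLocallyNilpotent_D k n) s (fun i => Polynomial.C (a i)) ⟨0, hn⟩).degree =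
        (b * T : ℕ) ∧
      ∀ j : Fin n, 0 < (j : ℕ) →
        (flowPt (isLocallyNilpotent_D k n) s (fun i => Polynomial.C (a i)) j).degree <
          (b * T : ℕ) := by
  have hx : ∀ j, (aeval (fun i => Polynomial.C (a i)) (x k n (j + 1))).degree ≤ (0 : ℕ) :=
    fun j => degree_aeval_x_le (fun _ => Polynomial.degree_C_le) _
  have hx0 : ∀ j : ℕ, (b : ℕ) < j → aeval (fun i => Polynomial.C (a i)) (x k n (j + 1)) = 0 := by
    intro j hj
    by_cases h : j < n
    · rw [aeval_x_succ_of_lt _ h, hb' _ (show b < ⟨j, h⟩ from hj), map_zero]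
    · rw [x_of_lt k n (by omega), map_zero]
  constructor
  · rw [flowPt_D_apply]
    refine degree_sum_eq_of_dominant (i₀ := (b : ℕ)) (by simp) ?_ ?_
    · rw [show ((⟨0, hn⟩ : Fin n) : ℕ) + b + 1 = b + 1 by simp, aeval_x_succ_of_lt _ b.2,
        mul_assoc, Polynomial.degree_mul, degree_pow_mul_eq _ hs (Polynomial.degree_C hb)]
      have : ((n - 1 - (0 : ℕ)).choose b : k) ≠ 0 := by
        exact_mod_cast (Nat.choose_pos (by omega)).ne'
      rw [← map_natCast (Polynomial.C (R := k)), Polynomial.degree_C this]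
      simp
    · intro i _ hi
      rcases lt_or_gt_of_ne hi with hi | hi
      · refine (degree_natCast_mul_pow_mul_le _ i hs.le (hx _)).trans_lt ?_
        have := Nat.mul_lt_mul_of_pos_right hi hT
        exact_mod_cast (by omega : i * T + 0 < b * T)
      · rw [hx0 _ (by simpa using hi), mul_zero, Polynomial.degree_zero]
        exact WithBot.bot_lt_coe _
  · intro j hj
    rw [flowPt_D_apply]
    refine degree_sum_lt_of_forall fun i _ => ?_
    rcases Nat.lt_or_ge i b with hi | hi
    · refine (degree_natCast_mul_pow_mul_le _ i hs.le (hx _)).trans_lt ?_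
      have := Nat.mul_lt_mul_of_pos_right hi hT
      exact_mod_cast (by omega : i * T + 0 < b * T)
    · rw [hx0 _ (by omega), mul_zero, Polynomial.degree_zero]
      exact WithBot.bot_lt_coe _

theorem degree_aeval_f_of_chord (hn : 3 ≤ n) (y : Fin n → Polynomial k) {a b : ℕ}
    (h0 : (y ⟨0, by omega⟩).degree = a) (h1 : (y ⟨n - 1, by omega⟩).degree = b)
    (hmid : ∀ j : Fin n, 0 < (j : ℕ) → (j : ℕ) < n - 1 → ∃ d : ℕ, (y j).degree ≤ d ∧
      (n - 1) * d < (n - 1 - j) * a + j * b) :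
    (aeval y (f k n)).degree = (halfDeg n * (a + b) : ℕ) := by
  have h := natDegree_aeval_f_sub_lt (k := k) hn y (Polynomial.natDegree_le_of_degree_le h0.le)
    (Polynomial.natDegree_le_of_degree_le h1.le) fun j hj hj' => by
      obtain ⟨d, hd, hlt⟩ := hmid j hj hj'
      exact (Nat.mul_le_mul_left _ (Polynomial.natDegree_le_of_degree_le hd)).trans_lt hlt
  have h2 : (y ⟨0, by omega⟩ ^ halfDeg n * y ⟨n - 1, by omega⟩ ^ halfDeg n).degree =
      (halfDeg n * (a + b) : ℕ) := by
    rw [Polynomial.degree_mul, Polynomial.degree_pow, Polynomial.degree_pow, h0, h1]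
    push_cast
    simp [mul_add]
  rw [← sub_add_cancel (aeval y (f k n))
    (y ⟨0, by omega⟩ ^ halfDeg n * y ⟨n - 1, by omega⟩ ^ halfDeg n),
    Polynomial.degree_add_eq_right_of_degree_lt, h2]
  rw [h2]
  exact Polynomial.degree_le_natDegree.trans_lt (by exact_mod_cast h)

end Degree

/-! ### The polar form in odd dimension -/

section Polar

variable {k : Type*} [Field k] [CharZero k] {n : ℕ} {R : Type*} [CommRing R] [Algebra k R]

/-- The coefficients are symmetric under `i ↦ 2 r - i`, so the two mixed sums agree and cancel the
factor 1/2. -/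
theorem aeval_f_add_of_odd {r : ℕ} (hr : n = 2 * r + 1) (y z : Fin n → R) :
    aeval (y + z) (f k n) = aeval y (f k n) + aeval z (f k n) +
      ∑ i ∈ Finset.range (2 * r + 1), algebraMap k R (fOddCoeff k r i) *
        (aeval y (x k n (i + 1)) * aeval z (x k n (2 * r - i + 1))) := by
  have hsym : ∑ i ∈ Finset.range (2 * r + 1), algebraMap k R (fOddCoeff k r i) *
        (aeval z (x k n (i + 1)) * aeval y (x k n (2 * r - i + 1))) =
      ∑ i ∈ Finset.range (2 * r + 1), algebraMap k R (fOddCoeff k r i) *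
        (aeval y (x k n (i + 1)) * aeval z (x k n (2 * r - i + 1))) := by
    rw [← Finset.sum_flip]
    refine Finset.sum_congr rfl fun i hi => ?_
    have hi' : i ≤ 2 * r := by simpa [Nat.lt_succ_iff] using hi
    have hc : fOddCoeff k r (2 * r - i) = fOddCoeff k r i := by
      have h1 : ((-1 : k)) ^ (2 * r - i) = (-1) ^ i := by
        rw [neg_one_pow_eq_pow_mod_two, neg_one_pow_eq_pow_mod_two (n := i)]
        congr 1
        omega
      rw [fOddCoeff, fOddCoeff, h1, Nat.choose_symm hi']
    rw [hc, Nat.sub_sub_self hi']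
    ring
  have hC : ∀ (w : Fin n → R) (c : k), aeval w (C c : MvPolynomial (Fin n) k) = algebraMap k R c :=
    fun w c => (aeval w).commutes c
  have half : algebraMap k R (1 / 2) + algebraMap k R (1 / 2) = 1 := by
    rw [← map_add, add_halves, map_one]
  rw [f_of_odd k n r hr, fOdd_succ]
  simp only [map_mul, map_sum, hC, aeval_x_add]
  have expand : ∀ a b c d e : R, a * ((b + c) * (d + e)) =
      a * (b * d) + a * (c * e) + a * (b * e) + a * (c * d) := by intros; ring
  simp only [expand, Finset.sum_add_distrib, hsym]
  linear_combination half * ∑ i ∈ Finset.range (2 * r + 1), algebraMap k R (fOddCoeff k r i) *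
        (aeval y (x k n (i + 1)) * aeval z (x k n (2 * r - i + 1)))

end Polar

/-! ### Growth of `f` along alternating flows -/

section Growth

variable {k : Type*} [Field k] {n : ℕ}

theorem degree_aeval_f_le_of_odd {r : ℕ} (hr : n = 2 * r + 1) {z : Fin n → Polynomial k} {d : ℕ}
    (hz : ∀ j, (z j).degree ≤ d) : (aeval z (f k n)).degree ≤ (2 * d : ℕ) := by
  rw [f_of_odd k n r hr, fOdd_succ, C_mul', map_smul]
  refine (Polynomial.degree_smul_le _ _).trans ?_
  rw [map_sum]
  refine degree_sum_le_of_forall fun i _ => ?_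
  rw [C_mul', map_smul, map_mul]
  refine (Polynomial.degree_smul_le _ _).trans ((Polynomial.degree_mul_le _ _).trans ?_)
  refine (add_le_add (degree_aeval_x_le hz _) (degree_aeval_x_le hz _)).trans ?_
  rw [two_mul]
  push_cast
  exact le_rfl

variable [CharZero k]

/-- The heart of the growth argument. The first summand alone has the small value `f(z)`, so its
leading parts cancel in `f`. Undoing flows that preserve `f` moves the sum to a point where one
product of extreme coordinates visibly dominates. -/
theorem degree_aeval_f_flow_add_flow (hn : 3 ≤ n) {z : Fin n → Polynomial k}
    {h t : Polynomial k} {a : Fin n → k} {c : k} {Z T : ℕ} {b : Fin n}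
    (hz : ∀ j, (z j).degree ≤ Z) (hzl : (z ⟨n - 1, by omega⟩).degree = Z) (hZ : 1 ≤ Z)
    (hh : h.degree = T) (ht : t.degree = T) (hZT : halfDeg n * Z ≤ T) (hc : c ≠ 0)
    (hb : a b ≠ 0) (hb' : ∀ j, b < j → a j = 0) :
    (aeval (flowPt (isLocallyNilpotent_D' k n) (Polynomial.C c)
        (flowPt (isLocallyNilpotent_D k n) h z) +
      flowPt (isLocallyNilpotent_D k n) t fun i => Polynomial.C (a i)) (f k n)).degree =
      (halfDeg n * ((n - 1) * T + Z + b * T) : ℕ) := by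
  have hκ : 1 ≤ halfDeg n := by rw [halfDeg]; split_ifs <;> norm_num
  have hZT' : Z ≤ T := (Nat.le_mul_of_pos_left Z hκ).trans hZT
  have hT : 1 ≤ T := hZ.trans hZT'
  have hn0 : 0 < n := by omega
  set r := flowPt (isLocallyNilpotent_D k n) h z with hr
  set w := flowPt (isLocallyNilpotent_D k n) t fun i => Polynomial.C (a i) with hw
  set v := flowPt (isLocallyNilpotent_D' k n) (Polynomial.C (-c)) w with hv
  -- Pulling back along `D'` gives `f(r + v)`, where the degrees of `r` decrease along the
  -- coordinates with slope `T` and those of `v` are all `b T`.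
  have hwv : w = flowPt (isLocallyNilpotent_D' k n) (Polynomial.C c) v := by
    rw [hv, flowPt_flowPt, ← map_add, neg_add_cancel, map_zero, flowPt_zero]
  rw [hwv, ← flowPt_D'_add, aeval_flowPt_of_mem_ker _ _ _ (D'_f k n hn0)]
  have rdeg : ∀ j : Fin n, (r j).degree = ((n - 1 - j) * T + Z : ℕ) :=
    degree_flowPt_D_eq hn0 hz hzl hT hh
  obtain ⟨w0, wj⟩ := degree_flowPt_D_const hn0 hb hb' hT ht
  have vdeg : ∀ j, (v j).degree = (b * T : ℕ) :=
    degree_flowPt_D'_eq hn0 w0 wj (neg_ne_zero.mpr hc)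
  have hbn : (b : ℕ) * T ≤ (n - 1) * T := Nat.mul_le_mul_right _ (by omega)
  have h2T : 2 * T ≤ (n - 1) * T := Nat.mul_le_mul_right _ (by omega)
  rcases odd_or_even n hn0 with ⟨m, hm⟩ | ⟨m, hm⟩
  -- For `κ = 1` only `Z ≤ T` is known, so for `b = 1` the last coordinates of `r` and `v` may have
  -- equal degree and cancel. The polar expansion avoids this: `f(r) = f(z)` and `f(v) = f(a)` are
  -- small, and the mixed term is dominated by `r₁ v_n`.
  · rw [aeval_f_add_of_odd hm, halfDeg_of_odd n m hm, one_mul]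
    have e1 : (aeval r (f k n)).degree ≤ (2 * Z : ℕ) := by
      rw [hr, aeval_flowPt_of_mem_ker _ _ _ (D_f k n hn0)]
      exact degree_aeval_f_le_of_odd hm hz
    have e2 : (aeval v (f k n)).degree ≤ (2 * 0 : ℕ) := by
      rw [hv, aeval_flowPt_of_mem_ker _ _ _ (D'_f k n hn0), hw,
        aeval_flowPt_of_mem_ker _ _ _ (D_f k n hn0)]
      exact degree_aeval_f_le_of_odd hm fun j => Polynomial.degree_C_le
    have e3 : (∑ i ∈ Finset.range (2 * m + 1), algebraMap k (Polynomial k) (fOddCoeff k m i) *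
        (aeval r (x k n (i + 1)) * aeval v (x k n (2 * m - i + 1)))).degree =
        ((n - 1) * T + Z + b * T : ℕ) := by
      refine degree_sum_eq_of_dominant (i₀ := 0) (by simp) ?_ ?_
      · rw [aeval_x_succ_of_lt r hn0, aeval_x_succ_of_lt v (show 2 * m - 0 < n by omega),
          show fOddCoeff k m 0 = 1 by simp [fOddCoeff], map_one, one_mul, Polynomial.degree_mul,
          rdeg, vdeg]
        push_cast
        simp
      · intro i hi hi0
        have hi' : i < 2 * m + 1 := by simpa using hi
        rw [aeval_x_succ_of_lt r (show i < n by omega),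
          aeval_x_succ_of_lt v (show 2 * m - i < n by omega), ← Algebra.smul_def]
        refine (Polynomial.degree_smul_le _ _).trans_lt ?_
        rw [Polynomial.degree_mul, rdeg, vdeg]
        have : (n - 1 - i) * T < (n - 1) * T := Nat.mul_lt_mul_of_pos_right (by omega) hT
        exact_mod_cast (by omega : (n - 1 - i) * T + Z + b * T < _)
    rw [Polynomial.degree_add_eq_right_of_degree_lt, e3]
    rw [e3]
    refine (Polynomial.degree_add_le _ _).trans_lt (max_lt (e1.trans_lt ?_) (e2.trans_lt ?_))
    · exact_mod_cast (by omega : 2 * Z < (n - 1) * T + Z + b * T)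
    · exact_mod_cast (by omega : 2 * 0 < (n - 1) * T + Z + b * T)
  · rw [halfDeg_of_even n m hm] at hZT
    by_cases hb0 : (b : ℕ) = 0
    -- For `b = 0` all `v` have degree 0. Undoing the flow of `D` as well gives `z + u`, with
    -- extreme degrees `(n - 1) T` and `Z` and the middle below the chord.
    · set u := flowPt (isLocallyNilpotent_D k n) (-h) v with hu
      have hvu : v = flowPt (isLocallyNilpotent_D k n) h u := by
        rw [hu, flowPt_flowPt, neg_add_cancel, flowPt_zero]
      have udeg : ∀ j : Fin n, (u j).degree = ((n - 1 - j) * T + 0 : ℕ) := by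
        refine degree_flowPt_D_eq hn0 (fun j => ?_) ?_ hT (by rw [Polynomial.degree_neg, hh])
        · rw [vdeg, hb0, zero_mul]
        · rw [vdeg, hb0, zero_mul]
      rw [hvu, hr, ← flowPt_D_add, aeval_flowPt_of_mem_ker _ _ _ (D_f k n hn0)]
      rw [degree_aeval_f_of_chord hn (a := (n - 1) * T) (b := Z)]
      · rw [hb0, zero_mul, add_zero]
      · rw [Pi.add_apply, Polynomial.degree_add_eq_right_of_degree_lt, udeg]
        · simp
        · rw [udeg]
          exact (hz _).trans_lt (by
            exact_mod_cast (by simp only [Nat.sub_zero]; omega : Z < (n - 1 - 0) * T + 0))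
      · rw [Pi.add_apply, Polynomial.degree_add_eq_left_of_degree_lt, hzl]
        rw [hzl, udeg]
        exact_mod_cast (by simp only [Nat.sub_self]; omega : (n - 1 - (n - 1)) * T + 0 < Z)
      · intro j hj hj'
        refine ⟨max Z ((n - 1 - j) * T), ?_, ?_⟩
        · rw [Pi.add_apply]
          refine (Polynomial.degree_add_le _ _).trans ?_
          rw [udeg, add_zero]
          exact (max_le_max (hz j) le_rfl).trans (by push_cast; exact le_rfl)
        · obtain ⟨q, hq⟩ : ∃ q, n - 1 = j + q + 1 := ⟨n - 1 - j - 1, by omega⟩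
          have hq' : n - 1 - j = q + 1 := by omega
          rw [hq']
          rw [hq] at h2T ⊢
          rcases max_cases Z ((q + 1) * T) with ⟨e, -⟩ | ⟨e, -⟩ <;> rw [e]
          · nlinarith [Nat.mul_le_mul_left (q + 1) h2T, Nat.mul_pos (Nat.succ_pos q) hZ]
          · nlinarith [Nat.mul_pos hj hZ]
    -- For `b ≥ 1`, `2 Z ≤ T` gives `Z < b T`, so `v` wins in the last coordinate and `r` in the
    -- first; the middle coordinates of `r + v` lie below the chord.
    · have hbT : T ≤ b * T := Nat.le_mul_of_pos_left T (by omega)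
      rw [degree_aeval_f_of_chord hn (a := (n - 1) * T + Z) (b := b * T)]
      · rw [Pi.add_apply, Polynomial.degree_add_eq_left_of_degree_lt, rdeg]
        · simp
        · rw [rdeg, vdeg]
          exact_mod_cast (by simp only [Nat.sub_zero]; omega : (b : ℕ) * T < (n - 1 - 0) * T + Z)
      · rw [Pi.add_apply, Polynomial.degree_add_eq_right_of_degree_lt, vdeg]
        rw [rdeg, vdeg]
        exact_mod_cast (by simp only [Nat.sub_self]; omega : (n - 1 - (n - 1)) * T + Z < b * T)
      · intro j hj hj'
        refine ⟨max ((n - 1 - j) * T + Z) (b * T), ?_, ?_⟩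
        · rw [Pi.add_apply]
          refine (Polynomial.degree_add_le _ _).trans ?_
          rw [rdeg, vdeg]
          exact le_of_eq (by push_cast; rfl)
        · obtain ⟨q, hq⟩ : ∃ q, n - 1 = j + q + 1 := ⟨n - 1 - j - 1, by omega⟩
          have hq' : n - 1 - j = q + 1 := by omega
          have hZb : Z < b * T := by omega
          generalize (b : ℕ) * T = B at *
          rw [hq']
          rw [hq] at hbn ⊢
          rcases max_cases ((q + 1) * T + Z) B with ⟨e, -⟩ | ⟨e, -⟩ <;> rw [e]
          · nlinarith [Nat.mul_lt_mul_of_pos_left hZb hj]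
          · nlinarith [Nat.mul_le_mul_left (q + 1) hbn, Nat.mul_pos (Nat.succ_pos q) hZ]

end Growth

/-! ### Words in `φ` and the translations -/

section Words

variable {k : Type*} [Field k] [CharZero k] {n : ℕ}

theorem D_f_pow (hn : 0 < n) (l : ℕ) : D k n (f k n ^ l) = 0 := by
  rw [Derivation.leibniz_pow, D_f k n hn]
  simp

/-- The automorphism `exp (f ^ l D)`. -/
def sigma (k : Type*) [Field k] [CharZero k] {n : ℕ} (hn : 0 < n) (l : ℕ) : PolyAut k n :=
  expAut (f k n ^ l • D k n) ((isLocallyNilpotent_D k n).smul (D_f_pow hn l))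

/-- The automorphism `exp (f ^ l D) ∘ exp D' ∘ exp (- f ^ l D)`. -/
def phi (k : Type*) [Field k] [CharZero k] {n : ℕ} (hn : 0 < n) (l : ℕ) : PolyAut k n :=
  sigma k hn l * expAut (D' k n) (isLocallyNilpotent_D' k n) * (sigma k hn l)⁻¹

variable {R : Type*} [CommRing R] [Algebra k R]

theorem aeval_sigma (hn : 0 < n) (l : ℕ) (y : Fin n → R) (p : MvPolynomial (Fin n) k) :
    aeval y (sigma k hn l p) =
      aeval (flowPt (isLocallyNilpotent_D k n) (aeval y (f k n) ^ l) y) p := by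
  rw [aeval_flowPt, sigma,
    map_expAut_smul (isLocallyNilpotent_D k n) (D_f_pow hn l), map_pow]

theorem aeval_sigma_inv (hn : 0 < n) (l : ℕ) (y : Fin n → R) (p : MvPolynomial (Fin n) k) :
    aeval y ((sigma k hn l)⁻¹ p) =
      aeval (flowPt (isLocallyNilpotent_D k n) (-aeval y (f k n) ^ l) y) p := by
  have h : D k n (-f k n ^ l) = 0 := by rw [map_neg, D_f_pow hn, neg_zero]
  rw [aeval_flowPt, sigma, expAut_smul_inv (isLocallyNilpotent_D k n) (D_f_pow hn l),
    map_expAut_smul (isLocallyNilpotent_D k n) h,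
    map_neg, map_pow]

theorem phi_zpow (hn : 0 < n) (l : ℕ) (i : ℤ) : phi k hn l ^ i = sigma k hn l *
    expAut (D' k n) (isLocallyNilpotent_D' k n) ^ i * (sigma k hn l)⁻¹ :=
  conj_zpow

/-- Automorphisms act on points contravariantly, so the leftmost factor moves the point first. All
the flows preserve `f`, hence the last time is minus the first. -/
theorem aeval_phi_zpow (hn : 0 < n) (l : ℕ) (i : ℤ) (y : Fin n → R)
    (p : MvPolynomial (Fin n) k) :
    aeval y ((phi k hn l ^ i) p) =
      aeval (flowPt (isLocallyNilpotent_D k n) (-aeval y (f k n) ^ l)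
        (flowPt (isLocallyNilpotent_D' k n) (i : R)
          (flowPt (isLocallyNilpotent_D k n) (aeval y (f k n) ^ l) y))) p := by
  rw [phi_zpow, AlgEquiv.mul_apply, AlgEquiv.mul_apply, aeval_sigma, map_expAut_zpow,
    ← aeval_flowPt, aeval_sigma_inv, aeval_flowPt_of_mem_ker _ _ _ (D'_f k n hn),
    aeval_flowPt_of_mem_ker _ _ _ (D_f k n hn)]

theorem aeval_translation {k : Type*} [Field k] {n : ℕ} {R : Type*} [CommRing R] [Algebra k R]
    (a : Fin n → k) (y : Fin n → R) (p : MvPolynomial (Fin n) k) :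
    aeval y (translation a p) = aeval (y + fun i => algebraMap k R (a i)) p := by
  have : (aeval y).comp (translation a : MvPolynomial (Fin n) k →ₐ[k] MvPolynomial (Fin n) k) =
      aeval (y + fun i => algebraMap k R (a i)) := by
    ext i
    simp [translation_X]
  exact DFunLike.congr_fun this p

theorem flowPt_D_last (hn : 0 < n) (s : R) (y : Fin n → R) :
    flowPt (isLocallyNilpotent_D k n) s y ⟨n - 1, by omega⟩ = y ⟨n - 1, by omega⟩ := by
  rw [flowPt, flow_of_mem_ker, aeval_X]
  rw [X_eq_x, D_x, x_of_lt k n (by simp only; omega), mul_zero]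

/-- The points over `k[s]` on which the words in `φ` and the translations grow. -/
def Growing (hn : 0 < n) (l : ℕ) (y : Fin n → Polynomial k) : Prop :=
  ∃ (s : Polynomial k) (z : Fin n → Polynomial k) (Z T : ℕ),
    y = flowPt (isLocallyNilpotent_D k n) (-s) z ∧ (∀ j, (z j).degree ≤ Z) ∧
    (z ⟨n - 1, by omega⟩).degree = Z ∧ 1 ≤ Z ∧ (aeval z (f k n) ^ l).degree = T ∧
    s.degree < T ∧ halfDeg n * Z ≤ T

/-- For `y = exp (-s D) z` and `t = f(z) ^ l`, `φ ^ i` flows `z` for time `t - s`, which still has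
degree `T` because `deg s < T`, then equalises the degrees by `D'`, and ends with the flow of time
`-t`. The outcome has the shape of `Growing` with `t` in the role of `s`. The bound `κ Z ≤ T` is
what `degree_aeval_f_flow_add_flow` consumes. -/
theorem Growing.phi_zpow {l : ℕ} (hn : 3 ≤ n) (hl : 1 ≤ l) {y : Fin n → Polynomial k}
    (hy : Growing (by omega) l y) {i : ℤ} (hi : i ≠ 0) :
    ∃ y' : Fin n → Polynomial k,
      (∀ p, aeval y ((phi k (by omega) l ^ i) p) = aeval y' p) ∧
      1 < (y' ⟨n - 1, by omega⟩).degree ∧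
      ∀ a : Fin n → k, a ≠ 0 → Growing (by omega) l (y' + fun i => Polynomial.C (a i)) := by
  have hn0 : 0 < n := by omega
  obtain ⟨s, z, Z, T, rfl, hz, hzl, hZ, ht, hs, hZT⟩ := hy
  have hκ : 1 ≤ halfDeg n := by rw [halfDeg]; split_ifs <;> norm_num
  have hT : 1 ≤ T := hZ.trans ((Nat.le_mul_of_pos_left Z hκ).trans hZT)
  refine ⟨_, aeval_phi_zpow hn0 l i _, ?_⟩
  rw [aeval_flowPt_of_mem_ker _ _ _ (D_f k n hn0)]
  set t := aeval z (f k n) ^ l with htdef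
  have hh : (-s + t).degree = T := by
    rw [Polynomial.degree_add_eq_right_of_degree_lt, ht]
    rwa [Polynomial.degree_neg, ht]
  have hi' : (i : k) ≠ 0 := by exact_mod_cast hi
  rw [flowPt_flowPt, show ((i : ℤ) : Polynomial k) = Polynomial.C (i : k) by simp]
  have rdeg := degree_flowPt_D_eq hn0 hz hzl hT hh
  have vdeg : ∀ j, (flowPt (isLocallyNilpotent_D' k n) (Polynomial.C (i : k))
      (flowPt (isLocallyNilpotent_D k n) (-s + t) z) j).degree = ((n - 1) * T + Z : ℕ) := by
    refine degree_flowPt_D'_eq hn0 (by rw [rdeg]; simp) (fun j hj => ?_) hi'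
    rw [rdeg]
    have : (n - 1 - j) * T < (n - 1) * T := Nat.mul_lt_mul_of_pos_right (by omega) hT
    exact_mod_cast (by omega : (n - 1 - j) * T + Z < (n - 1) * T + Z)
  have h2T : 2 * T ≤ (n - 1) * T := Nat.mul_le_mul_right _ (by omega)
  constructor
  · rw [flowPt_D_last hn0, vdeg]
    exact_mod_cast (by omega : 1 < (n - 1) * T + Z)
  · intro a ha
    obtain ⟨b, hb, hb'⟩ := exists_last_ne_zero ha
    obtain ⟨w0, wj⟩ := degree_flowPt_D_const hn0 hb hb' hT ht
    have hbn : (b : ℕ) * T ≤ (n - 1) * T := Nat.mul_le_mul_right _ (by omega)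
    have zdeg : ∀ j, ((flowPt (isLocallyNilpotent_D' k n) (Polynomial.C (i : k))
        (flowPt (isLocallyNilpotent_D k n) (-s + t) z) +
        flowPt (isLocallyNilpotent_D k n) t fun i => Polynomial.C (a i)) j).degree =
        ((n - 1) * T + Z : ℕ) := by
      intro j
      have hj : (flowPt (isLocallyNilpotent_D k n) t (fun i => Polynomial.C (a i)) j).degree ≤
          (b * T : ℕ) := by
        rcases Nat.eq_zero_or_pos (j : ℕ) with h | h
        · rw [show j = ⟨0, hn0⟩ from Fin.ext h, w0]
        · exact (wj j h).le
      rw [Pi.add_apply, Polynomial.degree_add_eq_left_of_degree_lt, vdeg]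
      rw [vdeg]
      exact hj.trans_lt (by exact_mod_cast (by omega : (b : ℕ) * T < (n - 1) * T + Z))
    have fdeg := degree_aeval_f_flow_add_flow hn hz hzl hZ hh ht hZT hi' hb hb'
    -- The translation is carried through the last flow: `exp (-t D) z' + a = exp (-t D) (z' + exp
    -- (t D) a)`, and the added vector has degree at most `b T`, below that of `z'`.
    refine ⟨t, _, (n - 1) * T + Z, l * (halfDeg n * ((n - 1) * T + Z + b * T)), ?_,
      fun j => (zdeg j).le, zdeg _, by omega, ?_, ?_, ?_⟩
    · rw [flowPt_D_add, flowPt_flowPt _ t, add_neg_cancel, flowPt_zero]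
    · rw [Polynomial.degree_pow, fdeg]
      push_cast
      simp
    · rw [ht]
      have h1 : (n - 1) * T + Z + b * T ≤ l * (halfDeg n * ((n - 1) * T + Z + b * T)) :=
        (Nat.le_mul_of_pos_left _ hκ).trans (Nat.le_mul_of_pos_left _ hl)
      exact_mod_cast (by omega : T < l * (halfDeg n * ((n - 1) * T + Z + b * T)))
    · refine le_trans ?_ (Nat.le_mul_of_pos_left _ hl)
      exact Nat.mul_le_mul_left _ (Nat.le_add_right _ _)

/-- The products `φ ^ i₁ τ₁ φ ^ i₂ ⋯ τ_{s-1} φ ^ i_s` with nonzero exponents and nontrivial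
translations. -/
inductive IsWord {k : Type*} [Field k] {n : ℕ} (φ : PolyAut k n) : PolyAut k n → Prop
  | single (i : ℤ) (hi : i ≠ 0) : IsWord φ (φ ^ i)
  | cons (i : ℤ) (a : Fin n → k) (w : PolyAut k n) (hi : i ≠ 0) (ha : a ≠ 0) (hw : IsWord φ w) :
    IsWord φ (φ ^ i * translation a * w)

/-- The variable `x_n` is tested because the final flow of `D` leaves it fixed, so its degree shows
without cancellation. -/
theorem IsWord.one_lt_degree {l : ℕ} (hn : 3 ≤ n) (hl : 1 ≤ l) {w : PolyAut k n}
    (hw : IsWord (phi k (by omega) l) w) :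
    ∀ y : Fin n → Polynomial k, Growing (by omega) l y →
      1 < (aeval y (w (X ⟨n - 1, by omega⟩))).degree := by
  induction hw with
  | single i hi =>
    intro y hy
    obtain ⟨y', h1, h2, -⟩ := hy.phi_zpow hn hl hi
    rwa [h1, aeval_X]
  | cons i a w hi ha _ ih =>
    intro y hy
    obtain ⟨y', h1, -, h3⟩ := hy.phi_zpow hn hl hi
    rw [AlgEquiv.mul_apply, AlgEquiv.mul_apply, h1, aeval_translation]
    exact ih _ (h3 a ha)

/-- At this point `f` has degree `2 κ`, and `s = 0` starts the induction. -/
theorem growing_corner {l : ℕ} (hn : 3 ≤ n) (hl : 1 ≤ l) :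
    Growing (k := k) (n := n) (by omega) l
      fun j => if (j : ℕ) = 0 ∨ (j : ℕ) = n - 1 then Polynomial.X else 0 := by
  have h1 : ∀ j : ℕ, ((if j = 0 ∨ j = n - 1 then Polynomial.X else 0 : Polynomial k)).degree ≤
      (1 : ℕ) := by
    intro j
    split_ifs
    · exact Polynomial.degree_X_le
    · simp
  have hκ : 1 ≤ halfDeg n := by rw [halfDeg]; split_ifs <;> norm_num
  refine ⟨0, _, 1, l * (halfDeg n * (1 + 1)), ?_, fun j => h1 j, ?_, le_rfl, ?_, ?_, ?_⟩
  · rw [neg_zero, flowPt_zero]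
  · simp
  · rw [Polynomial.degree_pow, degree_aeval_f_of_chord hn (a := 1) (b := 1)]
    · push_cast
      simp
    · simp
    · simp
    · intro j hj hj'
      refine ⟨0, ?_, by omega⟩
      rw [if_neg (by omega)]
      simp
  · rw [Polynomial.degree_zero]
    exact WithBot.bot_lt_coe _
  · refine le_trans ?_ (Nat.le_mul_of_pos_left _ hl)
    exact Nat.mul_le_mul_left _ (by norm_num)

end Words

/-! ### Affine automorphisms as those preserving polynomials of degree at most one -/

section Affine

variable {k : Type*} [Field k] {n : ℕ}

/-- The space of polynomials of degree at most one. -/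
def affineForms (k : Type*) [Field k] (n : ℕ) : Submodule k (MvPolynomial (Fin n) k) :=
  Submodule.span k (insert 1 (Set.range X))

theorem one_mem_affineForms : (1 : MvPolynomial (Fin n) k) ∈ affineForms k n :=
  Submodule.subset_span (Set.mem_insert _ _)

theorem C_mem_affineForms (c : k) : (C c : MvPolynomial (Fin n) k) ∈ affineForms k n := by
  rw [← mul_one (C c), C_mul']
  exact Submodule.smul_mem _ _ one_mem_affineForms

theorem X_mem_affineForms (i : Fin n) : (X i : MvPolynomial (Fin n) k) ∈ affineForms k n :=
  Submodule.subset_span (Set.mem_insert_of_mem _ ⟨i, rfl⟩)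

theorem x_mem_affineForms (i : ℕ) : x k n i ∈ affineForms k n := by
  rw [x]
  split_ifs
  · exact X_mem_affineForms _
  · exact zero_mem _

theorem map_mem_affineForms {F : Type*}
    [FunLike F (MvPolynomial (Fin n) k) (MvPolynomial (Fin n) k)]
    [AlgHomClass F k (MvPolynomial (Fin n) k) (MvPolynomial (Fin n) k)] {ψ : F}
    (h : ∀ i, ψ (X i) ∈ affineForms k n) {p : MvPolynomial (Fin n) k}
    (hp : p ∈ affineForms k n) : ψ p ∈ affineForms k n := by
  induction hp using Submodule.span_induction with
  | mem p hp =>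
    rcases hp with rfl | ⟨i, rfl⟩
    · rw [map_one]
      exact one_mem_affineForms
    · exact h i
  | zero => rw [map_zero]; exact zero_mem _
  | add p q _ _ hp hq => rw [map_add]; exact add_mem hp hq
  | smul c p _ hp => rw [map_smul]; exact Submodule.smul_mem _ _ hp

theorem exists_of_mem_affineForms {p : MvPolynomial (Fin n) k} (hp : p ∈ affineForms k n) :
    ∃ (v : Fin n → k) (b : k), p = (∑ j, C (v j) * X j) + C b := by
  induction hp using Submodule.span_induction with
  | mem p hp =>
    rcases hp with rfl | ⟨i, rfl⟩
    · exact ⟨0, 1, by simp⟩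
    · classical
      refine ⟨Pi.single i 1, 0, ?_⟩
      rw [Finset.sum_eq_single_of_mem i (Finset.mem_univ i)
        (fun j _ hj => by rw [Pi.single_eq_of_ne hj, C_0, zero_mul])]
      simp
  | zero => exact ⟨0, 0, by simp⟩
  | add p q _ _ hp hq =>
    obtain ⟨v, b, rfl⟩ := hp
    obtain ⟨w, c, rfl⟩ := hq
    refine ⟨v + w, b + c, ?_⟩
    simp only [Pi.add_apply, C_add, add_mul, Finset.sum_add_distrib]
    ring
  | smul c p _ hp =>
    obtain ⟨v, b, rfl⟩ := hp
    refine ⟨c • v, c * b, ?_⟩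
    simp only [Pi.smul_apply, smul_eq_mul, C_mul, smul_add, Finset.smul_sum, smul_eq_C_mul,
      mul_assoc]

theorem mem_Aff_iff {ψ : PolyAut k n} : ψ ∈ Aff k n ↔ ∀ i, ψ (X i) ∈ affineForms k n := by
  constructor
  · rintro ⟨A, b, h⟩ i
    rw [h]
    refine add_mem (Submodule.sum_mem _ fun j _ => ?_) (C_mem_affineForms _)
    rw [C_mul']
    exact Submodule.smul_mem _ _ (X_mem_affineForms j)
  · intro h
    -- An injective linear map of a finite-dimensional space into itself is onto, so `ψ⁻¹` preserves
    -- affine forms too and its linear part supplies the inverse matrix.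
    have hfin : FiniteDimensional k (affineForms k n) :=
      FiniteDimensional.span_of_finite k ((Set.finite_range _).insert _)
    have hinv : ∀ p ∈ affineForms k n, ψ⁻¹ p ∈ affineForms k n := by
      have hmap : (affineForms k n).map (ψ.toLinearMap) = affineForms k n := by
        refine Submodule.eq_of_le_of_finrank_eq ?_ ?_
        · rintro _ ⟨p, hp, rfl⟩
          exact map_mem_affineForms h hp
        · exact LinearEquiv.finrank_map_eq ψ.toLinearEquiv _
      intro p hp
      rw [← hmap] at hp
      obtain ⟨q, hq, rfl⟩ := hp
      change ψ⁻¹ (ψ q) ∈ _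
      rwa [← AlgEquiv.mul_apply, inv_mul_cancel]
    choose A b hA using fun i => exists_of_mem_affineForms (h i)
    choose A' b' hA' using fun i => exists_of_mem_affineForms (hinv _ (X_mem_affineForms i))
    have hC : ∀ c, ψ (C c) = C c := fun c => ψ.commutes c
    have key : ∀ i j, ∑ l, A' i l * A l j = if i = j then 1 else 0 := by
      intro i j
      have e : ψ (ψ⁻¹ (X i)) = X i := by rw [← AlgEquiv.mul_apply, mul_inv_cancel]; rfl
      rw [hA', map_add, map_sum, hC] at e
      simp only [map_mul, hC, hA] at e
      have e2 := congrArg (coeff (Finsupp.single j 1)) e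
      classical
      rw [coeff_X] at e2
      simp only [coeff_add, coeff_sum, coeff_C_mul, coeff_C, coeff_X,
        Finsupp.single_left_inj one_ne_zero, mul_ite, mul_one, mul_zero,
        Finset.sum_ite_eq', Finset.mem_univ, if_true] at e2
      have hne : (0 : Fin n →₀ ℕ) ≠ Finsupp.single j 1 := by
        intro h0
        have := congrArg (fun s => s j) h0
        simp at this
      simpa [hne] using e2
    have hmul : (Matrix.of fun i l => A' i l) * (Matrix.of fun l j => A l j) = 1 := by
      ext i j
      rw [Matrix.mul_apply, Matrix.one_apply]
      exact key i j
    refine ⟨⟨(Matrix.of fun l j => A l j).transpose, (Matrix.of fun i l => A' i l).transpose,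
      ?_, ?_⟩, b, fun i => hA i⟩
    · rw [← Matrix.transpose_mul, hmul, Matrix.transpose_one]
    · rw [← Matrix.transpose_mul, mul_eq_one_comm.mp hmul, Matrix.transpose_one]

theorem mul_mem_Aff {ψ χ : PolyAut k n} (hψ : ψ ∈ Aff k n) (hχ : χ ∈ Aff k n) :
    ψ * χ ∈ Aff k n := by
  rw [mem_Aff_iff] at *
  exact fun i => map_mem_affineForms hψ (hχ i)

theorem translation_mem_Aff (a : Fin n → k) : translation a ∈ Aff k n := by
  rw [mem_Aff_iff]
  intro i
  rw [translation_X]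
  exact add_mem (X_mem_affineForms i) (C_mem_affineForms _)

theorem degree_aeval_le_of_mem_affineForms {y : Fin n → Polynomial k}
    (hy : ∀ j, (y j).degree ≤ 1) {p : MvPolynomial (Fin n) k} (hp : p ∈ affineForms k n) :
    (aeval y p).degree ≤ 1 := by
  induction hp using Submodule.span_induction with
  | mem p hp =>
    rcases hp with rfl | ⟨i, rfl⟩
    · rw [map_one]
      exact Polynomial.degree_one_le.trans zero_le_one
    · rw [aeval_X]
      exact hy i
  | zero => rw [map_zero, Polynomial.degree_zero]; exact bot_le
  | add p q _ _ hp hq =>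
    rw [map_add]
    exact (Polynomial.degree_add_le _ _).trans (max_le hp hq)
  | smul c p _ hp => rw [map_smul]; exact (Polynomial.degree_smul_le _ _).trans hp

theorem IsWord.notMem_Aff [CharZero k] {l : ℕ} (hn : 3 ≤ n) (hl : 1 ≤ l) {w : PolyAut k n}
    (hw : IsWord (phi k (by omega) l) w) : w ∉ Aff k n := by
  intro h
  refine absurd (degree_aeval_le_of_mem_affineForms (fun j => ?_) (mem_Aff_iff.mp h _))
    (not_le.mpr (hw.one_lt_degree hn hl _ (growing_corner hn hl)))
  split_ifs
  · exact Polynomial.degree_X_le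
  · simp

end Affine

/-! ### Alternating words and free products -/

section FreeProduct

variable {Γ : Type*} [Group Γ] {H K : Subgroup Γ}

/-- The reduced words of the free product `H * K` that begin and end in `H`. -/
inductive IsAlternating : Monoid.Coprod H K → Prop
  | single (h : H) (hh : h ≠ 1) : IsAlternating (.inl h)
  | cons (h : H) (τ : K) (w : Monoid.Coprod H K) (hh : h ≠ 1) (hτ : τ ≠ 1)
    (hw : IsAlternating w) : IsAlternating (.inl h * .inr τ * w)

/-- Left multiplication by a generator either merges with the first letter or prepends one; when the
merged letter is trivial, the word shortens to its tail or to an element of `K`. -/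
theorem eq_inr_or_exists_isAlternating (g : Monoid.Coprod H K) :
    (∃ τ : K, g = .inr τ) ∨ ∃ (τ τ' : K) (w : Monoid.Coprod H K), IsAlternating w ∧
      g = .inr τ * w * .inr τ' := by
  induction g using Monoid.Coprod.induction_on' with
  | one => exact Or.inl ⟨1, (map_one _).symm⟩
  | inr_mul τ g ih =>
    rcases ih with ⟨σ, rfl⟩ | ⟨σ, σ', w, hw, rfl⟩
    · exact Or.inl ⟨τ * σ, (map_mul _ _ _).symm⟩
    · exact Or.inr ⟨τ * σ, σ', w, hw, by rw [map_mul]; group⟩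
  | inl_mul h g ih =>
    by_cases hh : h = 1
    · subst hh
      rwa [map_one, one_mul]
    rcases ih with ⟨σ, rfl⟩ | ⟨σ, σ', w, hw, rfl⟩
    · exact Or.inr ⟨1, σ, _, .single h hh, by rw [map_one, one_mul]⟩
    · by_cases hσ : σ = 1
      · subst hσ
        rw [map_one, one_mul]
        cases hw with
        | single h' hh' =>
          by_cases hp : h * h' = 1
          · refine Or.inl ⟨σ', ?_⟩
            rw [← mul_assoc, ← map_mul, hp, map_one, one_mul]
          · refine Or.inr ⟨1, σ', _, .single (h * h') hp, ?_⟩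
            rw [map_one, one_mul, map_mul, mul_assoc]
        | cons h' τ w hh' hτ hw =>
          by_cases hp : h * h' = 1
          · refine Or.inr ⟨τ, σ', w, hw, ?_⟩
            simp only [← mul_assoc]
            rw [← map_mul, hp, map_one, one_mul]
          · refine Or.inr ⟨1, σ', _, .cons (h * h') τ w hp hτ hw, ?_⟩
            simp only [map_one, one_mul, map_mul, mul_assoc]
      · refine Or.inr ⟨1, σ', _, .cons h σ w hh hσ hw, ?_⟩
        simp only [map_one, one_mul, mul_assoc]

end FreeProduct

/-! ### Consequences of alternating words being non-affine -/

section WordGroup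

variable {k : Type*} [Field k] {n : ℕ} {φ : PolyAut k n}

theorem inv_translation (a : Fin n → k) : (translation a)⁻¹ = translation (-a) := by
  rw [inv_eq_iff_mul_eq_one, translation_mul, add_neg_cancel, translation_zero]

theorem IsWord.mul_translation_mul {v w : PolyAut k n} (hv : IsWord φ v) (hw : IsWord φ w)
    {a : Fin n → k} (ha : a ≠ 0) : IsWord φ (v * translation a * w) := by
  induction hv with
  | single i hi => exact .cons i a w hi ha hw
  | cons i b v hi hb _ ih =>
    have := IsWord.cons i b _ hi hb ih
    simpa only [mul_assoc] using this

theorem IsWord.inv {w : PolyAut k n} (hw : IsWord φ w) : IsWord φ w⁻¹ := by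
  induction hw with
  | single i hi =>
    rw [← zpow_neg]
    exact .single _ (neg_ne_zero.mpr hi)
  | cons i a w hi ha _ ih =>
    have := ih.mul_translation_mul (.single (-i) (neg_ne_zero.mpr hi)) (neg_ne_zero.mpr ha)
    rwa [mul_inv_rev, mul_inv_rev, inv_translation, ← zpow_neg, ← mul_assoc]

theorem isWord_ofFn (s : ℕ) (i : Fin (s + 1) → ℤ) (a : Fin s → Fin n → k) (hi : ∀ j, i j ≠ 0)
    (ha : ∀ j, a j ≠ 0) : IsWord φ (φ ^ i 0 * (List.ofFn fun j : Fin s =>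
      translation (a j) * φ ^ i j.succ).prod) := by
  induction s with
  | zero => simpa using IsWord.single (φ := φ) (i 0) (hi 0)
  | succ s ih =>
    have := IsWord.cons (φ := φ) (i 0) (a 0) _ (hi 0) (ha 0)
      (ih (fun j => i j.succ) (fun j => a j.succ) (fun j => hi _) fun j => ha _)
    rw [List.ofFn_succ, List.prod_cons]
    simpa only [mul_assoc] using this

theorem IsAlternating.isWord {w : Monoid.Coprod (Subgroup.zpowers φ) (Tr k n)}
    (hw : IsAlternating w) :
    IsWord φ (Monoid.Coprod.lift (Subgroup.zpowers φ).subtype (Tr k n).subtype w) := by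
  have hpow : ∀ h : Subgroup.zpowers φ, h ≠ 1 → ∃ i : ℤ, i ≠ 0 ∧ (h : PolyAut k n) = φ ^ i := by
    rintro ⟨_, i, rfl⟩ hh
    refine ⟨i, ?_, rfl⟩
    rintro rfl
    exact hh (Subtype.ext (zpow_zero φ))
  induction hw with
  | single h hh =>
    obtain ⟨i, hi, hhi⟩ := hpow h hh
    rw [Monoid.Coprod.lift_apply_inl, Subgroup.subtype_apply, hhi]
    exact .single i hi
  | cons h τ w hh hτ _ ih =>
    obtain ⟨i, hi, hhi⟩ := hpow h hh
    obtain ⟨_, a, rfl⟩ := τ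
    rw [map_mul, map_mul, Monoid.Coprod.lift_apply_inl, Monoid.Coprod.lift_apply_inr,
      Subgroup.subtype_apply, Subgroup.subtype_apply, hhi]
    refine .cons i a _ hi ?_ ih
    rintro rfl
    exact hτ (Subtype.ext translation_zero)

theorem range_lift_zpowers_Tr :
    (Monoid.Coprod.lift (Subgroup.zpowers φ).subtype (Tr k n).subtype).range =
      Subgroup.closure ({φ} ∪ (Tr k n : Set (PolyAut k n))) := by
  rw [Monoid.Coprod.range_lift, Subgroup.range_subtype, Subgroup.range_subtype,
    Subgroup.closure_union, Subgroup.closure_eq, Subgroup.zpowers_eq_closure]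

theorem mem_Tr_or_exists_isWord {g : PolyAut k n}
    (hg : g ∈ Subgroup.closure ({φ} ∪ (Tr k n : Set (PolyAut k n)))) :
    g ∈ Tr k n ∨ ∃ (a b : Fin n → k) (w : PolyAut k n), IsWord φ w ∧
      g = translation a * w * translation b := by
  rw [← range_lift_zpowers_Tr] at hg
  obtain ⟨g, rfl⟩ := hg
  rcases eq_inr_or_exists_isAlternating g with ⟨τ, rfl⟩ | ⟨⟨_, a, rfl⟩, ⟨_, b, rfl⟩, w, hw, rfl⟩
  · exact Or.inl (by rw [Monoid.Coprod.lift_apply_inr]; exact τ.2)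
  · refine Or.inr ⟨a, b, _, hw.isWord, ?_⟩
    rw [map_mul, map_mul, Monoid.Coprod.lift_apply_inr, Monoid.Coprod.lift_apply_inr]
    rfl

theorem translation_mul_mul_translation_mem_Aff {a b : Fin n → k} {w : PolyAut k n}
    (h : translation a * w * translation b ∈ Aff k n) : w ∈ Aff k n := by
  have := mul_mem_Aff (mul_mem_Aff (translation_mem_Aff (-a)) h) (translation_mem_Aff (-b))
  rw [← inv_translation, ← inv_translation] at this
  convert this using 1
  group

/-- An element outside the factor of translations maps to a word flanked by translations; such a
product is non-affine, so it is not the identity. -/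
theorem isFreeProduct_of_words (hφ : ∀ w, IsWord φ w → w ∉ Aff k n) :
    IsFreeProduct (Subgroup.closure ({φ} ∪ (Tr k n : Set (PolyAut k n))))
      (Subgroup.zpowers φ) (Tr k n) := by
  refine ⟨?_, range_lift_zpowers_Tr⟩
  rw [injective_iff_map_eq_one]
  intro g hg
  rcases eq_inr_or_exists_isAlternating g with ⟨τ, rfl⟩ | ⟨⟨_, a, rfl⟩, ⟨_, b, rfl⟩, w, hw, rfl⟩
  · rw [Monoid.Coprod.lift_apply_inr] at hg
    rw [show τ = 1 from Subtype.ext hg, map_one]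
  · exfalso
    refine hφ _ hw.isWord (translation_mul_mul_translation_mem_Aff (a := a) (b := b) ?_)
    rw [map_mul, map_mul, Monoid.Coprod.lift_apply_inr, Monoid.Coprod.lift_apply_inr] at hg
    have h1 : (1 : PolyAut k n) ∈ Aff k n := translation_zero (k := k) (n := n) ▸
      translation_mem_Aff 0
    rw [← hg] at h1
    exact h1

theorem closure_inter_Aff_of_words (hφ : ∀ w, IsWord φ w → w ∉ Aff k n) :
    (Subgroup.closure ({φ} ∪ (Tr k n : Set (PolyAut k n))) : Set (PolyAut k n)) ∩ Aff k n =
      Tr k n := by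
  apply Set.Subset.antisymm
  · rintro g ⟨hg, hA⟩
    rcases mem_Tr_or_exists_isWord hg with h | ⟨a, b, w, hw, rfl⟩
    · exact h
    · exact absurd (translation_mul_mul_translation_mem_Aff hA) (hφ w hw)
  · rintro g hg
    refine ⟨Subgroup.subset_closure (Or.inr hg), ?_⟩
    obtain ⟨a, rfl⟩ := hg
    exact translation_mem_Aff a

/-- If `τ w τ'` lay in `EL`, then conjugating `τ_a` by it would be affine. Up to outer translations
that conjugate is `w τ_a w⁻¹`, again an alternating word. -/
theorem notMem_kurodaClosure_of_words
    (hφ : ∀ w, IsWord φ w → w ∉ Aff k n) :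
    φ ∉ kurodaClosure (Tr k n) (EL k n) := by
  rintro ⟨g, hg, hgA, a, ha, hc⟩
  rcases mem_Tr_or_exists_isWord hg with ⟨b, rfl⟩ | ⟨b, b', w, hw, rfl⟩
  · exact hgA (translation_mem_Aff b)
  · have h1 := hc 1
    rw [one_smul] at h1
    refine hφ _ (hw.mul_translation_mul hw.inv ha)
      (translation_mul_mul_translation_mem_Aff (a := b) (b := -b) ?_)
    convert h1 using 1
    have comm : translation b' * translation a * (translation b')⁻¹ = translation a := by
      rw [translation_mul, add_comm, ← translation_mul, mul_inv_cancel_right]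
    rw [← inv_translation, mul_inv_rev, mul_inv_rev]
    nth_rewrite 1 [← comm]
    group

end WordGroup

/-! ### Exponentials in the group generated by `φ` and the affine automorphisms -/

section AffineExp

variable {k : Type*} [Field k] {n : ℕ}

theorem D_X_mem_affineForms (i : Fin n) : D k n (X i) ∈ affineForms k n := by
  rw [X_eq_x, D_x, C_mul']
  exact Submodule.smul_mem _ _ (x_mem_affineForms _)

theorem D'_X_mem_affineForms (i : Fin n) : D' k n (X i) ∈ affineForms k n := by
  rw [X_eq_x, D'_x k n i.2, C_mul']
  exact Submodule.smul_mem _ _ (x_mem_affineForms _)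

theorem isLocallyNilpotent_C_smul_D (β : k) :
    IsLocallyNilpotent ((C β : MvPolynomial (Fin n) k) • D k n) :=
  (isLocallyNilpotent_D k n).smul ((D k n).map_algebraMap β)

theorem C_smul_D_apply (β : k) (p : MvPolynomial (Fin n) k) :
    ((C β : MvPolynomial (Fin n) k) • D k n) p = β • D k n p := by
  rw [Derivation.smul_apply, smul_eq_mul, C_mul']

/-- No `D x_j` involves `x₁`, and `D` does not see the constant added to `x₁`. -/
theorem translation_D_comm (hn : 0 < n) (c : k) (p : MvPolynomial (Fin n) k) :
    translation (Pi.single (⟨0, hn⟩ : Fin n) c) (D k n p) =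
      D k n (translation (Pi.single (⟨0, hn⟩ : Fin n) c) p) := by
  set τ := translation (Pi.single (⟨0, hn⟩ : Fin n) c)
  induction p using MvPolynomial.induction_on with
  | C a =>
    have h : ∀ a : k, D k n (C a) = 0 := (D k n).map_algebraMap
    rw [h, show τ (C a) = C a from τ.commutes a, h, map_zero]
  | add p q hp hq => simp only [map_add, hp, hq]
  | mul_X p i hp =>
    have hC : ∀ a : k, D k n (C a) = 0 := (D k n).map_algebraMap
    have hX : τ (D k n (X i)) = D k n (τ (X i)) := by
      rw [show τ (X i) = _ from translation_X _ i, map_add, hC, add_zero, X_eq_x, D_x, map_mul,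
        show τ (C ((n : k) - (↑↑i + 1))) = _ from τ.commutes _]
      by_cases h : (i : ℕ) + 1 < n
      · rw [x_succ_of_lt k n h, show τ (X _) = _ from translation_X _ _, Pi.single_eq_of_ne]
        · simp [algebraMap_eq]
        · intro h0
          have := congrArg Fin.val h0
          simp at this
      · rw [x_of_lt k n (show n < (i : ℕ) + 2 by omega), map_zero, mul_zero, mul_zero]
    simp only [Derivation.leibniz, map_add, map_mul, smul_eq_mul, hX, hp]

variable [CharZero k]

theorem expAut_mem_Aff {δ : Derivation k (MvPolynomial (Fin n) k) (MvPolynomial (Fin n) k)}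
    (hδ : IsLocallyNilpotent δ) (h : ∀ i, δ (X i) ∈ affineForms k n) : expAut δ hδ ∈ Aff k n := by
  have hmap : ∀ p ∈ affineForms k n, δ p ∈ affineForms k n := by
    intro p hp
    induction hp using Submodule.span_induction with
    | mem p hp =>
      rcases hp with rfl | ⟨i, rfl⟩
      · rw [δ.map_one_eq_zero]
        exact zero_mem _
      · exact h i
    | zero => rw [map_zero]; exact zero_mem _
    | add p q _ _ hp hq => rw [map_add]; exact add_mem hp hq
    | smul c p _ hp => rw [δ.map_smul]; exact Submodule.smul_mem _ _ hp
  rw [mem_Aff_iff]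
  intro i
  obtain ⟨m, hm⟩ := hδ (X i)
  rw [expAut_eq_sum hδ hm]
  have hiter : ∀ j, δ^[j] (X i) ∈ affineForms k n := by
    intro j
    induction j with
    | zero => exact X_mem_affineForms i
    | succ j ih => rw [Function.iterate_succ_apply']; exact hmap _ ih
  exact Submodule.sum_mem _ fun j _ => Submodule.smul_mem _ _ (hiter j)

end AffineExp

/-! ### Conjugation inside the `SL₂` generated by `exp D` and `exp D'` -/

section Bruhat

variable {k : Type*} [Field k] [CharZero k] {n : ℕ}

/-- `exp D' ∘ exp (β D) ∘ (exp D')²`. -/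
def bruhat (k : Type*) [Field k] [CharZero k] (n : ℕ) (β : k) : PolyAut k n :=
  expAut (D' k n) (isLocallyNilpotent_D' k n) *
    expAut ((C β : MvPolynomial (Fin n) k) • D k n) (isLocallyNilpotent_C_smul_D β) *
    expAut (D' k n) (isLocallyNilpotent_D' k n) ^ 2

theorem expAut_D'_D (p : MvPolynomial (Fin n) k) :
    expAut (D' k n) (isLocallyNilpotent_D' k n) (D k n p) =
      D k n (expAut (D' k n) (isLocallyNilpotent_D' k n) p) -
      H k n (expAut (D' k n) (isLocallyNilpotent_D' k n) p) -
      D' k n (expAut (D' k n) (isLocallyNilpotent_D' k n) p) := by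
  have h := expAut_apply_of_commutator (isLocallyNilpotent_D' k n) (D k n).toLinearMap
    (-(H k n).toLinearMap) (-(D' k n).toLinearMap)
    (fun p => by simpa [sub_eq_add_neg] using D'_D p)
    (fun p => by simp [D'_H, add_comm]) (fun p => by simp) p
  simpa [sub_eq_add_neg] using h

theorem expAut_D'_H (p : MvPolynomial (Fin n) k) :
    expAut (D' k n) (isLocallyNilpotent_D' k n) (H k n p) =
      H k n (expAut (D' k n) (isLocallyNilpotent_D' k n) p) +
      (2 : k) • D' k n (expAut (D' k n) (isLocallyNilpotent_D' k n) p) := by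
  have h := expAut_apply_of_commutator (isLocallyNilpotent_D' k n) (H k n).toLinearMap
    ((2 : k) • (D' k n).toLinearMap) 0
    (fun p => by simpa using D'_H p)
    (fun p => by simp) (fun p => by simp) p
  simpa using h

theorem expAut_D'_D' (p : MvPolynomial (Fin n) k) :
    expAut (D' k n) (isLocallyNilpotent_D' k n) (D' k n p) =
      D' k n (expAut (D' k n) (isLocallyNilpotent_D' k n) p) := by
  have h := expAut_apply_of_commutator (isLocallyNilpotent_D' k n) (D' k n).toLinearMap
    0 0 (fun p => by simp) (fun p => by simp) (fun p => by simp) p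
  simpa using h

theorem expAut_D_D (β : k) (p : MvPolynomial (Fin n) k) :
    expAut ((C β : MvPolynomial (Fin n) k) • D k n) (isLocallyNilpotent_C_smul_D β) (D k n p) =
      D k n
        (expAut ((C β : MvPolynomial (Fin n) k) • D k n) (isLocallyNilpotent_C_smul_D β) p) := by
  have h := expAut_apply_of_commutator (isLocallyNilpotent_C_smul_D (n := n) β)
    (D k n).toLinearMap 0 0 (fun p => by simp [C_smul_D_apply])
    (fun p => by simp) (fun p => by simp) p
  simpa using h

theorem expAut_D_H (β : k) (p : MvPolynomial (Fin n) k) :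
    expAut ((C β : MvPolynomial (Fin n) k) • D k n) (isLocallyNilpotent_C_smul_D β) (H k n p) =
      H k n (expAut ((C β : MvPolynomial (Fin n) k) • D k n) (isLocallyNilpotent_C_smul_D β) p) -
      (2 * β) • D k n
        (expAut ((C β : MvPolynomial (Fin n) k) • D k n) (isLocallyNilpotent_C_smul_D β) p) := by
  have h := expAut_apply_of_commutator (isLocallyNilpotent_C_smul_D (n := n) β)
    (H k n).toLinearMap (-(2 * β) • (D k n).toLinearMap) 0
    (fun p => by
      simp only [C_smul_D_apply, Derivation.map_smul, Derivation.coeFn_coe, LinearMap.smul_apply,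
        H_D]
      module)
    (fun p => by simp [C_smul_D_apply, Derivation.map_smul, smul_smul, mul_comm])
    (fun p => by simp) p
  simpa [sub_eq_add_neg] using h

theorem expAut_D_D' (β : k) (p : MvPolynomial (Fin n) k) :
    expAut ((C β : MvPolynomial (Fin n) k) • D k n) (isLocallyNilpotent_C_smul_D β) (D' k n p) =
      D' k n (expAut ((C β : MvPolynomial (Fin n) k) • D k n) (isLocallyNilpotent_C_smul_D β) p) +
      β • H k n
        (expAut ((C β : MvPolynomial (Fin n) k) • D k n) (isLocallyNilpotent_C_smul_D β) p) -
      β ^ 2 • D k n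
        (expAut ((C β : MvPolynomial (Fin n) k) • D k n) (isLocallyNilpotent_C_smul_D β) p) := by
  have h := expAut_apply_of_commutator (isLocallyNilpotent_C_smul_D (n := n) β)
    (D' k n).toLinearMap (β • (H k n).toLinearMap) (-(β ^ 2) • (D k n).toLinearMap)
    (fun p => by
      simp only [C_smul_D_apply, Derivation.map_smul, Derivation.coeFn_coe, LinearMap.smul_apply,
        D'_D]
      module)
    (fun p => by
      simp only [C_smul_D_apply, Derivation.map_smul, Derivation.coeFn_coe, LinearMap.smul_apply,
        H_D]
      module)
    (fun p => by
      simp only [C_smul_D_apply, Derivation.map_smul, Derivation.coeFn_coe, LinearMap.smul_apply]) p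
  simp only [Derivation.coeFn_coe, LinearMap.smul_apply, neg_smul] at h
  rw [h, sub_eq_add_neg]

/-- The word `exp D' exp (-3/2 D) (exp D')²` lies in the Borel subgroup fixing the line of `D`. -/
theorem bruhat_D (p : MvPolynomial (Fin n) k) :
    bruhat k n (-3 / 2) (D k n p) = (4 : k) • D k n (bruhat k n (-3 / 2) p) := by
  -- In `2 × 2` matrices the lower left entry of the word is `1 + 2 + 1 * 2 * β`, which vanishes for
  -- `β = -3/2`; the diagonal is then `(-2, -1/2)`, of ratio 4.
  simp only [bruhat, pow_two, AlgEquiv.mul_apply, expAut_D'_D, expAut_D'_H, expAut_D'_D',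
    expAut_D_D, expAut_D_H, expAut_D_D', map_sub, map_add, map_smul]
  module

theorem bruhat_f (hn : 0 < n) (β : k) : bruhat k n β (f k n) = f k n := by
  have hD : ((C β : MvPolynomial (Fin n) k) • D k n) (f k n) = 0 := by
    rw [C_smul_D_apply, D_f k n hn, smul_zero]
  simp only [bruhat, pow_two, AlgEquiv.mul_apply, expAut_of_mem_ker _ (D'_f k n hn),
    expAut_of_mem_ker _ hD]

theorem bruhat_mem_Aff (β : k) : bruhat k n β ∈ Aff k n := by
  have h' := expAut_mem_Aff (isLocallyNilpotent_D' k n) D'_X_mem_affineForms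
  refine mul_mem_Aff (mul_mem_Aff h' (expAut_mem_Aff _ fun i => ?_)) ?_
  · rw [C_smul_D_apply]
    exact Submodule.smul_mem _ _ (D_X_mem_affineForms i)
  · rw [pow_two]
    exact mul_mem_Aff h' h'

end Bruhat

/-! ### From `φ` to `exp (c x_n ^ r D)` -/

section KernelSubgroup

variable {k : Type*} [Field k] [CharZero k] {n : ℕ}

/-- The elements `g` of the kernel of `D` such that `exp (g D)` lies in `G`. -/
def kerExp (G : Subgroup (PolyAut k n)) : AddSubgroup (MvPolynomial (Fin n) k) where
  carrier := {g | ∃ hg : D k n g = 0,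
    expAut (g • D k n) ((isLocallyNilpotent_D k n).smul hg) ∈ G}
  zero_mem' := ⟨map_zero _, by
    have h := map_one (expKer (isLocallyNilpotent_D k n))
    change expAut ((0 : MvPolynomial (Fin n) k) • D k n) _ = 1 at h
    rw [h]
    exact one_mem G⟩
  add_mem' := by
    rintro g h ⟨hg, hgG⟩ ⟨hh, hhG⟩
    refine ⟨by rw [map_add, hg, hh, add_zero], ?_⟩
    rw [← expAut_smul_mul (isLocallyNilpotent_D k n) hg hh]
    exact mul_mem hgG hhG
  neg_mem' := by
    rintro g ⟨hg, hgG⟩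
    refine ⟨by rw [map_neg, hg, neg_zero], ?_⟩
    rw [← expAut_smul_inv (isLocallyNilpotent_D k n) hg]
    exact inv_mem hgG

/-- `B` commutes with `σ`, so the inner `σ⁻¹` and `σ` of `φ B φ²` cancel and leave `σ b σ⁻¹`. Since
`b σ⁻¹ b⁻¹ = exp (-4 f ^ l D)`, the coefficient is `1 - 4 = -3`. The unequal exponents 1 and 2
matter: with equal ones `b` would commute with `D` and nothing would remain. -/
theorem f_pow_mem_kerExp {G : Subgroup (PolyAut k n)} (hG : Aff k n ⊆ G) (hn : 0 < n) {l : ℕ}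
    (hφ : phi k hn l ∈ G) : (-3 : ℤ) • f k n ^ l ∈ kerExp G := by
  set σ := sigma k hn l with hσ
  set ε := expAut (D' k n) (isLocallyNilpotent_D' k n) with hε
  have hCβ : D k n (C (-3 / 2 : k)) = 0 := (D k n).map_algebraMap _
  set B := expAut ((C (-3 / 2 : k) : MvPolynomial (Fin n) k) • D k n)
    (isLocallyNilpotent_C_smul_D _) with hB
  set b := bruhat k n (-3 / 2) with hb
  have hbA := bruhat_mem_Aff (k := k) (n := n) (-3 / 2)
  have hBA : B ∈ Aff k n := expAut_mem_Aff _ fun i => by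
    rw [C_smul_D_apply]
    exact Submodule.smul_mem _ _ (D_X_mem_affineForms i)
  have hcomm : σ * B = B * σ := by
    have := expAut_smul_mul (isLocallyNilpotent_D k n) (D_f_pow hn l) hCβ
    have h2 := expAut_smul_mul (isLocallyNilpotent_D k n) hCβ (D_f_pow hn l)
    rw [hσ, hB, sigma, this, h2]
    exact expAut_congr (by rw [add_comm]) _ _
  have hneg : D k n (-f k n ^ l) = 0 := by rw [map_neg, D_f_pow hn, neg_zero]
  have h4 : D k n ((-4 : ℤ) • f k n ^ l) = 0 := by rw [map_zsmul, D_f_pow hn, smul_zero]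
  have hconj : b * σ⁻¹ * b⁻¹ = expAut (((-4 : ℤ) • f k n ^ l) • D k n)
      ((isLocallyNilpotent_D k n).smul h4) := by
    rw [hσ, sigma, expAut_smul_inv (isLocallyNilpotent_D k n) (D_f_pow hn l)]
    refine conj_expAut _ _ b fun p => ?_
    rw [Derivation.smul_apply, Derivation.smul_apply, smul_eq_mul, smul_eq_mul, map_mul, map_neg,
      map_pow, hb, bruhat_f hn, bruhat_D, ← C_mul', show (C 4 : MvPolynomial (Fin n) k) = 4 from
        map_ofNat C 4]
    simp only [zsmul_eq_mul]
    push_cast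
    ring
  have key : phi k hn l * B * phi k hn l ^ 2 * b⁻¹ = σ * (b * σ⁻¹ * b⁻¹) := by
    have h1 : σ⁻¹ * B = B * σ⁻¹ := by
      rw [inv_mul_eq_iff_eq_mul, ← mul_assoc, hcomm, mul_assoc, mul_inv_cancel, mul_one]
    have h2 : phi k hn l ^ 2 = σ * ε ^ 2 * σ⁻¹ := conj_pow
    calc phi k hn l * B * phi k hn l ^ 2 * b⁻¹
        = σ * ε * (σ⁻¹ * B) * (σ * ε ^ 2 * σ⁻¹) * b⁻¹ := by
          rw [h2, phi]
          simp only [mul_assoc]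
          rfl
      _ = σ * (ε * B * ε ^ 2) * σ⁻¹ * b⁻¹ := by
          rw [h1]
          group
      _ = σ * (b * σ⁻¹ * b⁻¹) := by
          rw [show ε * B * ε ^ 2 = b from rfl]
          group
  have hmem : phi k hn l * B * phi k hn l ^ 2 * b⁻¹ ∈ G :=
    mul_mem (mul_mem (mul_mem hφ (hG hBA)) (pow_mem hφ 2)) (inv_mem (hG hbA))
  have hsum := expAut_smul_mul (isLocallyNilpotent_D k n) (D_f_pow hn l) h4
  rw [key, hconj, hσ, sigma, hsum] at hmem
  refine ⟨by rw [map_zsmul, D_f_pow hn, smul_zero], ?_⟩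
  convert hmem using 4
  simp only [zsmul_eq_mul]
  push_cast
  ring

theorem translation_mem_kerExp {G : Subgroup (PolyAut k n)} (hG : Aff k n ⊆ G) (hn : 0 < n)
    (c : k) {g : MvPolynomial (Fin n) k} (hg : g ∈ kerExp G) :
    translation (Pi.single (⟨0, hn⟩ : Fin n) c) g ∈ kerExp G := by
  obtain ⟨hg0, hgG⟩ := hg
  have h0 : D k n (translation (Pi.single (⟨0, hn⟩ : Fin n) c) g) = 0 := by
    rw [← translation_D_comm, hg0, map_zero]
  refine ⟨h0, ?_⟩
  have hτ := hG (translation_mem_Aff (Pi.single (⟨0, hn⟩ : Fin n) c))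
  rw [← conj_expAut ((isLocallyNilpotent_D k n).smul hg0) _
    (translation (Pi.single (⟨0, hn⟩ : Fin n) c)) fun p => ?_]
  · exact mul_mem (mul_mem hτ hgG) (inv_mem hτ)
  · rw [Derivation.smul_apply, Derivation.smul_apply, smul_eq_mul, smul_eq_mul, map_mul,
      translation_D_comm]

/-- As a polynomial in the shift of `x₁`, `f` is dominated by its extreme monomial: the other
coordinates have degree 0, so the chord criterion holds with end degrees 1 and 0. -/
theorem exists_fwdDiff_f_pow (hn : 3 ≤ n) (l : ℕ) :
    ∃ P : Polynomial (MvPolynomial (Fin n) k),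
      (∀ a : ℕ, P.eval (a : MvPolynomial (Fin n) k) =
        translation (Pi.single (⟨0, by omega⟩ : Fin n) (a : k)) (f k n ^ l)) ∧
      P.natDegree = l * halfDeg n ∧ P.leadingCoeff = X ⟨n - 1, by omega⟩ ^ (halfDeg n * l) := by
  set y : Fin n → Polynomial (MvPolynomial (Fin n) k) :=
    fun j => if j = ⟨0, by omega⟩ then Polynomial.X + Polynomial.C (X j) else Polynomial.C (X j)
    with hy
  have hlast : y ⟨n - 1, by omega⟩ = Polynomial.C (X ⟨n - 1, by omega⟩) := by
    rw [hy]
    simp only [Fin.mk.injEq]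
    rw [if_neg (by omega)]
  have h0 : y ⟨0, by omega⟩ = Polynomial.X + Polynomial.C (X ⟨0, by omega⟩) := by
    rw [hy]
    simp
  set κ := halfDeg n
  have hM : (y ⟨0, by omega⟩ ^ κ * y ⟨n - 1, by omega⟩ ^ κ).natDegree = κ ∧
      (y ⟨0, by omega⟩ ^ κ * y ⟨n - 1, by omega⟩ ^ κ).leadingCoeff =
        X ⟨n - 1, by omega⟩ ^ κ := by
    have hm : (y ⟨0, by omega⟩ ^ κ).Monic := by
      rw [h0]
      exact (Polynomial.monic_X_add_C _).pow κ
    constructor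
    · rw [hlast, ← Polynomial.C_pow, Polynomial.natDegree_mul_C (pow_ne_zero _ (X_ne_zero _)), h0,
        Polynomial.natDegree_pow_X_add_C]
    · rw [Polynomial.leadingCoeff_mul, hm.leadingCoeff, one_mul, hlast, ← Polynomial.C_pow,
        Polynomial.leadingCoeff_C]
  have hlt := natDegree_aeval_f_sub_lt (k := k) hn y (a := 1) (b := 0)
    (by rw [h0]; exact (Polynomial.natDegree_X_add_C _).le) (by rw [hlast]; simp) fun j hj hj' => by
      have : y j = Polynomial.C (X j) := by
        rw [hy]
        exact if_neg fun h => by rw [h] at hj; simp at hj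
      rw [this, Polynomial.natDegree_C]
      omega
  rw [add_zero, mul_one] at hlt
  have hdeg : (aeval y (f k n) - y ⟨0, by omega⟩ ^ κ * y ⟨n - 1, by omega⟩ ^ κ).degree <
      (y ⟨0, by omega⟩ ^ κ * y ⟨n - 1, by omega⟩ ^ κ).degree := by
    apply Polynomial.degree_lt_degree
    rwa [hM.1]
  have hsplit := (sub_add_cancel (aeval y (f k n))
    (y ⟨0, by omega⟩ ^ κ * y ⟨n - 1, by omega⟩ ^ κ)).symm
  have hnd : (aeval y (f k n)).natDegree = κ := by
    rw [hsplit, Polynomial.natDegree_add_eq_right_of_degree_lt hdeg, hM.1]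
  have hlc : (aeval y (f k n)).leadingCoeff = X ⟨n - 1, by omega⟩ ^ κ := by
    rw [hsplit, Polynomial.leadingCoeff_add_of_degree_lt hdeg, hM.2]
  refine ⟨aeval y (f k n) ^ l, fun a => ?_, ?_, ?_⟩
  · rw [Polynomial.eval_pow, map_pow]
    congr 1
    have e : ((Polynomial.aeval (R := MvPolynomial (Fin n) k)
        (a : MvPolynomial (Fin n) k)).restrictScalars k).comp (aeval y) =
        (translation (Pi.single (⟨0, by omega⟩ : Fin n) (a : k)) :
          MvPolynomial (Fin n) k →ₐ[k] MvPolynomial (Fin n) k) := by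
      ext j : 1
      simp only [AlgHom.comp_apply, aeval_X, AlgHom.restrictScalars_apply, AlgEquiv.coe_toAlgHom,
        translation_X]
      by_cases hj : j = ⟨0, by omega⟩
      · rw [hj, h0, Pi.single_eq_same]
        simp [add_comm]
      · rw [hy, Pi.single_eq_of_ne hj]
        simp [hj]
    have := DFunLike.congr_fun e (f k n)
    rw [← Polynomial.coe_aeval_eq_eval]
    exact this
  · rw [Polynomial.natDegree_pow, hnd]
  · rw [Polynomial.leadingCoeff_pow, hlc, ← pow_mul]

/-- `kerExp G` is only known to be closed under integer combinations. A forward difference of order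
`N`, the degree in the shift, is such a combination of translates, and it equals `N!` times the
leading coefficient. -/
theorem X_last_pow_mem_kerExp {G : Subgroup (PolyAut k n)} (hG : Aff k n ⊆ G) (hn : 3 ≤ n)
    {l : ℕ} (hφ : phi k (show 0 < n by omega) l ∈ G) :
    ∃ c : k, c ≠ 0 ∧ C c * X ⟨n - 1, by omega⟩ ^ (halfDeg n * l) ∈ kerExp G := by
  obtain ⟨P, hP, hdeg, hlc⟩ := exists_fwdDiff_f_pow (k := k) hn l
  have h1 := congrFun (Polynomial.fwdDiff_iter_degree_eq_factorial P) 0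
  rw [fwdDiff_iter_eq_sum_shift] at h1
  have h2 : (-3 : ℤ) • ∑ j ∈ Finset.range (P.natDegree + 1),
      ((-1 : ℤ) ^ (P.natDegree - j) * P.natDegree.choose j) •
        P.eval (0 + j • 1 : MvPolynomial (Fin n) k) ∈ kerExp G := by
    rw [Finset.smul_sum]
    refine AddSubgroup.sum_mem _ fun j _ => ?_
    rw [smul_comm]
    refine AddSubgroup.zsmul_mem _ ?_ _
    rw [zero_add, nsmul_one, hP, ← map_zsmul]
    exact translation_mem_kerExp hG _ _ (f_pow_mem_kerExp hG _ hφ)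
  rw [h1, hlc] at h2
  refine ⟨-3 * (P.natDegree.factorial : k), ?_, ?_⟩
  · have : (P.natDegree.factorial : k) ≠ 0 := by exact_mod_cast Nat.factorial_ne_zero _
    exact mul_ne_zero (by norm_num) this
  · convert h2 using 1
    rw [map_mul, map_neg, map_natCast, show (C 3 : MvPolynomial (Fin n) k) = 3 from map_ofNat C 3,
      zsmul_eq_mul]
    simp [smul_eq_mul]
    ring

end KernelSubgroup

/-! ### Elementary automorphisms -/

section PowersSpan

variable {k : Type*} [Field k] [CharZero k]

/-- If a subspace contains the `s`-th powers of all combinations `∑ tᵢ vᵢ` with nonzero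
coefficients, then it contains all monomials of degree `s` in the `vᵢ`. -/
theorem prod_pow_mem_of_forall_sum_pow_mem {ι A : Type*} [Fintype ι] [DecidableEq ι] [CommRing A]
    [Algebra k A] (W : Submodule k A) (v : ι → A) (s : ℕ)
    (h : ∀ t : ι → k, (∀ i, t i ≠ 0) → (∑ i, t i • v i) ^ s ∈ W) (m : ι → ℕ)
    (hm : ∑ i, m i = s) : ∏ i, v i ^ m i ∈ W := by
  by_contra hc
  -- A functional `g` kills `W` but not the monomial. Then `g ((∑ tᵢ vᵢ) ^ s)` is a polynomial in
  -- `t` vanishing on `(kˣ) ^ ι`, hence zero, although one coefficient is a multinomial number times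
  -- `g` of the monomial.
  obtain ⟨g, hg, hW⟩ := Submodule.exists_le_ker_of_notMem hc
  set Q : MvPolynomial ι k := ∑ q ∈ Finset.piAntidiag Finset.univ s,
    monomial (Finsupp.equivFunOnFinite.symm q)
      ((Nat.multinomial Finset.univ q : k) * g (∏ i, v i ^ q i)) with hQ
  have heval : ∀ t : ι → k, eval t Q = g ((∑ i, t i • v i) ^ s) := by
    intro t
    rw [Finset.sum_pow_eq_sum_piAntidiag, hQ, map_sum, map_sum]
    refine Finset.sum_congr rfl fun q _ => ?_
    have e : ((Nat.multinomial Finset.univ q : A)) * ∏ i, (t i • v i) ^ q i =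
        ((Nat.multinomial Finset.univ q : k) * ∏ i, t i ^ q i) • ∏ i, v i ^ q i := by
      simp only [smul_pow, Finset.prod_smul, mul_smul, Nat.cast_smul_eq_nsmul, nsmul_eq_mul]
    rw [e, map_smul, eval_monomial, Finsupp.prod_fintype _ _ (by simp), smul_eq_mul]
    simp only [Finsupp.coe_equivFunOnFinite_symm]
    ring
  have hQ0 : Q = 0 := by
    refine MvPolynomial.funext_set (fun _ => {(0 : k)}ᶜ)
      (fun _ => (Set.finite_singleton (0 : k)).infinite_compl) fun t ht => ?_
    rw [heval, map_zero]
    exact hW (h t fun i => by simpa using ht i (Set.mem_univ i))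
  have hcoeff := congrArg (coeff (Finsupp.equivFunOnFinite.symm m)) hQ0
  rw [hQ, coeff_sum, Finset.sum_eq_single_of_mem m (by simp [hm]), coeff_monomial, if_pos rfl,
    coeff_zero] at hcoeff
  · refine (mul_ne_zero ?_ hg) hcoeff
    exact_mod_cast (Nat.multinomial_pos _ _).ne'
  · intro q _ hq
    rw [coeff_monomial, if_neg]
    exact fun e => hq (Finsupp.equivFunOnFinite.symm.injective e)

end PowersSpan

/-! ### Elementary automorphisms and their conjugates -/

section Elementary

variable {k : Type*} [Field k] {n : ℕ}

theorem map_eq_self_of_mem_supported {s : Set (Fin n)} {ψ : PolyAut k n}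
    (h : ∀ j ∈ s, ψ (X j) = X j) {p : MvPolynomial (Fin n) k} (hp : p ∈ supported k s) :
    ψ p = p := by
  have : supported k s ≤ AlgHom.equalizer (ψ : MvPolynomial (Fin n) k →ₐ[k] _)
      (AlgHom.id k (MvPolynomial (Fin n) k)) := by
    rw [supported_eq_adjoin_X]
    refine AlgHom.adjoin_le_equalizer _ _ ?_
    rintro _ ⟨j, hj, rfl⟩
    exact h j hj
  exact this hp

theorem map_mem_supported {s t : Set (Fin n)} {ψ : PolyAut k n}
    (h : ∀ j ∈ s, ψ (X j) ∈ supported k t) {p : MvPolynomial (Fin n) k}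
    (hp : p ∈ supported k s) : ψ p ∈ supported k t := by
  have : supported k s ≤
      (supported k t).comap (ψ : MvPolynomial (Fin n) k →ₐ[k] MvPolynomial (Fin n) k) := by
    rw [supported_eq_adjoin_X, Algebra.adjoin_le_iff]
    rintro _ ⟨j, hj, rfl⟩
    exact h j hj
  exact this hp

/-- The endomorphism `x_i ↦ x_i + g` fixing the other variables. -/
def elementaryHom (i : Fin n) (g : MvPolynomial (Fin n) k) :
    MvPolynomial (Fin n) k →ₐ[k] MvPolynomial (Fin n) k :=
  aeval fun j => X j + Pi.single (M := fun _ => MvPolynomial (Fin n) k) i g j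

theorem elementaryHom_comp (i : Fin n) {g h : MvPolynomial (Fin n) k}
    (hh : h ∈ supported k ({i}ᶜ : Set (Fin n))) (hgh : g + h = 0) :
    (elementaryHom i g).comp (elementaryHom i h) = AlgHom.id k _ := by
  have hfix : elementaryHom i g h = h := by
    have : supported k ({i}ᶜ : Set (Fin n)) ≤ AlgHom.equalizer (elementaryHom i g)
        (AlgHom.id k (MvPolynomial (Fin n) k)) := by
      rw [supported_eq_adjoin_X]
      refine AlgHom.adjoin_le_equalizer _ _ ?_
      rintro _ ⟨j, hj, rfl⟩
      simp [elementaryHom, Pi.single_eq_of_ne (show j ≠ i from hj)]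
    exact this hh
  ext j : 1
  by_cases hj : j = i
  · subst hj
    have hX : ∀ q : MvPolynomial (Fin n) k, elementaryHom j q (X j) = X j + q := fun q => by
      simp [elementaryHom]
    rw [AlgHom.comp_apply, AlgHom.id_apply, hX, map_add, hX, hfix, add_assoc, hgh, add_zero]
  · simp [elementaryHom, Pi.single_eq_of_ne hj]

/-- The elementary automorphism `x_i ↦ x_i + g`, where `g` does not involve `x_i`. -/
def elementary (i : Fin n) (g : MvPolynomial (Fin n) k)
    (hg : g ∈ supported k ({i}ᶜ : Set (Fin n))) : PolyAut k n :=
  AlgEquiv.ofAlgHom (elementaryHom i g) (elementaryHom i (-g))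
    (elementaryHom_comp i (neg_mem hg) (add_neg_cancel g))
    (elementaryHom_comp i hg (neg_add_cancel g))

variable {i : Fin n} {g : MvPolynomial (Fin n) k} (hg : g ∈ supported k ({i}ᶜ : Set (Fin n)))

theorem elementary_X_self : elementary i g hg (X i) = X i + g := by
  simp [elementary, elementaryHom]

theorem elementary_X_of_ne {j : Fin n} (hj : j ≠ i) : elementary i g hg (X j) = X j := by
  simp [elementary, elementaryHom, Pi.single_eq_of_ne hj]

theorem elementary_of_mem_supported {p : MvPolynomial (Fin n) k}
    (hp : p ∈ supported k ({i}ᶜ : Set (Fin n))) : elementary i g hg p = p :=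
  map_eq_self_of_mem_supported (fun _ hj => elementary_X_of_ne hg hj) hp

theorem eq_elementary {ψ : PolyAut k n} (h : ψ (X i) = X i + g) (h' : ∀ j ≠ i, ψ (X j) = X j) :
    ψ = elementary i g hg := by
  apply ext_X
  intro j
  by_cases hj : j = i
  · rw [hj, h, elementary_X_self]
  · rw [h' j hj, elementary_X_of_ne hg hj]

theorem elementary_mul {h : MvPolynomial (Fin n) k}
    (hh : h ∈ supported k ({i}ᶜ : Set (Fin n))) :
    elementary i g hg * elementary i h hh = elementary i (g + h) (add_mem hg hh) := by
  apply eq_elementary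
  · rw [AlgEquiv.mul_apply, elementary_X_self, map_add, elementary_X_self,
      elementary_of_mem_supported hg hh, add_assoc]
  · intro j hj
    rw [AlgEquiv.mul_apply, elementary_X_of_ne hh hj, elementary_X_of_ne hg hj]

theorem elementary_zero : elementary i (0 : MvPolynomial (Fin n) k) (zero_mem _) = 1 :=
  (eq_elementary _ (by simp) fun _ _ => rfl).symm

theorem elementary_inv : (elementary i g hg)⁻¹ = elementary i (-g) (neg_mem hg) := by
  rw [inv_eq_iff_mul_eq_one, elementary_mul]
  simp only [add_neg_cancel]
  exact elementary_zero

theorem elementary_mem_Aff (h : g ∈ affineForms k n) : elementary i g hg ∈ Aff k n := by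
  rw [mem_Aff_iff]
  intro j
  by_cases hj : j = i
  · rw [hj, elementary_X_self]
    exact add_mem (X_mem_affineForms i) h
  · rw [elementary_X_of_ne hg hj]
    exact X_mem_affineForms j

/-- The linear automorphism `x_i ↦ c_i x_i`. -/
def diagAut (c : Fin n → kˣ) : PolyAut k n :=
  AlgEquiv.ofAlgHom (aeval fun i => C (c i : k) * X i) (aeval fun i => C ((c i)⁻¹ : k) * X i)
    (by ext i; simp [← mul_assoc, ← C_mul, algebraMap_eq])
    (by ext i; simp [← mul_assoc, ← C_mul, algebraMap_eq])

theorem diagAut_X (c : Fin n → kˣ) (i : Fin n) : diagAut c (X i) = C (c i : k) * X i := by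
  simp [diagAut]

theorem diagAut_mem_Aff (c : Fin n → kˣ) : diagAut c ∈ Aff k n := by
  rw [mem_Aff_iff]
  intro i
  rw [diagAut_X, C_mul']
  exact Submodule.smul_mem _ _ (X_mem_affineForms i)

/-- The source of all closure properties below: diagonal `T` gives scalars, elementary `T` gives
substitutions. -/
theorem conj_elementary {T : PolyAut k n} {p : MvPolynomial (Fin n) k}
    (hp : p ∈ supported k ({i}ᶜ : Set (Fin n))) {α : k}
    (hi : T (X i) = C α * X i + p) (hT : ∀ j ≠ i, T (X j) ∈ supported k ({i}ᶜ : Set (Fin n)))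
    (hg' : C α * T⁻¹ g ∈ supported k ({i}ᶜ : Set (Fin n))) :
    T⁻¹ * elementary i g hg * T = elementary i (C α * T⁻¹ g) hg' := by
  have hC : ∀ ψ : PolyAut k n, ∀ a : k, ψ (C a) = C a := fun ψ a => ψ.commutes a
  have hinv : ∀ q, T⁻¹ (T q) = q := fun q => by rw [← AlgEquiv.mul_apply, inv_mul_cancel]; rfl
  apply eq_elementary
  · rw [AlgEquiv.mul_apply, AlgEquiv.mul_apply, hi, map_add, map_mul, hC, elementary_X_self,
      elementary_of_mem_supported hg hp, show C α * (X i + g) + p = (C α * X i + p) + C α * g by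
        ring, ← hi, map_add, hinv, map_mul, hC]
  · intro j hj
    rw [AlgEquiv.mul_apply, AlgEquiv.mul_apply, elementary_of_mem_supported hg (hT j hj), hinv]

end Elementary

/-! ### Generating all triangular automorphisms from one power of `x_n` -/

section ElementarySpace

variable {k : Type*} [Field k] {n : ℕ} {G : Subgroup (PolyAut k n)} (hG : Aff k n ⊆ G)

/-- The polynomials `g` such that `x_i ↦ x_i + g` is an elementary automorphism in `G`. -/
def elementarySpace (i : Fin n) : Submodule k (MvPolynomial (Fin n) k) where
  carrier := {g | ∃ hg, elementary i g hg ∈ G}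
  zero_mem' := ⟨zero_mem _, by rw [elementary_zero]; exact one_mem G⟩
  add_mem' := by
    rintro g h ⟨hg, hgG⟩ ⟨hh, hhG⟩
    exact ⟨add_mem hg hh, by rw [← elementary_mul hg hh]; exact mul_mem hgG hhG⟩
  smul_mem' := by
    rintro c g ⟨hg, hgG⟩
    refine ⟨Subalgebra.smul_mem _ hg c, ?_⟩
    by_cases hc : c = 0
    · subst hc
      simp only [zero_smul]
      rw [elementary_zero]
      exact one_mem G
    -- Scaling `x_i` by `c` fixes `g`, so conjugation multiplies `g` by `c`.
    · set T := diagAut (k := k) (Pi.mulSingle i (Units.mk0 c hc)) with hT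
      have hTX : ∀ j ≠ i, T (X j) = X j := fun j hj => by
        rw [hT, diagAut_X, Pi.mulSingle_eq_of_ne hj]
        simp
      have hTg : T⁻¹ g = g := by
        have := map_eq_self_of_mem_supported (ψ := T) (s := {i}ᶜ) hTX hg
        nth_rewrite 1 [← this]
        rw [← AlgEquiv.mul_apply, inv_mul_cancel]
        rfl
      have hcg : C c * T⁻¹ g ∈ supported k ({i}ᶜ : Set (Fin n)) := by
        rw [hTg, C_mul']
        exact Subalgebra.smul_mem _ hg c
      have key := conj_elementary hg (T := T) (p := 0) (zero_mem _) (α := c)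
        (by rw [hT, diagAut_X, Pi.mulSingle_eq_same]; simp)
        (fun j hj => by rw [hTX j hj]; exact X_mem_supported.mpr hj) hcg
      have hTG : T ∈ G := hG (diagAut_mem_Aff _)
      have hmem := mul_mem (mul_mem (inv_mem hTG) hgG) hTG
      rw [key] at hmem
      simpa only [hTg, C_mul'] using hmem

variable {hG}

theorem mem_elementarySpace_of_mem_affineForms {i : Fin n} {g : MvPolynomial (Fin n) k}
    (hg : g ∈ supported k ({i}ᶜ : Set (Fin n))) (h : g ∈ affineForms k n) :
    g ∈ elementarySpace hG i :=
  ⟨hg, hG (elementary_mem_Aff hg h)⟩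

theorem map_inv_mem_elementarySpace {i : Fin n} {T : PolyAut k n} (hTG : T ∈ G)
    {p : MvPolynomial (Fin n) k} (hp : p ∈ supported k ({i}ᶜ : Set (Fin n)))
    (hi : T (X i) = X i + p) (hT : ∀ j ≠ i, T (X j) ∈ supported k ({i}ᶜ : Set (Fin n)))
    (hT' : ∀ j ≠ i, T⁻¹ (X j) ∈ supported k ({i}ᶜ : Set (Fin n)))
    {g : MvPolynomial (Fin n) k} (h : g ∈ elementarySpace hG i) :
    T⁻¹ g ∈ elementarySpace hG i := by
  obtain ⟨hg, hgG⟩ := h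
  have hg' : T⁻¹ g ∈ supported k ({i}ᶜ : Set (Fin n)) :=
    map_mem_supported (fun j hj => hT' j hj) hg
  refine ⟨hg', ?_⟩
  have key := conj_elementary hg hp (T := T) (α := 1) (by rw [hi]; simp) hT (by simpa using hg')
  have hmem := mul_mem (mul_mem (inv_mem hTG) hgG) hTG
  rw [key] at hmem
  simpa using hmem

/-- Available polynomials may be substituted into one another: `x_j` may be replaced by `x_j + q`
inside `g`. -/
theorem elementary_mem_elementarySpace {i j : Fin n} (hij : i ≠ j) {q : MvPolynomial (Fin n) k}
    (hq : q ∈ elementarySpace hG j) (hqi : q ∈ supported k ({i}ᶜ : Set (Fin n)))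
    {g : MvPolynomial (Fin n) k} (h : g ∈ elementarySpace hG i) :
    elementary j q hq.1 g ∈ elementarySpace hG i := by
  obtain ⟨hqj, hqG⟩ := hq
  have hsupp : ∀ (r : MvPolynomial (Fin n) k) (hr : r ∈ supported k ({j}ᶜ : Set (Fin n))),
      r ∈ supported k ({i}ᶜ : Set (Fin n)) →
      ∀ l ≠ i, elementary j r hr (X l) ∈ supported k ({i}ᶜ : Set (Fin n)) := by
    intro r hr hri l hl
    by_cases hlj : l = j
    · rw [hlj, elementary_X_self]
      exact add_mem (X_mem_supported.mpr (hlj ▸ hl)) hri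
    · rw [elementary_X_of_ne hr hlj]
      exact X_mem_supported.mpr hl
  have := map_inv_mem_elementarySpace (hG := hG) (i := i) (T := (elementary j q hqj)⁻¹)
    (inv_mem hqG) (p := 0) (zero_mem _)
    (by rw [elementary_inv, elementary_X_of_ne _ hij, add_zero])
    (by rw [elementary_inv]; exact hsupp _ _ (neg_mem hqi))
    (by rw [inv_inv]; exact hsupp _ _ hqi) h
  rwa [inv_inv] at this

theorem rename_mem_elementarySpace (π : Equiv.Perm (Fin n)) {i : Fin n}
    {g : MvPolynomial (Fin n) k} (h : g ∈ elementarySpace hG i) :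
    rename π g ∈ elementarySpace hG (π i) := by
  obtain ⟨hg, hgG⟩ := h
  set P : PolyAut k n := renameEquiv k π with hP
  have hPX : ∀ j, P (X j) = X (π j) := fun j => by simp [hP]
  have hPA : P ∈ Aff k n := by
    rw [mem_Aff_iff]
    intro j
    rw [hPX]
    exact X_mem_affineForms _
  have hPinv : ∀ j, P⁻¹ (X j) = X (π.symm j) := fun j => by
    have : X j = P (X (π.symm j)) := by rw [hPX, Equiv.apply_symm_apply]
    rw [this, ← AlgEquiv.mul_apply, inv_mul_cancel]
    rfl
  have hPg : P g ∈ supported k ({π i}ᶜ : Set (Fin n)) := by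
    refine map_mem_supported (s := {i}ᶜ) (fun j hj => ?_) hg
    rw [hPX, X_mem_supported]
    exact fun e => hj (π.injective e)
  have hPr : P g = rename π g := rfl
  refine ⟨hPr ▸ hPg, ?_⟩
  have key : P * elementary i g hg * P⁻¹ = elementary (π i) (P g) hPg := by
    apply eq_elementary
    · rw [AlgEquiv.mul_apply, AlgEquiv.mul_apply, hPinv, Equiv.symm_apply_apply,
        elementary_X_self, map_add, hPX]
    · intro j hj
      have : π.symm j ≠ i := fun e => hj (by rw [← e, Equiv.apply_symm_apply])
      rw [AlgEquiv.mul_apply, AlgEquiv.mul_apply, hPinv, elementary_X_of_ne hg this, hPX,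
        Equiv.apply_symm_apply]
  have := mul_mem (mul_mem (hG hPA) hgG) (inv_mem (hG hPA))
  rwa [key] at this

variable [CharZero k]

/-- Affine substitutions turn `x_n ^ s` into `s`-th powers of affine forms without `x₁`.
Polarisation extracts the monomials, and a permutation moves the index from `x₁` to `x_i`. -/
theorem prod_pow_mem_elementarySpace (hn : 3 ≤ n) {s : ℕ}
    (h : (X ⟨n - 1, by omega⟩ : MvPolynomial (Fin n) k) ^ s ∈
      elementarySpace hG ⟨0, by omega⟩) (i : Fin n) (m : Fin n → ℕ) (hm : ∑ j, m j ≤ s)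
    (hmi : m i = 0) : ∏ j, (X j : MvPolynomial (Fin n) k) ^ m j ∈ elementarySpace hG i := by
  set i0 : Fin n := ⟨0, by omega⟩ with hi0
  set i1 : Fin n := ⟨n - 1, by omega⟩ with hi1
  have h01 : i0 ≠ i1 := by
    intro e
    have := congrArg Fin.val e
    simp only [hi0, hi1] at this
    omega
  -- The unused slot of `x₁` carries the constant 1, so that degree exactly `s` in `v` covers all
  -- degrees up to `s`.
  set v : Fin n → MvPolynomial (Fin n) k := fun j => if j = i0 then 1 else X j with hv
  have vaff : ∀ j, v j ∈ affineForms k n := fun j => by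
    simp only [hv]
    split_ifs
    · exact one_mem_affineForms
    · exact X_mem_affineForms j
  have vsupp0 : ∀ j, v j ∈ supported k ({i0}ᶜ : Set (Fin n)) := fun j => by
    simp only [hv]
    split_ifs with hj
    · exact one_mem _
    · exact X_mem_supported.mpr hj
  have vsupp1 : ∀ j ≠ i1, v j ∈ supported k ({i1}ᶜ : Set (Fin n)) := fun j hj' => by
    simp only [hv]
    split_ifs with hj
    · exact one_mem _
    · exact X_mem_supported.mpr hj'
  have key : ∀ t : Fin n → k, (∀ j, t j ≠ 0) →
      (∑ j, t j • v j) ^ s ∈ elementarySpace hG i0 := by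
    intro t ht
    set q := ∑ j ∈ Finset.univ.erase i1, ((t i1)⁻¹ * t j) • v j with hq
    have hq1 : q ∈ elementarySpace hG i1 := by
      refine mem_elementarySpace_of_mem_affineForms ?_ ?_
      · exact Subalgebra.sum_mem _ fun j hj =>
          Subalgebra.smul_mem _ (vsupp1 j (Finset.ne_of_mem_erase hj)) _
      · exact Submodule.sum_mem _ fun j _ => Submodule.smul_mem _ _ (vaff j)
    have hq0 : q ∈ supported k ({i0}ᶜ : Set (Fin n)) :=
      Subalgebra.sum_mem _ fun j _ => Subalgebra.smul_mem _ (vsupp0 j) _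
    have e := elementary_mem_elementarySpace h01 hq1 hq0 h
    rw [map_pow, elementary_X_self] at e
    have e2 : (∑ j, t j • v j) ^ s = (t i1) ^ s • (X i1 + q) ^ s := by
      rw [← smul_pow]
      congr 1
      rw [← Finset.add_sum_erase _ _ (Finset.mem_univ i1), smul_add, hq, Finset.smul_sum]
      congr 1
      · simp only [hv]
        rw [if_neg h01.symm]
      · refine Finset.sum_congr rfl fun j _ => ?_
        rw [smul_smul, ← mul_assoc, mul_inv_cancel₀ (ht i1), one_mul]
    rw [e2]
    exact Submodule.smul_mem _ _ e
  have base : ∀ m : Fin n → ℕ, ∑ j, m j ≤ s → m i0 = 0 →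
      ∏ j, (X j : MvPolynomial (Fin n) k) ^ m j ∈ elementarySpace hG i0 := by
    intro m hm hm0
    -- The missing degree is charged to the constant.
    have hsum : ∑ j, Function.update m i0 (s - ∑ j, m j) j = s := by
      rw [Finset.sum_update_of_mem (Finset.mem_univ _)]
      have : ∑ j, m j = m i0 + ∑ j ∈ Finset.univ \ {i0}, m j := by
        rw [← Finset.add_sum_erase _ _ (Finset.mem_univ i0), Finset.sdiff_singleton_eq_erase]
      omega
    have := prod_pow_mem_of_forall_sum_pow_mem _ v s key _ hsum
    convert this using 1
    refine Finset.prod_congr rfl fun j _ => ?_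
    by_cases hj : j = i0
    · rw [hj, hm0]
      simp [hv]
    · rw [Function.update_of_ne hj]
      simp only [hv]
      rw [if_neg hj]
  have hswap := rename_mem_elementarySpace (Equiv.swap i0 i)
    (base (fun j => m (Equiv.swap i0 i j)) (by rwa [Equiv.sum_comp (Equiv.swap i0 i) m])
      (by rw [Equiv.swap_apply_left, hmi]))
  rw [Equiv.swap_apply_left, map_prod] at hswap
  convert hswap using 1
  rw [← Equiv.prod_comp (Equiv.swap i0 i)]
  simp

/-- The degree rises by one: as `s ≥ 2`, the product `x₂ x_n` is available for `x₁`; replacing `x₂`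
by `x₂ + x_n ^ (s + d)` and subtracting leaves `x_n ^ (s + d + 1)`. Three distinct indices are
needed. -/
theorem X_last_pow_mem_elementarySpace (hn : 3 ≤ n) {s : ℕ} (hs : 2 ≤ s)
    (h : (X ⟨n - 1, by omega⟩ : MvPolynomial (Fin n) k) ^ s ∈
      elementarySpace hG ⟨0, by omega⟩) (d : ℕ) :
    (X ⟨n - 1, by omega⟩ : MvPolynomial (Fin n) k) ^ (s + d) ∈
      elementarySpace hG ⟨0, by omega⟩ := by
  induction d with
  | zero => exact h
  | succ d ih =>
    set i0 : Fin n := ⟨0, by omega⟩ with hi0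
    set i1 : Fin n := ⟨n - 1, by omega⟩ with hi1
    set i2 : Fin n := ⟨1, by omega⟩ with hi2
    have h01 : i0 ≠ i1 := fun e => by
      have := congrArg Fin.val e
      simp only [hi0, hi1] at this
      omega
    have h02 : i0 ≠ i2 := fun e => by
      have := congrArg Fin.val e
      simp [hi0, hi2] at this
    have h12 : i1 ≠ i2 := fun e => by
      have := congrArg Fin.val e
      simp only [hi1, hi2] at this
      omega
    have hq : (X i1 : MvPolynomial (Fin n) k) ^ (s + d) ∈ elementarySpace hG i2 := by
      have := prod_pow_mem_elementarySpace hn ih i2 (Pi.single i1 (s + d))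
        (by rw [Finset.sum_pi_single']; simp) (Pi.single_eq_of_ne h12.symm _)
      rwa [Finset.prod_eq_single_of_mem i1 (Finset.mem_univ _) (fun j _ hj => by
        rw [Pi.single_eq_of_ne hj, pow_zero]), Pi.single_eq_same] at this
    have h2 : (X i2 * X i1 : MvPolynomial (Fin n) k) ∈ elementarySpace hG i0 := by
      have := prod_pow_mem_elementarySpace hn ih i0 (Pi.single i1 1 + Pi.single i2 1)
        (by
          simp only [Pi.add_apply]
          rw [Finset.sum_add_distrib, Finset.sum_pi_single', Finset.sum_pi_single']
          simp
          omega)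
        (by rw [Pi.add_apply, Pi.single_eq_of_ne h01, Pi.single_eq_of_ne h02, add_zero])
      convert this using 1
      simp only [Pi.add_apply, pow_add, Finset.prod_mul_distrib]
      rw [mul_comm]
      congr 1 <;>
      rw [Finset.prod_eq_single_of_mem _ (Finset.mem_univ _) (fun j _ hj => by
        rw [Pi.single_eq_of_ne hj, pow_zero]), Pi.single_eq_same, pow_one]
    have h3 := elementary_mem_elementarySpace h02 hq
      (pow_mem (X_mem_supported.mpr h01.symm) _) h2
    rw [map_mul, elementary_X_self, elementary_X_of_ne _ h12, add_mul] at h3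
    have h4 := Submodule.sub_mem _ h3 h2
    rwa [add_sub_cancel_left, ← pow_succ] at h4

theorem supported_le_elementarySpace (hn : 3 ≤ n) {s : ℕ} (hs : 2 ≤ s)
    (h : (X ⟨n - 1, by omega⟩ : MvPolynomial (Fin n) k) ^ s ∈
      elementarySpace hG ⟨0, by omega⟩) {i : Fin n} {g : MvPolynomial (Fin n) k}
    (hg : g ∈ supported k ({i}ᶜ : Set (Fin n))) : g ∈ elementarySpace hG i := by
  rw [g.as_sum]
  refine Submodule.sum_mem _ fun m hm => ?_
  rw [monomial_eq, Finsupp.prod_fintype _ _ (by simp), C_mul']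
  refine Submodule.smul_mem _ _ (prod_pow_mem_elementarySpace hn
    (X_last_pow_mem_elementarySpace hn hs h (∑ j, m j)) i m (by omega) ?_)
  by_contra hmi
  have : i ∈ g.vars := (mem_vars_iff_mem_support i).mpr ⟨m, hm, by simpa using hmi⟩
  exact (mem_supported.mp hg this) rfl

/-- The polynomial parts are removed from the highest index down: the correction at index `r` does
not disturb the lower ones, which do not involve that variable. -/
theorem BA_subset (hn : 3 ≤ n) {s : ℕ} (hs : 2 ≤ s)
    (h : (X ⟨n - 1, by omega⟩ : MvPolynomial (Fin n) k) ^ s ∈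
      elementarySpace hG ⟨0, by omega⟩) : BA k n ⊆ G := by
  have key : ∀ (r : ℕ) (ψ : PolyAut k n) (a : Fin n → k) (p : Fin n → MvPolynomial (Fin n) k),
      (∀ i, a i ≠ 0) → (∀ i, p i ∈ supported k {j : Fin n | j < i}) →
      (∀ i, ψ (X i) = C (a i) * X i + p i) → (∀ i : Fin n, r ≤ i → p i = 0) → ψ ∈ G := by
    intro r
    induction r with
    | zero =>
      intro ψ a p _ _ hψ h0
      refine hG (mem_Aff_iff.mpr fun i => ?_)
      rw [hψ, h0 i (Nat.zero_le _), add_zero, C_mul']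
      exact Submodule.smul_mem _ _ (X_mem_affineForms i)
    | succ r ih =>
      intro ψ a p ha hp hψ h0
      by_cases hr : r < n
      · set i : Fin n := ⟨r, hr⟩ with hi
        have hpi : p i ∈ supported k ({i}ᶜ : Set (Fin n)) :=
          supported_mono (fun j hj => ne_of_lt hj) (hp i)
        have hq : (-(a i)⁻¹) • p i ∈ supported k ({i}ᶜ : Set (Fin n)) :=
          Subalgebra.smul_mem _ hpi _
        obtain ⟨_, hqG⟩ := supported_le_elementarySpace hn hs h hq
        set E := elementary i ((-(a i)⁻¹) • p i) hq with hE
        have hC : ∀ c : k, E (C c) = C c := fun c => E.commutes c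
        have hmem : E * ψ ∈ G := by
          refine ih (E * ψ) a (Function.update p i 0) ha ?_ ?_ ?_
          · intro j
            by_cases hj : j = i
            · rw [hj, Function.update_self]
              exact zero_mem _
            · rw [Function.update_of_ne hj]
              exact hp j
          · intro j
            rw [AlgEquiv.mul_apply, hψ, map_add, map_mul, hC]
            by_cases hj : j = i
            · rw [hj, Function.update_self, hE, elementary_X_self,
                elementary_of_mem_supported _ hpi, mul_add, C_mul', C_mul', smul_smul, mul_neg,
                mul_inv_cancel₀ (ha i), neg_smul, one_smul, add_assoc, neg_add_cancel]
            · rw [Function.update_of_ne hj, hE, elementary_X_of_ne _ hj]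
              congr 1
              rcases lt_or_gt_of_ne hj with hj' | hj'
              · refine elementary_of_mem_supported _ (supported_mono (fun l hl => ?_) (hp j))
                exact ne_of_lt (lt_trans hl hj')
              · rw [h0 j hj', map_zero]
          · intro j hj
            by_cases hj' : j = i
            · rw [hj', Function.update_self]
            · rw [Function.update_of_ne hj']
              refine h0 j ?_
              have : (j : ℕ) ≠ r := fun e => hj' (Fin.ext e)
              omega
        have := mul_mem (inv_mem hqG) hmem
        rwa [← mul_assoc, inv_mul_cancel, one_mul] at this
      · exact ih ψ a p ha hp hψ fun i hi => absurd i.2 (by omega)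
  rintro ψ ⟨a, p, ha, hp, hψ⟩
  exact key n ψ a p ha hp hψ fun i hi => absurd i.2 (by omega)

/-- Conjugating `x₁ ↦ x₁ + x_{n-1}` by `exp (c x_n ^ r D)` yields `x₁ ↦ x₁ + x_n ^ (r + 1)`. -/
theorem X_last_pow_succ_mem_elementarySpace (hn : 3 ≤ n) {c : k} (hc : c ≠ 0) {r : ℕ}
    (h : C c * X ⟨n - 1, by omega⟩ ^ r ∈ kerExp G) :
    (X ⟨n - 1, by omega⟩ : MvPolynomial (Fin n) k) ^ (r + 1) ∈
      elementarySpace hG ⟨0, by omega⟩ := by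
  obtain ⟨hker, hTG⟩ := h
  set i0 : Fin n := ⟨0, by omega⟩ with hi0
  set i1 : Fin n := ⟨n - 1, by omega⟩ with hi1
  set i2 : Fin n := ⟨n - 2, by omega⟩ with hi2
  set g := C c * X i1 ^ r with hg
  have h01 : i1 ≠ i0 := fun e => by
    have := congrArg Fin.val e
    simp only [hi0, hi1] at this
    omega
  have h02 : i2 ≠ i0 := fun e => by
    have := congrArg Fin.val e
    simp only [hi0, hi2] at this
    omega
  have hgs : g ∈ supported k ({i0}ᶜ : Set (Fin n)) := by
    rw [hg, C_mul']
    exact Subalgebra.smul_mem _ (pow_mem (X_mem_supported.mpr h01) _) _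
  have hx : ∀ j, x k n (j + 2) ∈ supported k ({i0}ᶜ : Set (Fin n)) := by
    intro j
    by_cases hj : j + 1 < n
    · rw [x_succ_of_lt k n hj, X_mem_supported]
      intro e
      have := congrArg Fin.val e
      simp [hi0] at this
    · rw [x_of_lt k n (by omega)]
      exact zero_mem _
  have formula : ∀ (q : MvPolynomial (Fin n) k) (hq : D k n q = 0),
      q ∈ supported k ({i0}ᶜ : Set (Fin n)) → ∀ j : Fin n,
      expAut (q • D k n) ((isLocallyNilpotent_D k n).smul hq) (X j) - X j ∈
        supported k ({i0}ᶜ : Set (Fin n)) := by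
    intro q hq hqs j
    have e := map_expAut_smul (isLocallyNilpotent_D k n) hq
      ((isLocallyNilpotent_D k n).smul hq) (aeval (X (R := k))) (X j)
    rw [← aeval_flowPt, aeval_X, flowPt_D_apply] at e
    simp only [aeval_X_left, AlgHom.id_apply] at e
    obtain ⟨n', rfl⟩ : ∃ n', n = n' + 1 := ⟨n - 1, by omega⟩
    rw [e, Finset.sum_range_succ', Nat.choose_zero_right, Nat.cast_one, pow_zero, one_mul, one_mul,
      add_zero, ← X_eq_x, add_sub_cancel_right]
    refine Subalgebra.sum_mem _ fun i _ => mul_mem (mul_mem (natCast_mem _ _) (pow_mem hqs _)) ?_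
    rw [show (j : ℕ) + (i + 1) + 1 = (j + i) + 2 by ring]
    exact hx _
  have formula' : ∀ (q : MvPolynomial (Fin n) k) (hq : D k n q = 0),
      q ∈ supported k ({i0}ᶜ : Set (Fin n)) → ∀ j ≠ i0,
      expAut (q • D k n) ((isLocallyNilpotent_D k n).smul hq) (X j) ∈
        supported k ({i0}ᶜ : Set (Fin n)) := by
    intro q hq hqs j hj
    have := add_mem (formula q hq hqs j) (X_mem_supported.mpr hj)
    rwa [sub_add_cancel] at this
  set T := expAut (g • D k n) ((isLocallyNilpotent_D k n).smul hker) with hT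
  have hker' : D k n (-g) = 0 := by rw [map_neg, hker, neg_zero]
  have hTinv : T⁻¹ = expAut ((-g) • D k n) ((isLocallyNilpotent_D k n).smul hker') :=
    expAut_smul_inv (isLocallyNilpotent_D k n) hker
  have hX2 : (X i2 : MvPolynomial (Fin n) k) ∈ elementarySpace hG i0 :=
    mem_elementarySpace_of_mem_affineForms (X_mem_supported.mpr h02) (X_mem_affineForms _)
  -- `T` moves `x₁` by a polynomial free of `x₁` and keeps the other variables free of it, since `D`
  -- only raises indices. Hence conjugation maps `x_{n-1}` to `x_{n-1} - c x_n ^ (r + 1)`, and the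
  -- difference isolates the power.
  have hmem := map_inv_mem_elementarySpace (hG := hG) hTG (formula g hker hgs i0)
    (by rw [hT]; ring) (formula' g hker hgs)
    (by rw [hTinv]; exact formula' _ hker' (neg_mem hgs)) hX2
  have hD2 : D k n (X i2) = X i1 := by
    rw [X_eq_x, D_x, show ((i2 : ℕ) : k) = (n : k) - 2 by
      simp only [hi2]; rw [Nat.cast_sub (by omega)]; norm_num, x_succ_of_lt k n
      (show (i2 : ℕ) + 1 < n by simp only [hi2]; omega)]
    rw [show (n : k) - ((n : k) - 2 + 1) = 1 by ring, C_1, one_mul]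
    congr 1
    apply Fin.ext
    simp only [hi1, hi2]
    omega
  have hD1 : D k n (X i1) = 0 := by
    rw [X_eq_x, D_x, x_of_lt k n (by simp only [hi1]; omega), mul_zero]
  have hTX : T⁻¹ (X i2) = X i2 - c • X i1 ^ (r + 1) := by
    have hit : ((-g) • D k n)^[2] (X i2) = 0 := by
      rw [iterate_smul_apply _ hker', Function.iterate_succ_apply', Function.iterate_one, hD2, hD1,
        mul_zero]
    rw [hTinv, expAut_eq_sum _ hit, Finset.sum_range_succ, Finset.sum_range_one,
      Function.iterate_zero, Function.iterate_one, Derivation.smul_apply, hD2, hg]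
    simp only [Nat.factorial, id_eq, smul_eq_mul, ← C_mul']
    simp
    ring
  rw [hTX] at hmem
  have h2 := Submodule.sub_mem _ hX2 hmem
  rw [sub_sub_cancel] at h2
  have h3 := Submodule.smul_mem _ c⁻¹ h2
  rwa [smul_smul, inv_mul_cancel₀ hc, one_smul] at h3

end ElementarySpace

theorem isCoTame_phi {k : Type*} [Field k] [CharZero k] {n l : ℕ} (hn : 3 ≤ n) (hl : 1 ≤ l) :
    IsCoTame (phi k (show 0 < n by omega) l) := by
  rw [IsCoTame, TA, Subgroup.closure_le]
  set G := Subgroup.closure ({phi k (show 0 < n by omega) l} ∪ Aff k n)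
  have hG : Aff k n ⊆ G := Set.subset_union_right.trans Subgroup.subset_closure
  have hφ : phi k (show 0 < n by omega) l ∈ G := Subgroup.subset_closure (Or.inl rfl)
  obtain ⟨c, hc, hmem⟩ := X_last_pow_mem_kerExp hG hn hφ
  have hκ : 1 ≤ halfDeg n := by rw [halfDeg]; split_ifs <;> norm_num
  have hr : 2 ≤ halfDeg n * l + 1 := by
    have := Nat.mul_le_mul hκ hl
    omega
  exact Set.union_subset hG
    (BA_subset (hG := hG) hn hr (X_last_pow_succ_mem_elementarySpace hn hc hmem))

end CoTame

end

theorem theorem2 (k : Type*) [Field k] [CharZero k] (n l : ℕ) (hn : 3 ≤ n) (hl : 1 ≤ l) :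
    ∃ (h₁ : CoTame.IsLocallyNilpotent (CoTame.f k n ^ l • CoTame.D k n))
      (h₂ : CoTame.IsLocallyNilpotent (CoTame.D' k n))
      (h₃ : CoTame.IsLocallyNilpotent ((-(CoTame.f k n ^ l)) • CoTame.D k n))
      (φ : CoTame.PolyAut k n) (G : Subgroup (CoTame.PolyAut k n)),
      φ = CoTame.expAut (CoTame.f k n ^ l • CoTame.D k n) h₁ *
        CoTame.expAut (CoTame.D' k n) h₂ *
        CoTame.expAut ((-(CoTame.f k n ^ l)) • CoTame.D k n) h₃ ∧
      G = Subgroup.closure ({φ} ∪ (CoTame.Tr k n : Set (CoTame.PolyAut k n))) ∧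
      CoTame.IsCoTame φ ∧
      CoTame.IsFreeProduct G (Subgroup.zpowers φ) (CoTame.Tr k n) ∧
      (G : Set (CoTame.PolyAut k n)) ∩ CoTame.Aff k n = CoTame.Tr k n ∧
      (∀ (s : ℕ) (i : Fin (s + 1) → ℤ) (a : Fin s → Fin n → k),
        (∀ j, i j ≠ 0) → (∀ j, a j ≠ 0) →
        φ ^ i 0 * (List.ofFn fun j : Fin s =>
          CoTame.translation (a j) * φ ^ i j.succ).prod ∉ CoTame.Aff k n) ∧
      φ ∉ CoTame.kurodaClosure (CoTame.Tr k n) (CoTame.EL k n) := by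
  have h0 : 0 < n := by omega
  have hφ : ∀ w, CoTame.IsWord (CoTame.phi k h0 l) w → w ∉ CoTame.Aff k n :=
    fun _ hw => hw.notMem_Aff hn hl
  have hD := CoTame.isLocallyNilpotent_D k n
  have hf := CoTame.D_f_pow (k := k) h0 l
  refine ⟨hD.smul hf, CoTame.isLocallyNilpotent_D' k n,
    hD.smul (by rw [map_neg, hf, neg_zero]), CoTame.phi k h0 l, _, ?_, rfl,
    CoTame.isCoTame_phi hn hl, CoTame.isFreeProduct_of_words hφ,
    CoTame.closure_inter_Aff_of_words hφ, fun s i a hi ha => hφ _ (CoTame.isWord_ofFn s i a hi ha),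
    CoTame.notMem_kurodaClosure_of_words hφ⟩
  rw [CoTame.phi, CoTame.sigma, CoTame.expAut_smul_inv hD hf]
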